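/- **Conventions.** Manifolds are smooth, finite-dimensional, Hausdorff, second countable and without boundary. A hyperKähler structure $(g,I,J,K)$ consists of a smooth non-degenerate metric $g$, which may be positive definite or indefinite, and integrable almost complex structures with $IJ=K=-JI$, such that for each $A\in\{I,J,K\}$ the metric $g$ is $A$-Hermitian and the two-form $\omega_A=g(A\cdot,\cdot)$ is closed. An action of period $T>0$ is a smooth action of the circle $\mathbb R/T\mathbb Z$. Given a vector field $X$, put $\alpha_0=g(X,\cdot)$, $\alpha_A=g(AX,\cdot)$ for $A=I,J,K$, $\lVert X\rVert^2=g(X,X)$ and $g_{\mathbb HX}=\alpha_0^2+\alpha_I^2+\alpha_J^2+\alpha_K^2$. If $dh=b_1\alpha_I+b_2\alpha_J+b_3\alpha_K$ at a point where $X\neq0$, put ${*}_3dh=b_1\,\alpha_J\wedge\alpha_K+b_2\,\alpha_K\wedge\alpha_I+b_3\,\alpha_I\wedge\alpha_J$ there. *Twists.* Let $X$ generate a circle action on $M$, let $F$ be a smooth $X$-invariant two-form on $M$ and $a$ a smooth nowhere zero function on $M$ with $da=-X\lrcorner F$. Let $\pi\colon P\to M$ be a principal circle bundle whose principal action has generator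 $Z$, with principal connection $\theta$ (so $\theta(Z)=1$) of curvature $F$, that is $d\theta=\pi^*F$. Put $\mathcal H=\ker\theta$ and $X'=\widetilde X+aZ$, where $\widetilde X$ is the horizontal lift of $X$. If $X'$ generates a free circle action and $\check\pi\colon P\to\check M$ is the (smooth) quotient by it, then $\check M$ is a *twist of $M$ by $(X,a,F)$*. Tensors on $M$ and $\check M$ are *$\mathcal H$-related*, written $\sim_{\mathcal H}$, if they induce the same tensor on $\mathcal H$: functions and covariant tensors have the same restriction to $\mathcal H$ of their pull-backs to $P$, vector fields have the same horizontal lift, and endomorphism fields lift to the same endomorphisms of $\mathcal H$. *Twisting via $(h,\lambda,a,F)$.* Let $(M,g,I,J,K)$ be a connected hyperKähler manifold with an effective circle action, generated by $X$, that preserves $g,I,J,K$. Let $h$ be a smooth function on $M$ and $\lambda\neq0$ a real constant. We say that an elementary deformation of $(M,g,X)$ *twists via $(h,\lambda,a,F)$* to $(\check M,\check g,\check X)$, where $(\check M,\check g,\check I,\check J,\check K)$ is hyperKähler and $\check X$ is a vector field on $\check M$, if $\check M$ is a twist of $M$ by $(X,a,F)$ such that * where $X\neq0$: $a=\lambda(1+h\lVert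 X\rVert^2)$, $\ dh\in\operatorname{span}(\alpha_I,\alpha_J,\alpha_K)$, $\ d{*}_3dh=0$ and $F=\lambda\bigl(d(h\alpha_0)+{*}_3dh\bigr)$; * $\check g\sim_{\mathcal H}\tilde g=g+h\,g_{\mathbb HX}$, $\ \check I\sim_{\mathcal H}I$, $\ \check J\sim_{\mathcal H}J$, $\ \check K\sim_{\mathcal H}K$ and $\check X\sim_{\mathcal H}-\tfrac1aX$. **Proposition 5.2.** Suppose that an elementary deformation of $(M,g,X)$ twists via $(h,\lambda,a,F)$ to $(\check M,\check g,\check X)$, through the double fibration $M\xleftarrow{\pi}P\xrightarrow{\check\pi}\check M$. Then there are functions $\check h,\check a$ and a two-form $\check F$ on $\check M$ with $$\check h\sim_{\mathcal H}-\lambda^2h,\qquad \check a\sim_{\mathcal H}\tfrac1a,\qquad \check F\sim_{\mathcal H}\tfrac1aF,$$ such that, with $\check\lambda=\tfrac1\lambda$, an elementary deformation of $(\check M,\check g,\check X)$ twists via $(\check h,\check\lambda,\check a,\check F)$ to $(M,g,X)$. This twist is realised by the same double fibration read backwards: the principal bundle is $\check\pi\colon P\to\check M$ with generator $X'$, its connection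 $\check\theta$ has the same horizontal distribution $\ker\check\theta=\mathcal H$, the lifted vector field $\check X'$ is $Z$, and the quotient map is $\pi$. In particular $\check M$ is connected and $\check X$ generates an effective circle action on $\check M$ preserving $\check g,\check I,\check J,\check K$. If the (effective) circle actions generated by $X$, $Z$, $X'$ have periods $T$, $T_P$, $T'$ respectively, then the effective action generated by $\check X$ has period $T\,T_P/T'$. -/

import Mathlib

open scoped Manifold ContDiff Topology

noncomputable section

namespace HKTwist

section Tensors

/-! Tensor fields on a manifold `M` without boundary modelled on a finite-dimensional real
vector space `E`. -/

/-- Vector fields. -/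
abbrev VField (E M : Type*) [NormedAddCommGroup E] [NormedSpace ℝ E]
    [TopologicalSpace M] [ChartedSpace E M] :=
  ∀ x : M, TangentSpace 𝓘(ℝ, E) x

/-- Fields of endomorphisms of the tangent spaces. -/
abbrev Endo (E M : Type*) [NormedAddCommGroup E] [NormedSpace ℝ E]
    [TopologicalSpace M] [ChartedSpace E M] :=
  ∀ x : M, TangentSpace 𝓘(ℝ, E) x →L[ℝ] TangentSpace 𝓘(ℝ, E) x

/-- Fields of bilinear forms on the tangent spaces. -/
abbrev Bilin (E M : Type*) [NormedAddCommGroup E] [NormedSpace ℝ E]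
    [TopologicalSpace M] [ChartedSpace E M] :=
  ∀ x : M, TangentSpace 𝓘(ℝ, E) x →L[ℝ] TangentSpace 𝓘(ℝ, E) x →L[ℝ] ℝ

/-- One-forms, as fields of covectors. -/
abbrev OneForm (E M : Type*) [NormedAddCommGroup E] [NormedSpace ℝ E]
    [TopologicalSpace M] [ChartedSpace E M] :=
  ∀ x : M, TangentSpace 𝓘(ℝ, E) x →L[ℝ] ℝ

/-- Differential forms of degree `k`. -/
abbrev Form (E M : Type*) [NormedAddCommGroup E] [NormedSpace ℝ E]
    [TopologicalSpace M] [ChartedSpace E M] (k : ℕ) :=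
  ∀ x : M, TangentSpace 𝓘(ℝ, E) x [⋀^Fin k]→L[ℝ] ℝ

variable {E M : Type*} [NormedAddCommGroup E] [NormedSpace ℝ E]
  [TopologicalSpace M] [ChartedSpace E M] {k : ℕ}

/-- A one-form regarded as a differential form of degree `1`. -/
def OneForm.toForm (α : OneForm E M) : Form E M 1 := fun x =>
  ContinuousAlternatingMap.ofSubsingleton ℝ (TangentSpace 𝓘(ℝ, E) x) ℝ (0 : Fin 1) (α x)

/-- The expression of a differential form in the preferred chart at `x₀`: its pull-back by the
inverse of that chart (meaningful on the target of the chart, an open subset of `E`). -/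
def Form.inChart (η : Form E M k) (x₀ : M) (y : E) : E [⋀^Fin k]→L[ℝ] ℝ :=
  (η ((extChartAt 𝓘(ℝ, E) x₀).symm y)).compContinuousLinearMap
    (mfderiv 𝓘(ℝ, E) 𝓘(ℝ, E) (extChartAt 𝓘(ℝ, E) x₀).symm y)

/-- Smoothness of a differential form. -/
def Form.Smooth (η : Form E M k) : Prop :=
  ∀ x₀ : M, ContDiffOn ℝ ∞ (η.inChart x₀) (extChartAt 𝓘(ℝ, E) x₀).target

/-- The exterior derivative, computed at `x` in the preferred chart at `x`. -/
def Form.d (η : Form E M k) : Form E M (k + 1) := fun x =>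
  (extDeriv (η.inChart x) (extChartAt 𝓘(ℝ, E) x x)).compContinuousLinearMap
    (mfderiv 𝓘(ℝ, E) 𝓘(ℝ, E) (extChartAt 𝓘(ℝ, E) x) x)

/-- Smoothness of a vector field. -/
def SmoothVField [IsManifold 𝓘(ℝ, E) ∞ M] (V : VField E M) : Prop :=
  ContMDiff 𝓘(ℝ, E) 𝓘(ℝ, E).tangent ∞ (fun x => (⟨x, V x⟩ : TangentBundle 𝓘(ℝ, E) M))

end Tensors

section HyperKahler

/-- A (pseudo-)hyperkähler structure: a smooth, symmetric, non-degenerate, possibly indefinite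
metric `g` and smooth integrable almost complex structures `I`, `J`, `K` with `IJ = K = -JI`, for
each of which `g` is Hermitian with closed fundamental two-form `g(A ·, ·)`. -/
structure HyperKahler (E M : Type*) [NormedAddCommGroup E] [NormedSpace ℝ E]
    [TopologicalSpace M] [ChartedSpace E M] [IsManifold 𝓘(ℝ, E) ∞ M] where
  g : Bilin E M
  I : Endo E M
  J : Endo E M
  K : Endo E M
  g_smooth : ContMDiff 𝓘(ℝ, E) (𝓘(ℝ, E).prod 𝓘(ℝ, E →L[ℝ] E →L[ℝ] ℝ)) ∞
    (fun x => Bundle.TotalSpace.mk' (E →L[ℝ] E →L[ℝ] ℝ)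
      (E := fun x : M => TangentSpace 𝓘(ℝ, E) x →L[ℝ] TangentSpace 𝓘(ℝ, E) x →L[ℝ] ℝ) x (g x))
  g_symm : ∀ x u v, g x u v = g x v u
  g_nondeg : ∀ x u, (∀ v, g x u v = 0) → u = 0
  smooth_endo : ∀ A : Endo E M, A = I ∨ A = J ∨ A = K →
    ContMDiff 𝓘(ℝ, E) (𝓘(ℝ, E).prod 𝓘(ℝ, E →L[ℝ] E)) ∞
      (fun x => Bundle.TotalSpace.mk' (E →L[ℝ] E)
        (E := fun x : M => TangentSpace 𝓘(ℝ, E) x →L[ℝ] TangentSpace 𝓘(ℝ, E) x) x (A x))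
  I_sq : ∀ x u, I x (I x u) = -u
  J_sq : ∀ x u, J x (J x u) = -u
  I_J : ∀ x u, I x (J x u) = K x u
  J_I : ∀ x u, J x (I x u) = -K x u
  hermitian : ∀ A : Endo E M, A = I ∨ A = J ∨ A = K →
    ∀ x u v, g x (A x u) (A x v) = g x u v
  /-- Vanishing of the Nijenhuis tensors. -/
  integrable : ∀ A : Endo E M, A = I ∨ A = J ∨ A = K →
    ∀ V W : VField E M, SmoothVField V → SmoothVField W → ∀ x,
      VectorField.mlieBracket 𝓘(ℝ, E) (fun y => A y (V y)) (fun y => A y (W y)) x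
        - A x (VectorField.mlieBracket 𝓘(ℝ, E) (fun y => A y (V y)) W x)
        - A x (VectorField.mlieBracket 𝓘(ℝ, E) V (fun y => A y (W y)) x)
        - VectorField.mlieBracket 𝓘(ℝ, E) V W x = 0
  closed : ∀ A : Endo E M, A = I ∨ A = J ∨ A = K →
    ∃ η : Form E M 2, (∀ x u v, η x ![u, v] = g x (A x u) v) ∧ η.Smooth ∧ ∀ x, η.d x = 0

variable {E M : Type*} [NormedAddCommGroup E] [NormedSpace ℝ E]
  [TopologicalSpace M] [ChartedSpace E M] [IsManifold 𝓘(ℝ, E) ∞ M]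

/-- `α₀ = g(X, ·)`. -/
def HyperKahler.alpha0 (S : HyperKahler E M) (X : VField E M) : OneForm E M :=
  fun x => S.g x (X x)

/-- `α_I = g(IX, ·)`. -/
def HyperKahler.alphaI (S : HyperKahler E M) (X : VField E M) : OneForm E M :=
  fun x => S.g x (S.I x (X x))

/-- `α_J = g(JX, ·)`. -/
def HyperKahler.alphaJ (S : HyperKahler E M) (X : VField E M) : OneForm E M :=
  fun x => S.g x (S.J x (X x))

/-- `α_K = g(KX, ·)`. -/
def HyperKahler.alphaK (S : HyperKahler E M) (X : VField E M) : OneForm E M :=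
  fun x => S.g x (S.K x (X x))

/-- `‖X‖² = g(X, X)`. -/
def HyperKahler.normSq (S : HyperKahler E M) (X : VField E M) (x : M) : ℝ :=
  S.g x (X x) (X x)

/-- The square `α² = α ⊗ α` of a one-form. -/
def OneForm.sq (α : OneForm E M) : Bilin E M := fun x => (α x).smulRight (α x)

/-- The elementary deformation
`g + h (α₀² + α_I² + α_J² + α_K²)` of the metric along `X` by the function `h`. -/
def HyperKahler.elemDeform (S : HyperKahler E M) (X : VField E M) (h : M → ℝ) : Bilin E M :=
  fun x => S.g x + h x • (OneForm.sq (S.alpha0 X) x + OneForm.sq (S.alphaI X) x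
    + OneForm.sq (S.alphaJ X) x + OneForm.sq (S.alphaK X) x)

/-- `(α ∧ β)(u, v)`. -/
def wedge {V : Type*} (α β : V → ℝ) (u v : V) : ℝ := α u * β v - α v * β u

/-- `dh` lies in the span of `α_I, α_J, α_K` at `x` and `σ = *₃ dh` there, where `*₃` is the Hodge
star on that span for which `α_I, α_J, α_K` is an oriented orthonormal basis:
`dh = b₁ α_I + b₂ α_J + b₃ α_K` and
`σ = b₁ α_J ∧ α_K + b₂ α_K ∧ α_I + b₃ α_I ∧ α_J`. -/
def HyperKahler.IsStarThree (S : HyperKahler E M) (X : VField E M) (h : M → ℝ)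
    (σ : Form E M 2) (x : M) : Prop :=
  ∃ b₁ b₂ b₃ : ℝ,
    (∀ u : TangentSpace 𝓘(ℝ, E) x, (mfderiv 𝓘(ℝ, E) 𝓘(ℝ, ℝ) h x u : ℝ)
      = b₁ * S.alphaI X x u + b₂ * S.alphaJ X x u + b₃ * S.alphaK X x u) ∧
    ∀ u v : TangentSpace 𝓘(ℝ, E) x, σ x ![u, v]
      = b₁ * wedge (S.alphaJ X x) (S.alphaK X x) u v
      + b₂ * wedge (S.alphaK X x) (S.alphaI X x) u v
      + b₃ * wedge (S.alphaI X x) (S.alphaJ X x) u v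

end HyperKahler

section CircleActions

variable {E M : Type*} [NormedAddCommGroup E] [NormedSpace ℝ E]
  [TopologicalSpace M] [ChartedSpace E M]

/-- `φ` is a smooth action of the circle `ℝ / Tℤ`, written as a `T`-periodic flow, and its
generator is the vector field `X`. -/
structure IsCircleFlow (T : ℝ) (X : VField E M) (φ : ℝ → M → M) : Prop where
  period_pos : 0 < T
  smooth : ContMDiff (𝓘(ℝ, ℝ).prod 𝓘(ℝ, E)) 𝓘(ℝ, E) ∞ (fun q : ℝ × M => φ q.1 q.2)
  map_zero : ∀ x, φ 0 x = x
  map_add : ∀ s t x, φ (s + t) x = φ s (φ t x)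
  periodic : ∀ x, φ T x = x
  generator : ∀ x, IsMIntegralCurve (I := 𝓘(ℝ, E)) (fun t => φ t x) X

/-- The action of `ℝ / Tℤ` is effective. -/
def IsEffectiveFlow (T : ℝ) (φ : ℝ → M → M) : Prop :=
  ∀ t, (∀ x, φ t x = x) → ∃ n : ℤ, t = n * T

/-- The action of `ℝ / Tℤ` is free. -/
def IsFreeFlow (T : ℝ) (φ : ℝ → M → M) : Prop :=
  ∀ t x, φ t x = x → ∃ n : ℤ, t = n * T

/-- The one-parameter group `φ` preserves the bilinear form `b`. -/
def PreservesBilin (φ : ℝ → M → M) (b : Bilin E M) : Prop :=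
  ∀ t x (u v : TangentSpace 𝓘(ℝ, E) x),
    b (φ t x) (mfderiv 𝓘(ℝ, E) 𝓘(ℝ, E) (φ t) x u) (mfderiv 𝓘(ℝ, E) 𝓘(ℝ, E) (φ t) x v) = b x u v

/-- The one-parameter group `φ` preserves the field of endomorphisms `A`. -/
def PreservesEndo (φ : ℝ → M → M) (A : Endo E M) : Prop :=
  ∀ t x (u : TangentSpace 𝓘(ℝ, E) x),
    mfderiv 𝓘(ℝ, E) 𝓘(ℝ, E) (φ t) x (A x u) = A (φ t x) (mfderiv 𝓘(ℝ, E) 𝓘(ℝ, E) (φ t) x u)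

/-- The one-parameter group `φ` preserves the two-form `F`. -/
def PreservesTwoForm (φ : ℝ → M → M) (F : Form E M 2) : Prop :=
  ∀ t x (u v : TangentSpace 𝓘(ℝ, E) x),
    F (φ t x) ![mfderiv 𝓘(ℝ, E) 𝓘(ℝ, E) (φ t) x u, mfderiv 𝓘(ℝ, E) 𝓘(ℝ, E) (φ t) x v]
      = F x ![u, v]

/-- The one-parameter group `φ` preserves the one-form `θ`. -/
def PreservesOneForm (φ : ℝ → M → M) (θ : OneForm E M) : Prop :=
  ∀ t x (u : TangentSpace 𝓘(ℝ, E) x),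
    θ (φ t x) (mfderiv 𝓘(ℝ, E) 𝓘(ℝ, E) (φ t) x u) = θ x u

/-- `X` generates an effective action of `ℝ / Tℤ` by triholomorphic isometries. -/
def IsTriholomorphicCircleAction [IsManifold 𝓘(ℝ, E) ∞ M]
    (T : ℝ) (S : HyperKahler E M) (X : VField E M) : Prop :=
  ∃ φ : ℝ → M → M, IsCircleFlow T X φ ∧ IsEffectiveFlow T φ ∧
    PreservesBilin φ S.g ∧ PreservesEndo φ S.I ∧ PreservesEndo φ S.J ∧ PreservesEndo φ S.K

end CircleActions

section Twist

variable {E M EP P EW W : Type*}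
  [NormedAddCommGroup E] [NormedSpace ℝ E] [TopologicalSpace M] [ChartedSpace E M]
  [NormedAddCommGroup EP] [NormedSpace ℝ EP] [TopologicalSpace P] [ChartedSpace EP P]
  [NormedAddCommGroup EW] [NormedSpace ℝ EW] [TopologicalSpace W] [ChartedSpace EW W]

/-- `pr : P → M` is a principal bundle for the circle `ℝ / Tℤ`, whose principal action is generated
by `Z`: a surjective submersion whose fibres are the orbits of a free action. -/
structure IsPrincipalCircleBundle (T : ℝ) (pr : P → M) (Z : VField EP P) : Prop where
  smooth : ContMDiff 𝓘(ℝ, EP) 𝓘(ℝ, E) ∞ pr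
  submersion : Manifold.IsSubmersion 𝓘(ℝ, EP) 𝓘(ℝ, E) ∞ pr
  surjective : Function.Surjective pr
  action : ∃ φ : ℝ → P → P, IsCircleFlow T Z φ ∧ IsFreeFlow T φ ∧
    ∀ p q, pr p = pr q ↔ ∃ t, φ t p = q

/-- `θ` is a principal connection on the principal circle bundle with generator `Z` of
period `T`. -/
structure IsConnection (T : ℝ) (Z : VField EP P) (θ : OneForm EP P) : Prop where
  smooth : (OneForm.toForm θ).Smooth
  generator : ∀ p, θ p (Z p) = 1
  invariant : ∀ φ : ℝ → P → P, IsCircleFlow T Z φ → PreservesOneForm φ θ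

/-- `(pr, prW, P, Z, θ)` exhibits `W` as the twist of `M` by `X` with respect to `(a, F)`.
The circle bundle `pr : P → M` with principal generator `Z` has connection `θ` of curvature `F`;
`F` is `X`-invariant and `da = -X ⌟ F` with `a` nowhere zero; the vector field `X' = X̃ + a Z`,
where `X̃` is the horizontal lift of `X`, generates a free circle action, and
`prW : P → W` is the quotient by it.  The numbers `T`, `TP`, `TW` are the periods of the circle
actions generated by `X`, `Z`, `X'`. -/
structure IsTwist (T TP TW : ℝ) (X : VField E M) (a : M → ℝ) (F : Form E M 2)
    (pr : P → M) (Z : VField EP P) (θ : OneForm EP P) (X' : VField EP P) (prW : P → W) : Prop where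
  bundle : IsPrincipalCircleBundle (E := E) TP pr Z
  connection : IsConnection TP Z θ
  F_smooth : F.Smooth
  curvature : ∀ p (u v : TangentSpace 𝓘(ℝ, EP) p), (OneForm.toForm θ).d p ![u, v]
    = F (pr p) ![mfderiv 𝓘(ℝ, EP) 𝓘(ℝ, E) pr p u, mfderiv 𝓘(ℝ, EP) 𝓘(ℝ, E) pr p v]
  F_invariant : ∀ φ : ℝ → M → M, IsCircleFlow T X φ → PreservesTwoForm φ F
  a_smooth : ContMDiff 𝓘(ℝ, E) 𝓘(ℝ, ℝ) ∞ a
  a_ne_zero : ∀ x, a x ≠ 0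
  da : ∀ x (u : TangentSpace 𝓘(ℝ, E) x),
    (mfderiv 𝓘(ℝ, E) 𝓘(ℝ, ℝ) a x u : ℝ) = -F x ![X x, u]
  /-- `X' - a Z` is the horizontal lift of `X`. -/
  lift : ∀ p, θ p (X' p - a (pr p) • Z p) = 0 ∧
    mfderiv 𝓘(ℝ, EP) 𝓘(ℝ, E) pr p (X' p - a (pr p) • Z p) = X (pr p)
  quotient : IsPrincipalCircleBundle (E := EW) TW prW X'

/-- `f ∘ pr = f' ∘ prW`: the functions `f` on `M` and `f'` on `W` are related. -/
def RelFun (pr : P → M) (prW : P → W) (f : M → ℝ) (f' : W → ℝ) : Prop :=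
  ∀ p, f' (prW p) = f (pr p)

/-- The vector fields `Y` on `M` and `Y'` on `W` are `H`-related, `H = ker θ`: they have the same
horizontal lift to `P`. -/
def RelVField (θ : OneForm EP P) (pr : P → M) (prW : P → W)
    (Y : VField E M) (Y' : VField EW W) : Prop :=
  ∀ p, ∃ v : TangentSpace 𝓘(ℝ, EP) p, θ p v = 0 ∧
    mfderiv 𝓘(ℝ, EP) 𝓘(ℝ, E) pr p v = Y (pr p) ∧
    mfderiv 𝓘(ℝ, EP) 𝓘(ℝ, EW) prW p v = Y' (prW p)

/-- The bilinear forms `b` on `M` and `b'` on `W` are `H`-related: their pull-backs to `P` agree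
on `H = ker θ`. -/
def RelBilin (θ : OneForm EP P) (pr : P → M) (prW : P → W)
    (b : Bilin E M) (b' : Bilin EW W) : Prop :=
  ∀ p (u v : TangentSpace 𝓘(ℝ, EP) p), θ p u = 0 → θ p v = 0 →
    b' (prW p) (mfderiv 𝓘(ℝ, EP) 𝓘(ℝ, EW) prW p u) (mfderiv 𝓘(ℝ, EP) 𝓘(ℝ, EW) prW p v)
      = b (pr p) (mfderiv 𝓘(ℝ, EP) 𝓘(ℝ, E) pr p u) (mfderiv 𝓘(ℝ, EP) 𝓘(ℝ, E) pr p v)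

/-- The two-forms `F` on `M` and `F'` on `W` are `H`-related: their pull-backs to `P` agree
on `H = ker θ`. -/
def RelTwoForm (θ : OneForm EP P) (pr : P → M) (prW : P → W)
    (F : Form E M 2) (F' : Form EW W 2) : Prop :=
  ∀ p (u v : TangentSpace 𝓘(ℝ, EP) p), θ p u = 0 → θ p v = 0 →
    F' (prW p) ![mfderiv 𝓘(ℝ, EP) 𝓘(ℝ, EW) prW p u, mfderiv 𝓘(ℝ, EP) 𝓘(ℝ, EW) prW p v]
      = F (pr p) ![mfderiv 𝓘(ℝ, EP) 𝓘(ℝ, E) pr p u, mfderiv 𝓘(ℝ, EP) 𝓘(ℝ, E) pr p v]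

/-- The endomorphism fields `A` on `M` and `A'` on `W` are `H`-related: they lift to the same
endomorphisms of `H = ker θ`. -/
def RelEndo (θ : OneForm EP P) (pr : P → M) (prW : P → W)
    (A : Endo E M) (A' : Endo EW W) : Prop :=
  ∀ p (u : TangentSpace 𝓘(ℝ, EP) p), θ p u = 0 →
    ∃ v : TangentSpace 𝓘(ℝ, EP) p, θ p v = 0 ∧
      mfderiv 𝓘(ℝ, EP) 𝓘(ℝ, E) pr p v = A (pr p) (mfderiv 𝓘(ℝ, EP) 𝓘(ℝ, E) pr p u) ∧
      mfderiv 𝓘(ℝ, EP) 𝓘(ℝ, EW) prW p v = A' (prW p) (mfderiv 𝓘(ℝ, EP) 𝓘(ℝ, EW) prW p u)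

/-- An elementary deformation of the connected hyperkähler manifold `(M, S)`, with its effective
triholomorphic circle action generated by `X`, twists via `(h, lam, a, F)` to the
hyperkähler manifold `(W, S')` with vector field `Y`.  The twist is realised by the double
fibration `M ← P → W` with maps `pr`, `prW`, generators `Z`, `X'`, and connection `θ`; the
circle actions generated by `X`, `Z`, `X'` have periods `T`, `TP`, `TW`. -/
structure TwistsVia [IsManifold 𝓘(ℝ, E) ∞ M] [IsManifold 𝓘(ℝ, EW) ∞ W]
    (T TP TW : ℝ) (S : HyperKahler E M) (X : VField E M)
    (h : M → ℝ) (lam : ℝ) (a : M → ℝ) (F : Form E M 2)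
    (pr : P → M) (Z : VField EP P) (θ : OneForm EP P) (X' : VField EP P) (prW : P → W)
    (S' : HyperKahler EW W) (Y : VField EW W) : Prop where
  connected : ConnectedSpace M
  action : IsTriholomorphicCircleAction T S X
  h_smooth : ContMDiff 𝓘(ℝ, E) 𝓘(ℝ, ℝ) ∞ h
  lam_ne_zero : lam ≠ 0
  /-- `a = lam (1 + h ‖X‖²)` where `X ≠ 0`. -/
  a_eq : ∀ x, X x ≠ 0 → a x = lam * (1 + h x * S.normSq X x)
  /-- Where `X ≠ 0`: `dh` is in the span of `α_I, α_J, α_K`, `d *₃ dh = 0`, and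
  `F = lam (d(h α₀) + *₃ dh)`. -/
  F_eq : ∃ σ : Form E M 2, ∀ x, X x ≠ 0 →
    S.IsStarThree X h σ x ∧ σ.d x = 0 ∧
    F x = lam • ((OneForm.toForm (fun y => h y • S.alpha0 X y)).d x + σ x)
  twist : IsTwist (EW := EW) T TP TW X a F pr Z θ X' prW
  rel_g : RelBilin θ pr prW (S.elemDeform X h) S'.g
  rel_I : RelEndo θ pr prW S.I S'.I
  rel_J : RelEndo θ pr prW S.J S'.J
  rel_K : RelEndo θ pr prW S.K S'.K
  /-- `Y` is `H`-related to `-(1/a) X`. -/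
  rel_X : RelVField θ pr prW (fun x => -(1 / a x) • X x) Y

end Twist

end HKTwist

end

set_option linter.unusedSectionVars false

noncomputable section

namespace HKTwist

/-! The double fibration becomes symmetric once the connection is rescaled. Since θ(X') = a, the
form θ' = θ/a has the kernel of θ and takes the value 1 on X'. By Cartan's formula, da = -X⌟F gives
L_{X'}θ = 0; as a is also X-invariant, θ' is a connection for `prW`
(`twistedConnection_isConnection`). Its differential F/a - a⁻² da∧θ is invariant and annihilates X',
so it descends to F' (`exists_curvature_descent`). The horizontal lift of -X/a is Z - X'/a, which
`prW` maps to the same vector as Z; hence Z projects to Y (`mfderiv_prW_Z`), and the fibration read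
backwards is a twist (`IsTwist.inverse`).

For the geometry, X, IX, JX, KX are orthogonal with the same square norm, so the deformed metric
pairs each of them with any vector as (1 + h‖X‖²)g = (a/λ)g. As Y is related to -X/a, each form α'
of Y is related to -α/λ (`alpha0_related`, `alpha_related`). Therefore h' = -λ²h undoes the
deformation, and ‖Y‖² = ‖X‖²/(λa) yields the formula for a'. The pull-back of h'α₀' is λhα₀ - θ +
λθ' (`pullback_alpha0`), so σ' = λF' - d(h'α₀') pulls back to λ times the pull-back of *₃dh, and
this is what *₃dh' requires (`curvature_inverse`).

For the action, the flow of Z commutes with that of X' and induces the flow of Y, which preserves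
every tensor related to one on M because the flow of Z covers the identity of M and preserves θ. The
period is found by comparing two commuting free circle actions on the connected space P
(`effective_period`): a map of finite order that commutes with a free circle action and preserves
its orbits is a rotation. -/

lemma minSmoothness_two_le_infty : minSmoothness ℝ 2 ≤ (∞ : WithTop ℕ∞) := by
  rw [minSmoothness_of_isRCLikeNormedField]
  exact WithTop.coe_le_coe.2 (le_top : (2 : ℕ∞) ≤ ⊤)

lemma extDeriv_pullback_of_contDiffAt {V W : Type*} [NormedAddCommGroup V] [NormedSpace ℝ V]
    [NormedAddCommGroup W] [NormedSpace ℝ W] {k : ℕ} {η : W → W [⋀^Fin k]→L[ℝ] ℝ} {F : V → W}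
    {y : V} (hη : ContDiffAt ℝ ∞ η (F y)) (hF : ContDiffAt ℝ ∞ F y) :
    extDeriv (fun z => (η (F z)).compContinuousLinearMap (fderiv ℝ F z)) y =
      (extDeriv η (F y)).compContinuousLinearMap (fderiv ℝ F y) :=
  extDeriv_pullback (hη.differentiableAt (by simp)) hF minSmoothness_two_le_infty

/-! ### Coordinate charts. -/

section Charts

variable {E M : Type*} [NormedAddCommGroup E] [NormedSpace ℝ E]
  [TopologicalSpace M] [ChartedSpace E M] [IsManifold 𝓘(ℝ, E) ∞ M]

lemma mdifferentiableAt_extChartAt_symm' (x₀ : M) {y : E}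
    (hy : y ∈ (extChartAt 𝓘(ℝ, E) x₀).target) :
    MDifferentiableAt 𝓘(ℝ, E) 𝓘(ℝ, E) (extChartAt 𝓘(ℝ, E) x₀).symm y :=
  ((contMDiffOn_extChartAt_symm (n := ∞) x₀).contMDiffAt
    ((isOpen_extChartAt_target x₀).mem_nhds hy)).mdifferentiableAt (by simp)

lemma contMDiffAt_extChartAt_symm (x₀ : M) {y : E}
    (hy : y ∈ (extChartAt 𝓘(ℝ, E) x₀).target) :
    ContMDiffAt 𝓘(ℝ, E) 𝓘(ℝ, E) ∞ (extChartAt 𝓘(ℝ, E) x₀).symm y :=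
  (contMDiffOn_extChartAt_symm (n := ∞) x₀).contMDiffAt
    ((isOpen_extChartAt_target x₀).mem_nhds hy)

lemma mdifferentiableAt_extChartAt' (x₀ : M) {x : M}
    (hx : x ∈ (extChartAt 𝓘(ℝ, E) x₀).source) :
    MDifferentiableAt 𝓘(ℝ, E) 𝓘(ℝ, E) (extChartAt 𝓘(ℝ, E) x₀) x :=
  haveI : IsManifold 𝓘(ℝ, E) 1 M := .of_le (n := ∞) (by simp)
  mdifferentiableAt_extChartAt (by simpa using hx)

lemma mfderiv_extChartAt_symm_comp (x₀ : M) {x : M}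
    (hx : x ∈ (extChartAt 𝓘(ℝ, E) x₀).source) (u : TangentSpace 𝓘(ℝ, E) x) :
    mfderiv 𝓘(ℝ, E) 𝓘(ℝ, E) (extChartAt 𝓘(ℝ, E) x₀).symm (extChartAt 𝓘(ℝ, E) x₀ x)
      (mfderiv 𝓘(ℝ, E) 𝓘(ℝ, E) (extChartAt 𝓘(ℝ, E) x₀) x u) = u := by
  have h1 := mdifferentiableAt_extChartAt_symm' x₀ ((extChartAt 𝓘(ℝ, E) x₀).map_source hx)
  have h2 := mfderiv_comp x h1 (mdifferentiableAt_extChartAt' x₀ hx)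
  have h3 : ((extChartAt 𝓘(ℝ, E) x₀).symm ∘ (extChartAt 𝓘(ℝ, E) x₀)) =ᶠ[𝓝 x] id := by
    filter_upwards [(isOpen_extChartAt_source x₀).mem_nhds hx] with z hz
    exact (extChartAt 𝓘(ℝ, E) x₀).left_inv hz
  rw [h3.mfderiv_eq, mfderiv_id] at h2
  exact (DFunLike.congr_fun h2 u).symm

end Charts

/-! ### Pull-back and exterior derivative of forms on manifolds. -/

section Pullback

variable {E M E' N : Type*}
  [NormedAddCommGroup E] [NormedSpace ℝ E] [TopologicalSpace M] [ChartedSpace E M]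
  [IsManifold 𝓘(ℝ, E) ∞ M]
  [NormedAddCommGroup E'] [NormedSpace ℝ E'] [TopologicalSpace N] [ChartedSpace E' N]
  [IsManifold 𝓘(ℝ, E') ∞ N]
  {k : ℕ}

/-- All tangent spaces are definitionally the model space, so the base point can be replaced by an
equal one without casting the vectors. -/
lemma Form.apply_congr (η : Form E M k) {p q : M} (h : p = q) (v : Fin k → E) :
    (η p : (Fin k → E) → ℝ) v = (η q : (Fin k → E) → ℝ) v := by
  subst h; rfl

/-- Pull-back of a differential form. -/
def Form.pullback (f : N → M) (η : Form E M k) : Form E' N k := fun x =>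
  (η (f x)).compContinuousLinearMap (mfderiv 𝓘(ℝ, E') 𝓘(ℝ, E) f x)

/-- Smoothness of a differential form at a point, in the preferred chart there. -/
def Form.SmoothAt (η : Form E M k) (x : M) : Prop :=
  ContDiffAt ℝ ∞ (η.inChart x) (extChartAt 𝓘(ℝ, E) x x)

lemma Form.inChart_pullback (f : N → M) (η : Form E M k) (x₀ : N) (y₀ : M) {y : E'}
    (hy : y ∈ (extChartAt 𝓘(ℝ, E') x₀).target)
    (hf : MDifferentiableAt 𝓘(ℝ, E') 𝓘(ℝ, E) f ((extChartAt 𝓘(ℝ, E') x₀).symm y))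
    (hfy : f ((extChartAt 𝓘(ℝ, E') x₀).symm y) ∈ (extChartAt 𝓘(ℝ, E) y₀).source) :
    (η.pullback f : Form E' N k).inChart x₀ y =
      (η.inChart y₀ (extChartAt 𝓘(ℝ, E) y₀ (f ((extChartAt 𝓘(ℝ, E') x₀).symm y)))
        ).compContinuousLinearMap
        (fderiv ℝ (fun z => extChartAt 𝓘(ℝ, E) y₀ (f ((extChartAt 𝓘(ℝ, E') x₀).symm z))) y) := by
  set φ := extChartAt 𝓘(ℝ, E') x₀
  set ψ := extChartAt 𝓘(ℝ, E) y₀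
  have hφ := mdifferentiableAt_extChartAt_symm' x₀ hy
  have hg : MDifferentiableAt 𝓘(ℝ, E') 𝓘(ℝ, E) (f ∘ φ.symm) y := hf.comp y hφ
  have hψ := mdifferentiableAt_extChartAt' y₀ hfy
  have hG : MDifferentiableAt 𝓘(ℝ, E') 𝓘(ℝ, E) (ψ ∘ (f ∘ φ.symm)) y := hψ.comp y hg
  ext v
  simp only [Form.inChart, Form.pullback, ContinuousAlternatingMap.compContinuousLinearMap_apply]
  refine (Form.apply_congr η (ψ.left_inv hfy).symm _).trans ?_
  refine congrArg _ (funext fun i => ?_)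
  simp only [Function.comp_apply]
  have e1 : mfderiv 𝓘(ℝ, E') 𝓘(ℝ, E) f (φ.symm y) (mfderiv 𝓘(ℝ, E') 𝓘(ℝ, E') φ.symm y (v i))
      = mfderiv 𝓘(ℝ, E') 𝓘(ℝ, E) (f ∘ φ.symm) y (v i) := by
    rw [mfderiv_comp y hf hφ]; rfl
  have e2 : mfderiv 𝓘(ℝ, E') 𝓘(ℝ, E) (ψ ∘ (f ∘ φ.symm)) y (v i) =
      mfderiv 𝓘(ℝ, E) 𝓘(ℝ, E) ψ (f (φ.symm y))
        (mfderiv 𝓘(ℝ, E') 𝓘(ℝ, E) (f ∘ φ.symm) y (v i)) := by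
    rw [mfderiv_comp y hψ hg]; rfl
  refine e1.trans ?_
  have e3 := mfderiv_extChartAt_symm_comp y₀ hfy
    (mfderiv 𝓘(ℝ, E') 𝓘(ℝ, E) (f ∘ φ.symm) y (v i))
  refine e3.symm.trans ?_
  refine congrArg _ (e2.symm.trans ?_)
  rw [mfderiv_eq_fderiv]; rfl

lemma Form.inChart_congr {η η' : Form E M k} {x₀ : M} {y : E}
    (h : η ((extChartAt 𝓘(ℝ, E) x₀).symm y) = η' ((extChartAt 𝓘(ℝ, E) x₀).symm y)) :
    η.inChart x₀ y = η'.inChart x₀ y := by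
  simp only [Form.inChart, h]

lemma eventually_extChartAt_symm {P : M → Prop} {x : M} (h : ∀ᶠ z in 𝓝 x, P z) :
    ∀ᶠ y in 𝓝 (extChartAt 𝓘(ℝ, E) x x), P ((extChartAt 𝓘(ℝ, E) x).symm y) := by
  have := continuousAt_extChartAt_symm (I := 𝓘(ℝ, E)) x
  rw [ContinuousAt, extChartAt_to_inv] at this
  exact this.eventually h

lemma Form.inChart_eventuallyEq {η η' : Form E M k} {x : M} (h : ∀ᶠ z in 𝓝 x, η z = η' z) :
    η.inChart x =ᶠ[𝓝 (extChartAt 𝓘(ℝ, E) x x)] η'.inChart x := by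
  filter_upwards [eventually_extChartAt_symm h] with y hy using Form.inChart_congr hy

lemma Form.SmoothAt.congr {η η' : Form E M k} {x : M} (hη : η.SmoothAt x)
    (h : ∀ᶠ z in 𝓝 x, η z = η' z) : η'.SmoothAt x :=
  ContDiffAt.congr_of_eventuallyEq hη (Form.inChart_eventuallyEq h).symm

lemma Form.d_congr {η η' : Form E M k} {x : M} (h : ∀ᶠ z in 𝓝 x, η z = η' z) :
    η.d x = η'.d x := by
  simp only [Form.d, (Form.inChart_eventuallyEq h).extDeriv_eq]

lemma Form.inChart_pullback_eventuallyEq {f : N → M} (η : Form E M k) {x : N}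
    (hf : ContMDiffAt 𝓘(ℝ, E') 𝓘(ℝ, E) ∞ f x) :
    (η.pullback f : Form E' N k).inChart x =ᶠ[𝓝 (extChartAt 𝓘(ℝ, E') x x)] fun y =>
      (η.inChart (f x) (extChartAt 𝓘(ℝ, E) (f x) (f ((extChartAt 𝓘(ℝ, E') x).symm y)))
        ).compContinuousLinearMap
        (fderiv ℝ (fun z => extChartAt 𝓘(ℝ, E) (f x) (f ((extChartAt 𝓘(ℝ, E') x).symm z))) y) := by
  have h1 : ∀ᶠ z in 𝓝 x, MDifferentiableAt 𝓘(ℝ, E') 𝓘(ℝ, E) f z := by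
    have := (contMDiffAt_iff_contMDiffAt_nhds (n := 1) (by simp)).1 (hf.of_le (by simp))
    filter_upwards [this] with z hz using hz.mdifferentiableAt (by simp)
  have h2 : ∀ᶠ z in 𝓝 x, f z ∈ (extChartAt 𝓘(ℝ, E) (f x)).source :=
    hf.continuousAt.eventually_mem (extChartAt_source_mem_nhds (f x))
  filter_upwards [eventually_extChartAt_symm h1, eventually_extChartAt_symm h2,
    extChartAt_target_mem_nhds (I := 𝓘(ℝ, E')) x] with y h1 h2 h3
  exact Form.inChart_pullback f η x (f x) h3 h1 h2

lemma contDiffAt_writtenInChart {f : N → M} {x : N} (hf : ContMDiffAt 𝓘(ℝ, E') 𝓘(ℝ, E) ∞ f x) :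
    ContDiffAt ℝ ∞ (fun z => extChartAt 𝓘(ℝ, E) (f x) (f ((extChartAt 𝓘(ℝ, E') x).symm z)))
      (extChartAt 𝓘(ℝ, E') x x) := by
  have := (contMDiffAt_iff.1 hf).2
  simpa [contDiffWithinAt_univ, Function.comp_def] using this

end Pullback

section ContDiff

variable {V W G : Type*} [NormedAddCommGroup V] [NormedSpace ℝ V]
  [NormedAddCommGroup W] [NormedSpace ℝ W] [NormedAddCommGroup G] [NormedSpace ℝ G] {k : ℕ}
  {n : WithTop ℕ∞}

/-- In finite dimension, evaluation on all tuples of basis vectors is injective and linear, and a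
linear left inverse of it is continuous. Hence smoothness of the coefficients suffices. -/
lemma contDiffAt_alternating_iff [FiniteDimensional ℝ V] {f : G → V [⋀^Fin k]→L[ℝ] ℝ} {y : G} :
    ContDiffAt ℝ n f y ↔ ∀ v : Fin k → V, ContDiffAt ℝ n (fun z => f z v) y := by
  refine ⟨fun h v => ?_, fun h => ?_⟩
  · exact ((ContinuousMultilinearMap.apply ℝ (fun _ : Fin k => V) ℝ v).comp
      (ContinuousAlternatingMap.toContinuousMultilinearMapCLM ℝ)).contDiff.contDiffAt.comp y h
  · let b := Module.finBasis ℝ V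
    let ev : (V [⋀^Fin k]→L[ℝ] ℝ) →ₗ[ℝ] ((Fin k → Fin (Module.finrank ℝ V)) → ℝ) :=
      { toFun := fun η j => η (fun i => b (j i))
        map_add' := fun _ _ => rfl
        map_smul' := fun _ _ => rfl }
    have hev : LinearMap.ker ev = ⊥ := by
      rw [LinearMap.ker_eq_bot]
      intro η η' he
      have : η.toAlternatingMap = η'.toAlternatingMap := by
        refine Module.Basis.ext_alternating b fun j _ => congrFun he j
      exact ContinuousAlternatingMap.toAlternatingMap_injective this
    obtain ⟨r, hr⟩ := ev.exists_leftInverse_of_injective hev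
    have h2 : f = fun z => r.toContinuousLinearMap (ev (f z)) := by
      funext z
      exact (LinearMap.congr_fun hr (f z)).symm
    rw [h2]
    refine r.toContinuousLinearMap.contDiff.contDiffAt.comp y ?_
    exact contDiffAt_pi.2 fun j => h _

lemma _root_.ContDiffAt.compContinuousAlternatingMap_fderiv [FiniteDimensional ℝ V]
    {η : W → W [⋀^Fin k]→L[ℝ] ℝ} {F : V → W} {y : V}
    (hω : ContDiffAt ℝ ∞ η (F y)) (hF : ContDiffAt ℝ ∞ F y) :
    ContDiffAt ℝ ∞ (fun z => (η (F z)).compContinuousLinearMap (fderiv ℝ F z)) y := by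
  rw [contDiffAt_alternating_iff]
  intro v
  have h1 : ContDiffAt ℝ ∞ (fun z =>
      (ContinuousMultilinearMap.compContinuousLinearMapContinuousMultilinear ℝ
        (fun _ : Fin k => V) (fun _ => W) ℝ (fun _ => fderiv ℝ F z))
        (η (F z)).toContinuousMultilinearMap) y := by
    refine ContDiffAt.clm_apply ?_ ?_
    · refine (ContinuousMultilinearMap.contDiff _).contDiffAt.comp y ?_
      exact contDiffAt_pi.2 fun _ => hF.fderiv_right (by simp)
    · exact (ContinuousAlternatingMap.toContinuousMultilinearMapCLM
        ℝ).contDiff.contDiffAt.comp y (hω.comp y hF)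
  exact (ContinuousMultilinearMap.apply ℝ (fun _ : Fin k => V) ℝ v).contDiff.contDiffAt.comp y h1

end ContDiff

section PullbackSmooth

variable {E M E' N : Type*}
  [NormedAddCommGroup E] [NormedSpace ℝ E] [TopologicalSpace M] [ChartedSpace E M]
  [IsManifold 𝓘(ℝ, E) ∞ M]
  [NormedAddCommGroup E'] [NormedSpace ℝ E'] [FiniteDimensional ℝ E']
  [TopologicalSpace N] [ChartedSpace E' N]
  [IsManifold 𝓘(ℝ, E') ∞ N] {k : ℕ}

lemma Form.SmoothAt.pullback {f : N → M} {η : Form E M k} {x : N} (hη : η.SmoothAt (f x))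
    (hf : ContMDiffAt 𝓘(ℝ, E') 𝓘(ℝ, E) ∞ f x) : (η.pullback f : Form E' N k).SmoothAt x := by
  refine ContDiffAt.congr_of_eventuallyEq ?_ (Form.inChart_pullback_eventuallyEq η hf)
  refine ContDiffAt.compContinuousAlternatingMap_fderiv (η := η.inChart (f x)) ?_
    (contDiffAt_writtenInChart hf)
  rw [extChartAt_to_inv]
  exact hη

/-- The exterior derivative commutes with pull-back. -/
lemma Form.d_pullback {f : N → M} {η : Form E M k} {x : N} (hη : η.SmoothAt (f x))
    (hf : ContMDiffAt 𝓘(ℝ, E') 𝓘(ℝ, E) ∞ f x) :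
    (η.pullback f : Form E' N k).d x = (η.d).pullback f x := by
  have h1 := contDiffAt_writtenInChart hf
  have h2 : ContDiffAt ℝ ∞ (η.inChart (f x)) (extChartAt 𝓘(ℝ, E) (f x)
      (f ((extChartAt 𝓘(ℝ, E') x).symm (extChartAt 𝓘(ℝ, E') x x)))) := by
    rw [extChartAt_to_inv]; exact hη
  have hfd := hf.mdifferentiableAt (by simp)
  ext v
  have h0 := extDeriv_pullback_of_contDiffAt (η := η.inChart (f x))
    (F := fun z => extChartAt 𝓘(ℝ, E) (f x) (f ((extChartAt 𝓘(ℝ, E') x).symm z))) h2 h1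
  rw [← (Form.inChart_pullback_eventuallyEq η hf).extDeriv_eq, extChartAt_to_inv] at h0
  refine (congrArg (fun α : E' [⋀^Fin (k + 1)]→L[ℝ] ℝ =>
    α fun i => mfderiv 𝓘(ℝ, E') 𝓘(ℝ, E') (extChartAt 𝓘(ℝ, E') x) x (v i)) h0).trans ?_
  refine congrArg (extDeriv (η.inChart (f x)) (extChartAt 𝓘(ℝ, E) (f x) (f x)))
    (funext fun i => ?_)
  simp only
  have h3 := mfderiv_comp x (mdifferentiableAt_extChartAt' (f x) (mem_extChartAt_source (f x))) hfd
  have h4 : MDifferentiableAt 𝓘(ℝ, E') 𝓘(ℝ, E)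
      (fun z => extChartAt 𝓘(ℝ, E) (f x) (f ((extChartAt 𝓘(ℝ, E') x).symm z)))
      (extChartAt 𝓘(ℝ, E') x x) := (h1.differentiableAt (by simp)).mdifferentiableAt
  have h5 := mfderiv_comp x h4 (mdifferentiableAt_extChartAt' x (mem_extChartAt_source x))
  have h6 : (fun z => extChartAt 𝓘(ℝ, E) (f x) (f ((extChartAt 𝓘(ℝ, E') x).symm z))) ∘
      (extChartAt 𝓘(ℝ, E') x) =ᶠ[𝓝 x] extChartAt 𝓘(ℝ, E) (f x) ∘ f := by
    filter_upwards [extChartAt_source_mem_nhds (I := 𝓘(ℝ, E')) x] with z hz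
    simp only [Function.comp_apply, (extChartAt 𝓘(ℝ, E') x).left_inv hz]
  rw [h6.mfderiv_eq, h3, mfderiv_eq_fderiv] at h5
  exact (DFunLike.congr_fun h5 (v i)).symm

lemma Form.inChart_self (η : Form E E k) (x : E) : η.inChart x = η := by
  funext z
  ext v
  refine congrArg (η z) (funext fun i => ?_)
  have : mfderiv 𝓘(ℝ, E) 𝓘(ℝ, E) (extChartAt 𝓘(ℝ, E) x).symm z (v i) = v i := by
    rw [show ((extChartAt 𝓘(ℝ, E) x).symm : E → E) = id by
      rw [extChartAt_model_space_eq_id]; rfl, mfderiv_id]; rfl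
  exact this

lemma Form.d_self (η : Form E E k) (x : E) : η.d x = extDeriv η x := by
  ext v
  have h : (extChartAt 𝓘(ℝ, E) x : E → E) = id := by rw [extChartAt_model_space_eq_id]; rfl
  simp only [Form.d, Form.inChart_self]
  refine (congrArg (fun z => extDeriv η z _) (congrFun h x)).trans
    (congrArg (extDeriv η x) (funext fun i => ?_))
  have : mfderiv 𝓘(ℝ, E) 𝓘(ℝ, E) (extChartAt 𝓘(ℝ, E) x) x (v i) = v i := by
    rw [h, mfderiv_id]; rfl
  exact this

variable [FiniteDimensional ℝ E]

lemma Form.Smooth.smoothAt {η : Form E M k} (hη : η.Smooth) (x : M) : η.SmoothAt x :=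
  (hη x).contDiffAt (extChartAt_target_mem_nhds x)

/-- `SmoothAt` looks only at the preferred chart of the point. The expression in another chart is
the pull-back by the inverse of that chart, a form on the model space whose own chart is the
identity. -/
lemma Form.smooth_of_smoothAt {η : Form E M k} (hη : ∀ x, η.SmoothAt x) : η.Smooth := by
  intro x₀ y hy
  set x := (extChartAt 𝓘(ℝ, E) x₀).symm y with hx
  have hxs : x ∈ (extChartAt 𝓘(ℝ, E) x₀).source := (extChartAt 𝓘(ℝ, E) x₀).map_target hy
  have hyx : extChartAt 𝓘(ℝ, E) x₀ x = y := (extChartAt 𝓘(ℝ, E) x₀).right_inv hy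
  have h1 : ContMDiffAt 𝓘(ℝ, E) 𝓘(ℝ, E) ∞ (extChartAt 𝓘(ℝ, E) x₀).symm y :=
    contMDiffAt_extChartAt_symm x₀ hy
  have h2 : (η.pullback (extChartAt 𝓘(ℝ, E) x₀).symm : Form E E k).SmoothAt y :=
    (hη x).pullback h1
  refine ContDiffAt.contDiffWithinAt ?_
  simp only [Form.SmoothAt, Form.inChart_self, extChartAt_self_apply] at h2
  exact h2

/-- Where the form is smooth, its exterior derivative can be computed in any chart. -/
lemma Form.inChart_d {η : Form E M k} {x₀ : M} {y : E}
    (hy : y ∈ (extChartAt 𝓘(ℝ, E) x₀).target)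
    (hη : η.SmoothAt ((extChartAt 𝓘(ℝ, E) x₀).symm y)) :
    η.d.inChart x₀ y = extDeriv (η.inChart x₀) y := by
  have h1 := Form.d_pullback hη (contMDiffAt_extChartAt_symm x₀ hy)
  have h2 : (η.pullback (extChartAt 𝓘(ℝ, E) x₀).symm : Form E E k) = η.inChart x₀ := rfl
  exact h1.symm.trans (Form.d_self (η.inChart x₀) y)

lemma Form.Smooth.d {η : Form E M k} (hη : η.Smooth) : η.d.Smooth := by
  intro x₀ y hy
  have h1 : ContDiffAt ℝ ∞ (extDeriv (η.inChart x₀)) y := by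
    have : ContDiffAt ℝ ∞ (fderiv ℝ (η.inChart x₀)) y :=
      ((hη x₀).contDiffAt ((isOpen_extChartAt_target x₀).mem_nhds hy)).fderiv_right (by simp)
    exact (ContinuousAlternatingMap.alternatizeUncurryFinCLM ℝ E ℝ).contDiff.contDiffAt.comp y this
  refine (h1.congr_of_eventuallyEq ?_).contDiffWithinAt
  filter_upwards [(isOpen_extChartAt_target x₀).mem_nhds hy] with z hz
  exact Form.inChart_d hz (hη.smoothAt _)

/-- `Form.d` changes chart from point to point, so it cannot be differentiated as it stands.
`inChart_d` first expresses it near `x` in the single chart at `x`, where d² = 0 is the statement on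
a vector space. -/
lemma Form.d_d {η : Form E M k} (hη : η.Smooth) (x : M) : η.d.d x = 0 := by
  have h1 : η.d.inChart x =ᶠ[𝓝 (extChartAt 𝓘(ℝ, E) x x)] extDeriv (η.inChart x) := by
    filter_upwards [extChartAt_target_mem_nhds (I := 𝓘(ℝ, E)) x] with z hz
    exact Form.inChart_d hz (hη.smoothAt _)
  have h2 := extDeriv_extDeriv_apply (hη.smoothAt x) minSmoothness_two_le_infty
  ext v
  simp only [Form.d] at *
  rw [h1.extDeriv_eq, h2]
  rfl

end PullbackSmooth

/-! ### Submersions: local sections and the dimension of fibres. -/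

section Submersion

universe u

variable {E M P : Type*} {EP : Type u}
  [NormedAddCommGroup E] [NormedSpace ℝ E] [TopologicalSpace M] [ChartedSpace E M]
  [IsManifold 𝓘(ℝ, E) ∞ M]
  [NormedAddCommGroup EP] [NormedSpace ℝ EP] [TopologicalSpace P] [ChartedSpace EP P]
  [IsManifold 𝓘(ℝ, EP) ∞ P]

/-- Adapted coordinates for a submersion: smooth maps `κ : P → E × F` and `κ'`, locally inverse to
each other, and a chart `ψ` of the base in which the submersion is the first projection. -/
lemma exists_adapted_coordinates {f : P → M}
    (hf : Manifold.IsSubmersion 𝓘(ℝ, EP) 𝓘(ℝ, E) ∞ f) (p : P) :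
    ∃ (F : Type u) (_ : NormedAddCommGroup F) (_ : NormedSpace ℝ F) (_ : EP ≃L[ℝ] E × F)
      (κ : OpenPartialHomeomorph P (E × F)) (ψ : OpenPartialHomeomorph M E),
      p ∈ κ.source ∧ f p ∈ ψ.source ∧
      (∀ q ∈ κ.source, f q ∈ ψ.source ∧ (κ q).1 = ψ (f q)) ∧
      ContMDiffOn 𝓘(ℝ, EP) 𝓘(ℝ, E × F) ∞ κ κ.source ∧
      ContMDiffOn 𝓘(ℝ, E × F) 𝓘(ℝ, EP) ∞ κ.symm κ.target ∧
      ContMDiffOn 𝓘(ℝ, E) 𝓘(ℝ, E) ∞ ψ ψ.source := by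
  obtain ⟨F, i1, i2, h⟩ := hf
  obtain ⟨φ, ψ, hp, hfp, hφ, hψ, hsub, e, he⟩ := h p
  have hc := contMDiffOn_of_mem_maximalAtlas hφ
  have hcs := contMDiffOn_symm_of_mem_maximalAtlas hφ
  refine ⟨F, i1, i2, e, φ.transHomeomorph e.toHomeomorph, ψ, hp, hfp,
    ?_, ?_, ?_, contMDiffOn_of_mem_maximalAtlas hψ⟩
  · intro q hq
    have hq' : q ∈ φ.source := hq
    refine ⟨hsub hq', ?_⟩
    have := he (x := φ q) (by simpa using φ.map_source hq')
    simp [hq'] at this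
    simpa using this.symm
  · exact e.contDiff.contMDiff.comp_contMDiffOn hc
  · exact hcs.comp e.symm.contDiff.contMDiff.contMDiffOn fun y hy => hy

/-- In adapted coordinates the section keeps the fibre coordinate of `p` constant. -/
lemma exists_local_section {f : P → M}
    (hf : Manifold.IsSubmersion 𝓘(ℝ, EP) 𝓘(ℝ, E) ∞ f) (p : P) :
    ∃ s : M → P, ContMDiffAt 𝓘(ℝ, E) 𝓘(ℝ, EP) ∞ s (f p) ∧ s (f p) = p ∧
      ∀ᶠ x in 𝓝 (f p), f (s x) = x := by
  obtain ⟨F, i1, i2, e, κ, ψ, hp, hfp, h, hκ, hκs, hψ⟩ := exists_adapted_coordinates hf p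
  have h0 : κ p ∈ κ.target := κ.map_source hp
  have hk : κ p = (ψ (f p), (κ p).2) := by rw [← (h p hp).2]
  refine ⟨fun x => κ.symm (ψ x, (κ p).2), ?_, ?_, ?_⟩
  · have h1 : ContMDiffAt 𝓘(ℝ, E × F) 𝓘(ℝ, EP) ∞ κ.symm (ψ (f p), (κ p).2) := by
      rw [← hk]; exact hκs.contMDiffAt (κ.open_target.mem_nhds h0)
    refine h1.comp (f p) ?_
    exact (hψ.contMDiffAt (ψ.open_source.mem_nhds hfp)).prodMk_space contMDiffAt_const
  · simp only [← hk, κ.left_inv hp]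
  · have hcont : ContinuousAt (fun x => (ψ x, (κ p).2)) (f p) :=
      (ψ.continuousAt hfp).prodMk continuousAt_const
    have ht : κ.target ∈ 𝓝 (ψ (f p), (κ p).2) := by rw [← hk]; exact κ.open_target.mem_nhds h0
    filter_upwards [hcont.eventually_mem ht, ψ.open_source.mem_nhds hfp] with x hx hxs
    obtain ⟨h2, h3⟩ := h _ (κ.map_target hx)
    rw [κ.right_inv hx] at h3
    exact (ψ.injOn hxs h2 h3).symm

lemma mfderiv_surjective {f : P → M} (hf : Manifold.IsSubmersion 𝓘(ℝ, EP) 𝓘(ℝ, E) ∞ f)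
    (hs : ContMDiff 𝓘(ℝ, EP) 𝓘(ℝ, E) ∞ f) (p : P) (u : TangentSpace 𝓘(ℝ, E) (f p)) :
    ∃ v : TangentSpace 𝓘(ℝ, EP) p, mfderiv 𝓘(ℝ, EP) 𝓘(ℝ, E) f p v = u := by
  obtain ⟨s, h1, h2, h3⟩ := exists_local_section hf p
  have hfs : MDifferentiableAt 𝓘(ℝ, EP) 𝓘(ℝ, E) f (s (f p)) :=
    (hs _).mdifferentiableAt (by simp)
  have h4 := mfderiv_comp (f p) hfs (h1.mdifferentiableAt (by simp))
  have h5 : f ∘ s =ᶠ[𝓝 (f p)] id := h3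
  rw [h5.mfderiv_eq, mfderiv_id] at h4
  have h6 := DFunLike.congr_fun h4 u
  -- The derivative of `s` takes values in the tangent space at `s (f p)`; it is generalized so that
  -- this point can be rewritten to `p`.
  revert h6
  generalize mfderiv 𝓘(ℝ, E) 𝓘(ℝ, EP) s (f p) = L
  revert L
  rw [h2]
  exact fun L h6 => ⟨L u, h6.symm⟩

open Module in
/-- A vector space with a nonempty open subset covered by a smooth curve has dimension at most
one. -/
lemma finrank_le_one_of_curve {F : Type*} [NormedAddCommGroup F] [NormedSpace ℝ F]
    [FiniteDimensional ℝ F] {γ : ℝ → F} {O : Set ℝ} (hγ : ∀ t ∈ O, ContDiffAt ℝ ∞ γ t)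
    {U : Set F} (hU : IsOpen U) (hne : U.Nonempty) (hUO : U ⊆ γ '' O) :
    finrank ℝ F ≤ 1 := by
  -- Locally Lipschitz maps do not raise Hausdorff dimension, while a nonempty open subset of `F`
  -- has Hausdorff dimension `finrank ℝ F`.
  have h1 : dimH (γ '' O) ≤ dimH O := by
    refine dimH_image_le_of_locally_lipschitzOn fun t ht => ?_
    obtain ⟨C, u, hu, h⟩ := ((hγ t ht).of_le (m := 1) (by simp)).exists_lipschitzOnWith
    exact ⟨C, u, mem_nhdsWithin_of_mem_nhds hu, h⟩
  have h2 : dimH U = finrank ℝ F :=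
    Real.dimH_of_nonempty_interior (by rwa [hU.interior_eq])
  have h3 : dimH O ≤ 1 := (dimH_mono (Set.subset_univ O)).trans Real.dimH_univ.le
  have h4 := h2 ▸ ((dimH_mono hUO).trans (h1.trans h3))
  exact_mod_cast h4

end Submersion

/-! ### Principal circle bundles: the vertical tangent spaces. -/

section Bundle

universe u

variable {E M P : Type*} {EP : Type u}
  [NormedAddCommGroup E] [NormedSpace ℝ E] [TopologicalSpace M] [ChartedSpace E M]
  [IsManifold 𝓘(ℝ, E) ∞ M]
  [NormedAddCommGroup EP] [NormedSpace ℝ EP] [FiniteDimensional ℝ EP]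
  [TopologicalSpace P] [ChartedSpace EP P] [IsManifold 𝓘(ℝ, EP) ∞ P]
  {T : ℝ} {pr : P → M} {Z : VField EP P}

lemma IsCircleFlow.contMDiff_right {X : VField E M} {φ : ℝ → M → M} (h : IsCircleFlow T X φ)
    (t : ℝ) : ContMDiff 𝓘(ℝ, E) 𝓘(ℝ, E) ∞ (φ t) :=
  h.smooth.comp (contMDiff_const.prodMk contMDiff_id)

lemma IsCircleFlow.contMDiff_left {X : VField E M} {φ : ℝ → M → M} (h : IsCircleFlow T X φ)
    (x : M) : ContMDiff 𝓘(ℝ, ℝ) 𝓘(ℝ, E) ∞ (fun t => φ t x) :=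
  h.smooth.comp (contMDiff_id.prodMk contMDiff_const)

lemma IsPrincipalCircleBundle.mfderiv_surjective (hb : IsPrincipalCircleBundle (E := E) T pr Z)
    (p : P) (u : TangentSpace 𝓘(ℝ, E) (pr p)) :
    ∃ v : TangentSpace 𝓘(ℝ, EP) p, mfderiv 𝓘(ℝ, EP) 𝓘(ℝ, E) pr p v = u :=
  HKTwist.mfderiv_surjective hb.submersion hb.smooth p u

/-- A curve moving along a vector field on `P` projects to the projected vectors. -/
lemma hasMFDerivAt_comp_integralCurve {f : P → M} {γ : ℝ → P}
    {t : ℝ} (hf : MDifferentiableAt 𝓘(ℝ, EP) 𝓘(ℝ, E) f (γ t))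
    {V : TangentSpace 𝓘(ℝ, EP) (γ t)}
    (hγ : HasMFDerivAt 𝓘(ℝ, ℝ) 𝓘(ℝ, EP) γ t ((1 : ℝ →L[ℝ] ℝ).smulRight V)) :
    HasMFDerivAt 𝓘(ℝ, ℝ) 𝓘(ℝ, E) (f ∘ γ) t
      ((1 : ℝ →L[ℝ] ℝ).smulRight (mfderiv 𝓘(ℝ, EP) 𝓘(ℝ, E) f (γ t) V)) := by
  have h := hf.hasMFDerivAt.comp t hγ
  have h1 : (mfderiv 𝓘(ℝ, EP) 𝓘(ℝ, E) f (γ t)).comp ((1 : ℝ →L[ℝ] ℝ).smulRight V) =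
      (1 : ℝ →L[ℝ] ℝ).smulRight (mfderiv 𝓘(ℝ, EP) 𝓘(ℝ, E) f (γ t) V) := by
    refine ContinuousLinearMap.ext_ring ?_
    change mfderiv 𝓘(ℝ, EP) 𝓘(ℝ, E) f (γ t) ((1 : ℝ) • V) = (1 : ℝ) • _
    rw [one_smul, one_smul]
  exact h1 ▸ h

lemma IsPrincipalCircleBundle.mfderiv_generator (hb : IsPrincipalCircleBundle (E := E) T pr Z)
    (p : P) : mfderiv 𝓘(ℝ, EP) 𝓘(ℝ, E) pr p (Z p) = 0 := by
  obtain ⟨φ, hφ, -, h⟩ := hb.action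
  have h1 := hφ.generator p 0
  have h2 := hasMFDerivAt_comp_integralCurve (f := pr) (γ := fun t => φ t p) (t := 0)
    ((hb.smooth _).mdifferentiableAt (by simp)) h1
  have h3 : pr ∘ (fun t => φ t p) = fun _ => pr p := by
    funext t
    exact ((h p (φ t p)).2 ⟨t, rfl⟩).symm
  rw [h3] at h2
  have h4 := hasMFDerivAt_unique h2 (hasMFDerivAt_const (pr p) (0 : ℝ))
  have h5 : (1 : ℝ) • mfderiv 𝓘(ℝ, EP) 𝓘(ℝ, E) pr (φ 0 p) (Z (φ 0 p)) = 0 :=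
    DFunLike.congr_fun h4 (1 : ℝ)
  rwa [one_smul, hφ.map_zero] at h5

/-- The vertical tangent spaces of a principal circle bundle are spanned by the generator. -/
lemma IsPrincipalCircleBundle.eq_smul_of_mfderiv_eq_zero
    (hb : IsPrincipalCircleBundle (E := E) T pr Z) (p : P) (hZ : Z p ≠ 0)
    (v : TangentSpace 𝓘(ℝ, EP) p) (hv : mfderiv 𝓘(ℝ, EP) 𝓘(ℝ, E) pr p v = 0) :
    ∃ c : ℝ, v = c • Z p := by
  obtain ⟨φ, hφ, -, hfib⟩ := hb.action
  obtain ⟨F, i1, i2, e, κ, ψ, hp, hfp, h, hκ, hκs, hψ⟩ :=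
    exists_adapted_coordinates hb.submersion p
  have : FiniteDimensional ℝ (E × F) := e.toLinearEquiv.finiteDimensional
  have : FiniteDimensional ℝ F :=
    FiniteDimensional.of_surjective (LinearMap.snd ℝ E F) LinearMap.snd_surjective
  -- The fibre is a single orbit, so in the adapted chart its slice is an open subset of `F` covered
  -- by the smooth curve of second coordinates along the orbit.
  have hrank : Module.finrank ℝ F ≤ 1 := by
    refine finrank_le_one_of_curve (γ := fun t => (κ (φ t p)).2) (O := {t | φ t p ∈ κ.source})
      (U := {w | ((κ p).1, w) ∈ κ.target}) ?_ ?_ ⟨(κ p).2, κ.map_source hp⟩ ?_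
    · intro t ht
      have h1 : ContMDiffAt 𝓘(ℝ, ℝ) 𝓘(ℝ, E × F) ∞ (fun t => κ (φ t p)) t :=
        (hκ.contMDiffAt (κ.open_source.mem_nhds ht)).comp t (hφ.contMDiff_left p t)
      exact contDiffAt_snd.comp t h1.contDiffAt
    · exact κ.open_target.preimage (by fun_prop)
    · intro w hw
      have h1 := κ.map_target hw
      obtain ⟨h2, h3⟩ := h _ h1
      rw [κ.right_inv hw] at h3
      have h4 := ψ.injOn hfp h2 ((h p hp).2.symm.trans h3)
      obtain ⟨t, ht⟩ := (hfib _ _).1 h4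
      refine ⟨t, ?_, ?_⟩
      · simp only [Set.mem_ofPred_eq, ht, h1]
      · simp only [ht, κ.right_inv hw]
  have hκp : MDifferentiableAt 𝓘(ℝ, EP) 𝓘(ℝ, E × F) κ p :=
    (hκ.contMDiffAt (κ.open_source.mem_nhds hp)).mdifferentiableAt (by simp)
  have hκsp : MDifferentiableAt 𝓘(ℝ, E × F) 𝓘(ℝ, EP) κ.symm (κ p) :=
    (hκs.contMDiffAt (κ.open_target.mem_nhds (κ.map_source hp))).mdifferentiableAt (by simp)
  let K : EP →L[ℝ] E × F := mfderiv 𝓘(ℝ, EP) 𝓘(ℝ, E × F) κ p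
  have hKinj : ∀ w : EP, K w = 0 → w = 0 := by
    intro w hw
    have h1 := mfderiv_comp p hκsp hκp
    have h2 : κ.symm ∘ κ =ᶠ[𝓝 p] id := κ.eventually_left_inverse hp
    rw [h2.mfderiv_eq, mfderiv_id] at h1
    have h3 : w = mfderiv 𝓘(ℝ, E × F) 𝓘(ℝ, EP) κ.symm (κ p) (K w) := DFunLike.congr_fun h1 w
    rw [hw] at h3
    exact h3.trans (map_zero _)
  have hK1 : ∀ w : TangentSpace 𝓘(ℝ, EP) p, mfderiv 𝓘(ℝ, EP) 𝓘(ℝ, E) pr p w = 0 →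
      (K w).1 = 0 := by
    intro w hw
    have h1 := mfderiv_comp p (I := 𝓘(ℝ, EP)) (I' := 𝓘(ℝ, E × F)) (I'' := 𝓘(ℝ, E))
      (g := Prod.fst) (contDiff_fst.contMDiff.mdifferentiableAt (n := ∞) (by simp)) hκp
    have hψp : MDifferentiableAt 𝓘(ℝ, E) 𝓘(ℝ, E) ψ (pr p) :=
      (hψ.contMDiffAt (ψ.open_source.mem_nhds hfp)).mdifferentiableAt (by simp)
    have h2 := mfderiv_comp p hψp ((hb.smooth p).mdifferentiableAt (by simp))
    have h3 : Prod.fst ∘ κ =ᶠ[𝓝 p] ψ ∘ pr := by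
      filter_upwards [κ.open_source.mem_nhds hp] with q hq using (h q hq).2
    rw [h3.mfderiv_eq, h2] at h1
    have h4 := DFunLike.congr_fun h1 w
    rw [mfderiv_eq_fderiv, fderiv_fst] at h4
    refine Eq.trans h4.symm ?_
    exact (congrArg (mfderiv 𝓘(ℝ, E) 𝓘(ℝ, E) ψ (pr p)) hw).trans
      (mfderiv 𝓘(ℝ, E) 𝓘(ℝ, E) ψ (pr p)).map_zero
  -- `K` is injective and carries vertical vectors into `0 × F`, so the image of the generator spans
  -- this space of dimension at most one.
  have hZ2 : (K (Z p)).2 ≠ 0 := fun h0 =>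
    hZ (hKinj _ (Prod.ext (hK1 _ (hb.mfderiv_generator p)) h0))
  obtain ⟨c, hc⟩ := (finrank_le_one_iff (K := ℝ) (V := F)).1 hrank
  obtain ⟨a, ha⟩ := hc (K (Z p)).2
  obtain ⟨b, hb'⟩ := hc (K v).2
  have ha0 : a ≠ 0 := by
    rintro rfl
    exact hZ2 (by rw [← ha, zero_smul])
  refine ⟨b / a, ?_⟩
  let z : EP := Z p
  let v' : EP := v
  have h1 : K (v' - (b / a) • z) = 0 := by
    rw [map_sub, map_smul]
    change K v - (b / a) • K (Z p) = 0
    refine Prod.ext ?_ ?_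
    · simp [hK1 _ hv, hK1 _ (hb.mfderiv_generator p)]
    · simp only [Prod.snd_sub, Prod.smul_snd, Prod.snd_zero, ← ha, ← hb', smul_smul]
      rw [div_mul_cancel₀ _ ha0, sub_self]
  exact sub_eq_zero.1 (hKinj _ h1)

end Bundle

/-! ### Flows: uniqueness, intertwining and Lie derivatives. -/

section Flow

variable {E M EP P : Type*}
  [NormedAddCommGroup E] [NormedSpace ℝ E] [FiniteDimensional ℝ E]
  [TopologicalSpace M] [T2Space M] [ChartedSpace E M]
  [IsManifold 𝓘(ℝ, E) ∞ M]
  [NormedAddCommGroup EP] [NormedSpace ℝ EP] [FiniteDimensional ℝ EP]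
  [TopologicalSpace P] [T2Space P] [ChartedSpace EP P] [IsManifold 𝓘(ℝ, EP) ∞ P]
  {T TP : ℝ} {X : VField E M} {φ : ℝ → M → M} {V : VField EP P} {ψ : ℝ → P → P}

lemma IsCircleFlow.mfderiv_time (h : IsCircleFlow T X φ) (t : ℝ) (x : M) (r : ℝ) :
    mfderiv 𝓘(ℝ, ℝ) 𝓘(ℝ, E) (fun t => φ t x) t r = r • X (φ t x) := by
  rw [(h.generator x t).mfderiv]; rfl

/-- `X` is the tangent map of the joint flow applied to the time direction at time 0, so its
smoothness is inherited from the flow. -/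
lemma IsCircleFlow.smoothVField (h : IsCircleFlow T X φ) : SmoothVField X := by
  have h1 := h.smooth.contMDiff_tangentMap (m := ∞) (by simp)
  have h2 : ContMDiff 𝓘(ℝ, E) (𝓘(ℝ, ℝ).prod 𝓘(ℝ, E)).tangent ∞ (fun x : M =>
      (equivTangentBundleProd 𝓘(ℝ, ℝ) ℝ 𝓘(ℝ, E) M).symm
        ((⟨0, (1 : ℝ)⟩ : TangentBundle 𝓘(ℝ, ℝ) ℝ), (⟨x, 0⟩ : TangentBundle 𝓘(ℝ, E) M))) := by
    refine (contMDiff_equivTangentBundleProd_symm).comp ?_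
    exact contMDiff_const.prodMk (Bundle.contMDiff_zeroSection ℝ _)
  have h3 := h1.comp h2
  refine h3.congr fun x => ?_
  have h4 : MDifferentiableAt (𝓘(ℝ, ℝ).prod 𝓘(ℝ, E)) 𝓘(ℝ, E)
      (fun q : ℝ × M => φ q.1 q.2) (0, x) := (h.smooth _).mdifferentiableAt (by simp)
  have h5 := mfderiv_comp (I := 𝓘(ℝ, ℝ)) (f := fun t : ℝ => (t, x)) (0 : ℝ) h4
    (mdifferentiableAt_id.prodMk mdifferentiableAt_const)
  have h6 := h.mfderiv_time 0 x 1
  change mfderiv 𝓘(ℝ, ℝ) 𝓘(ℝ, E) ((fun q : ℝ × M => φ q.1 q.2) ∘ fun t : ℝ => (t, x)) 0 1 = _ at h6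
  rw [h5, mfderiv_prod_left, one_smul] at h6
  have h7 : (⟨x, X x⟩ : TangentBundle 𝓘(ℝ, E) M) = ⟨φ 0 x, X (φ 0 x)⟩ := by rw [h.map_zero]
  rw [h7, ← h6]
  rfl

lemma IsCircleFlow.eq_of_isMIntegralCurve (h : IsCircleFlow T X φ) {γ : ℝ → M}
    (hγ : IsMIntegralCurve (I := 𝓘(ℝ, E)) γ X) (t : ℝ) : γ t = φ t (γ 0) := by
  have : IsManifold 𝓘(ℝ, E) 1 M := .of_le (n := ∞) (by simp)
  have h1 : ContMDiff 𝓘(ℝ, E) 𝓘(ℝ, E).tangent 1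
      (fun x => (⟨x, X x⟩ : TangentBundle 𝓘(ℝ, E) M)) := h.smoothVField.of_le (by simp)
  exact congrFun (isMIntegralCurve_Ioo_eq_of_contMDiff_boundaryless h1 hγ
    (h.generator (γ 0)) (t₀ := 0) (h.map_zero _).symm) t

/-- A smooth map relating the generators of two flows intertwines the flows. -/
lemma IsCircleFlow.map_flow (h : IsCircleFlow T X φ) (hψ : IsCircleFlow TP V ψ) {f : P → M}
    (hf : ContMDiff 𝓘(ℝ, EP) 𝓘(ℝ, E) ∞ f)
    (hfV : ∀ p, mfderiv 𝓘(ℝ, EP) 𝓘(ℝ, E) f p (V p) = X (f p)) (t : ℝ) (p : P) :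
    f (ψ t p) = φ t (f p) := by
  have h1 : IsMIntegralCurve (I := 𝓘(ℝ, E)) (fun t => f (ψ t p)) X := by
    intro t
    have h2 := hasMFDerivAt_comp_integralCurve ((hf (ψ t p)).mdifferentiableAt (by simp))
      (hψ.generator p t)
    rw [hfV] at h2
    exact h2
  have h3 := h.eq_of_isMIntegralCurve h1 t
  simpa [hψ.map_zero] using h3

lemma hasDerivAt_of_hasMFDerivAt {g : ℝ → ℝ} {t : ℝ} {c c' : ℝ}
    (h : HasMFDerivAt 𝓘(ℝ, ℝ) 𝓘(ℝ, ℝ) g t ((1 : ℝ →L[ℝ] ℝ).smulRight c)) (hc : c = c') :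
    HasDerivAt g c' t := by
  have h1 : HasFDerivAt g ((1 : ℝ →L[ℝ] ℝ).smulRight c) t := h.hasFDerivAt
  have h2 := h1.hasDerivAt
  simpa [hc] using h2

lemma IsCircleFlow.comp_eq_of_mfderiv_eq_zero (h : IsCircleFlow T X φ) {f : M → ℝ}
    (hf : ContMDiff 𝓘(ℝ, E) 𝓘(ℝ, ℝ) ∞ f)
    (hfX : ∀ x, (mfderiv 𝓘(ℝ, E) 𝓘(ℝ, ℝ) f x (X x) : ℝ) = 0) (t : ℝ) (x : M) :
    f (φ t x) = f x := by
  have h1 : ∀ t, HasDerivAt (fun t => f (φ t x)) 0 t := by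
    intro t
    have h2 := hasMFDerivAt_comp_integralCurve (f := f) ((hf (φ t x)).mdifferentiableAt (by simp))
      (h.generator x t)
    exact hasDerivAt_of_hasMFDerivAt h2 (hfX _)
  have h4 := is_const_of_deriv_eq_zero (fun t => (h1 t).differentiableAt) (fun t => (h1 t).deriv) t 0
  simpa [h.map_zero] using h4

lemma IsCircleFlow.mfderiv_zero (h : IsCircleFlow T X φ) (x : M) (u : E) :
    mfderiv 𝓘(ℝ, E) 𝓘(ℝ, E) (φ 0) x u = u := by
  have : φ 0 = id := funext h.map_zero
  rw [this, mfderiv_id]; rfl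

/-- The differential of a function. -/
def dFun (f : M → ℝ) : OneForm E M := fun x => mfderiv 𝓘(ℝ, E) 𝓘(ℝ, ℝ) f x

lemma eq_of_hasMFDerivAt_smulRight {γ : ℝ → M} {t : ℝ} {v w : TangentSpace 𝓘(ℝ, E) (γ t)}
    (hv : HasMFDerivAt 𝓘(ℝ, ℝ) 𝓘(ℝ, E) γ t ((1 : ℝ →L[ℝ] ℝ).smulRight v))
    (hw : HasMFDerivAt 𝓘(ℝ, ℝ) 𝓘(ℝ, E) γ t ((1 : ℝ →L[ℝ] ℝ).smulRight w)) : v = w := by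
  have h : (1 : ℝ) • v = (1 : ℝ) • w := DFunLike.congr_fun (hasMFDerivAt_unique hv hw) (1 : ℝ)
  rwa [one_smul, one_smul] at h

lemma hasMFDerivAt_of_hasDerivAt {G : Type*} [NormedAddCommGroup G] [NormedSpace ℝ G]
    {γ : ℝ → G} {t : ℝ} {v : G} (h : HasDerivAt γ v t) :
    HasMFDerivAt 𝓘(ℝ, ℝ) 𝓘(ℝ, G) γ t ((1 : ℝ →L[ℝ] ℝ).smulRight v) := by
  refine HasFDerivAt.hasMFDerivAt ?_
  have := h.hasFDerivAt
  exact this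

/-- Every tangent vector is the velocity of a smooth curve. -/
lemma exists_curve (x : M) (u : TangentSpace 𝓘(ℝ, E) x) :
    ∃ γ : ℝ → M, γ 0 = x ∧ (∀ᶠ s in 𝓝 (0 : ℝ), ContMDiffAt 𝓘(ℝ, ℝ) 𝓘(ℝ, E) ∞ γ s) ∧
      HasMFDerivAt 𝓘(ℝ, ℝ) 𝓘(ℝ, E) γ 0 ((1 : ℝ →L[ℝ] ℝ).smulRight (u : E)) := by
  set e := extChartAt 𝓘(ℝ, E) x with he
  let u' : E := mfderiv 𝓘(ℝ, E) 𝓘(ℝ, E) e x u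
  have hx0 : e x + (0 : ℝ) • u' = e x := by simp
  refine ⟨fun s => e.symm (e x + s • u'), ?_, ?_, ?_⟩
  · simp only [hx0]; exact extChartAt_to_inv x
  · have h1 : ContinuousAt (fun s : ℝ => e x + s • u') 0 := by fun_prop
    have h2 : e.target ∈ 𝓝 (e x + (0 : ℝ) • u') := by
      rw [hx0]; exact extChartAt_target_mem_nhds (I := 𝓘(ℝ, E)) x
    filter_upwards [h1.eventually_mem h2] with s hs
    refine (contMDiffAt_extChartAt_symm x hs).comp s ?_
    exact ContDiffAt.contMDiffAt (by fun_prop)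
  · have h1 : HasDerivAt (fun s : ℝ => e x + s • u') u' 0 := by
      simpa using ((hasDerivAt_id (0 : ℝ)).smul_const u').const_add (e x)
    have h2 := hasMFDerivAt_comp_integralCurve (f := e.symm) (V := u')
      (by
        simp only [hx0]
        exact mdifferentiableAt_extChartAt_symm' x (mem_extChartAt_target x))
      (hasMFDerivAt_of_hasDerivAt h1)
    have h3 := mfderiv_extChartAt_symm_comp x (mem_extChartAt_source x) u
    have h4 : (mfderiv 𝓘(ℝ, E) 𝓘(ℝ, E) e.symm (e x + (0 : ℝ) • u') u' : E) = u :=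
      (congrArg (fun y => (mfderiv 𝓘(ℝ, E) 𝓘(ℝ, E) e.symm y u' : E)) hx0).trans h3
    exact Eq.subst (motive := fun w : E => HasMFDerivAt 𝓘(ℝ, ℝ) 𝓘(ℝ, E)
      (fun s => e.symm (e x + s • u')) 0 ((1 : ℝ →L[ℝ] ℝ).smulRight w)) h4 h2

/-- Cartan's formula for a one-form along a flow. -/
lemma IsCircleFlow.hasDerivAt_oneForm (h : IsCircleFlow T X φ) {β : OneForm E M}
    (hβ : β.toForm.Smooth) {b : M → ℝ} (hb : ContMDiff 𝓘(ℝ, E) 𝓘(ℝ, ℝ) ∞ b)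
    (hbX : ∀ x, β x (X x) = b x) (x : M) (u : TangentSpace 𝓘(ℝ, E) x) (t : ℝ) :
    HasDerivAt (fun t => β (φ t x) (mfderiv 𝓘(ℝ, E) 𝓘(ℝ, E) (φ t) x u))
      (β.toForm.d (φ t x) ![X (φ t x), mfderiv 𝓘(ℝ, E) 𝓘(ℝ, E) (φ t) x u] +
        dFun b (φ t x) (mfderiv 𝓘(ℝ, E) 𝓘(ℝ, E) (φ t) x u)) t := by
  obtain ⟨γ, hγ0, hγ, hγ'⟩ := exists_curve x u
  -- On this surface the time direction maps to X, and along s = 0 the direction of s maps to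
  -- Dφ_t(u). With ζ the pull-back of β, dζ(∂_t, ∂_s) = ∂_t ζ(∂_s) - ∂_s ζ(∂_t), and ζ(∂_t) = b ∘ c
  -- near the point. Solving for ∂_t ζ(∂_s) gives the formula.
  let c : ℝ × ℝ → M := fun z => φ z.1 (γ z.2)
  have hc0 : ∀ t, c (t, 0) = φ t x := fun t => by simp only [c, hγ0]
  have hc' : ∀ t, ∀ᶠ z in 𝓝 (t, (0 : ℝ)), ContMDiffAt 𝓘(ℝ, ℝ × ℝ) 𝓘(ℝ, E) ∞ c z := by
    intro t
    have h1 : ContinuousAt (Prod.snd : ℝ × ℝ → ℝ) (t, 0) := continuousAt_snd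
    filter_upwards [h1.eventually hγ] with z hz
    have h2 : ContMDiffAt 𝓘(ℝ, ℝ × ℝ) (𝓘(ℝ, ℝ).prod 𝓘(ℝ, E)) ∞
        (fun z : ℝ × ℝ => (z.1, γ z.2)) z :=
      (contDiff_fst.contMDiff z).prodMk (hz.comp z (contDiff_snd.contMDiff z))
    exact (h.smooth (z.1, γ z.2)).comp z h2
  have hc := hc' t
  have hct : ∀ᶠ z in 𝓝 (t, (0 : ℝ)),
      mfderiv 𝓘(ℝ, ℝ × ℝ) 𝓘(ℝ, E) c z ((1 : ℝ), (0 : ℝ)) = X (c z) := by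
    filter_upwards [hc] with z hz
    have h1 : HasDerivAt (fun τ : ℝ => (τ, z.2)) ((1 : ℝ), (0 : ℝ)) z.1 :=
      (hasDerivAt_id _).prodMk (hasDerivAt_const _ _)
    have h2 := hasMFDerivAt_comp_integralCurve (f := c) (t := z.1)
      (hz.mdifferentiableAt (by simp)) (hasMFDerivAt_of_hasDerivAt h1)
    exact eq_of_hasMFDerivAt_smulRight h2 (h.generator (γ z.2) z.1)
  have hcs : ∀ t, (mfderiv 𝓘(ℝ, ℝ × ℝ) 𝓘(ℝ, E) c (t, 0) ((0 : ℝ), (1 : ℝ)) : E) =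
      mfderiv 𝓘(ℝ, E) 𝓘(ℝ, E) (φ t) x u := by
    intro t
    have h1 : HasDerivAt (fun s : ℝ => (t, s)) ((0 : ℝ), (1 : ℝ)) 0 :=
      (hasDerivAt_const _ _).prodMk (hasDerivAt_id _)
    have h2 := hasMFDerivAt_comp_integralCurve (f := c) (t := (0 : ℝ))
      ((hc' t).self_of_nhds.mdifferentiableAt (by simp)) (hasMFDerivAt_of_hasDerivAt h1)
    have h3 := hasMFDerivAt_comp_integralCurve (f := φ t) (t := (0 : ℝ))
      ((h.contMDiff_right t _).mdifferentiableAt (by simp)) hγ'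
    have h4 := eq_of_hasMFDerivAt_smulRight h2 h3
    refine Eq.trans h4 ?_
    rw [hγ0]
  let ζ : Form (ℝ × ℝ) (ℝ × ℝ) 1 := β.toForm.pullback c
  have hζ : ζ.SmoothAt (t, 0) := (hβ.smoothAt _).pullback hc.self_of_nhds
  let ζ' : ℝ × ℝ → (ℝ × ℝ) [⋀^Fin 1]→L[ℝ] ℝ := ζ
  have hζ' : DifferentiableAt ℝ ζ' (t, 0) := by
    have h1 : ContDiffAt ℝ ∞ (ζ.inChart (t, 0)) (extChartAt 𝓘(ℝ, ℝ × ℝ) (t, (0 : ℝ)) (t, 0)) := hζ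
    rw [Form.inChart_self, extChartAt_self_apply] at h1
    exact h1.differentiableAt (by simp)
  have hd : extDeriv ζ' (t, 0) ![((1 : ℝ), (0 : ℝ)), ((0 : ℝ), (1 : ℝ))] =
      β.toForm.d (φ t x) ![X (φ t x), mfderiv 𝓘(ℝ, E) 𝓘(ℝ, E) (φ t) x u] := by
    have h1 : extDeriv ζ' (t, 0) = (β.toForm.d).pullback c (t, 0) :=
      (Form.d_self ζ (t, 0)).symm.trans (Form.d_pullback (hβ.smoothAt _) hc.self_of_nhds)
    rw [h1]
    refine (congrArg (β.toForm.d (c (t, 0))) (funext fun i => ?_)).trans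
      (Form.apply_congr β.toForm.d (hc0 t) _)
    fin_cases i
    · refine hct.self_of_nhds.trans ?_
      rw [hc0]
      rfl
    · exact hcs t
  rw [extDeriv_apply hζ', Fin.sum_univ_two] at hd
  have e0 : (0 : Fin 2).removeNth ![((1 : ℝ), (0 : ℝ)), ((0 : ℝ), (1 : ℝ))] = ![(0, 1)] := by
    ext i <;> fin_cases i <;> rfl
  have e1 : (1 : Fin 2).removeNth ![((1 : ℝ), (0 : ℝ)), ((0 : ℝ), (1 : ℝ))] = ![(1, 0)] := by
    ext i <;> fin_cases i <;> rfl
  simp only [e0, e1] at hd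
  have hdiff : ∀ v : Fin 1 → ℝ × ℝ, DifferentiableAt ℝ (fun z => ζ' z v) (t, 0) := fun v =>
    hζ'.continuousAlternatingMap_apply_const v
  have h1 : HasDerivAt (fun τ : ℝ => ζ' (τ, 0) ![(0, 1)])
      (fderiv ℝ (fun z => ζ' z ![(0, 1)]) (t, 0) ((1 : ℝ), (0 : ℝ))) t :=
    HasFDerivAt.comp_hasDerivAt (f := fun τ : ℝ => (τ, (0 : ℝ))) t (hdiff _).hasFDerivAt
      ((hasDerivAt_id _).prodMk (hasDerivAt_const _ _))
  have h2 : (fun τ : ℝ => ζ' (τ, 0) ![(0, 1)]) =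
      fun t => β (φ t x) (mfderiv 𝓘(ℝ, E) 𝓘(ℝ, E) (φ t) x u) := by
    funext τ
    refine (congrArg (β (c (τ, 0))) (hcs τ)).trans ?_
    rw [hc0]
  have h3 : (fun z => ζ' z ![(1, 0)]) =ᶠ[𝓝 (t, (0 : ℝ))] b ∘ c := by
    filter_upwards [hct] with z hz
    exact (congrArg (β (c z)) hz).trans (hbX _)
  have h4 : fderiv ℝ (b ∘ c) (t, 0) ((0 : ℝ), (1 : ℝ)) =
      dFun b (φ t x) (mfderiv 𝓘(ℝ, E) 𝓘(ℝ, E) (φ t) x u) := by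
    have h5 := mfderiv_comp (t, (0 : ℝ)) ((hb _).mdifferentiableAt (by simp))
      (hc.self_of_nhds.mdifferentiableAt (by simp))
    rw [mfderiv_eq_fderiv] at h5
    refine (DFunLike.congr_fun h5 ((0 : ℝ), (1 : ℝ))).trans ?_
    refine (congrArg (dFun b (c (t, 0))) (hcs t)).trans ?_
    rw [hc0]
  rw [h2] at h1
  rw [h3.fderiv_eq] at hd
  simp only [Matrix.cons_val_zero, Matrix.cons_val_one, h4] at hd
  convert h1 using 1
  rw [← hd]
  simp

/-- A one-form is preserved by a flow if its Lie derivative vanishes. -/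
lemma IsCircleFlow.preservesOneForm (h : IsCircleFlow T X φ) {β : OneForm E M}
    (hβ : β.toForm.Smooth) {b : M → ℝ} (hb : ContMDiff 𝓘(ℝ, E) 𝓘(ℝ, ℝ) ∞ b)
    (hbX : ∀ x, β x (X x) = b x)
    (hL : ∀ x (u : TangentSpace 𝓘(ℝ, E) x), β.toForm.d x ![X x, u] + dFun b x u = 0) :
    PreservesOneForm φ β := by
  intro t x u
  have h1 : ∀ t, HasDerivAt (fun t => β (φ t x) (mfderiv 𝓘(ℝ, E) 𝓘(ℝ, E) (φ t) x u)) 0 t :=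
    fun t => hL (φ t x) (mfderiv 𝓘(ℝ, E) 𝓘(ℝ, E) (φ t) x u) ▸
      h.hasDerivAt_oneForm hβ hb hbX x u t
  have h4 := is_const_of_deriv_eq_zero (fun t => (h1 t).differentiableAt) (fun t => (h1 t).deriv) t 0
  refine h4.trans ?_
  refine (congrArg (β (φ 0 x)) (h.mfderiv_zero x u)).trans ?_
  rw [h.map_zero]

end Flow

/-! ### Exterior calculus: linearity, the Leibniz rule, smoothness of α₀, two-forms. -/

section FormCalculus

variable {E M : Type*}
  [NormedAddCommGroup E] [NormedSpace ℝ E] [FiniteDimensional ℝ E]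
  [TopologicalSpace M] [ChartedSpace E M] [IsManifold 𝓘(ℝ, E) ∞ M]
  {k : ℕ}

lemma Form.inChart_add (η ζ : Form E M k) (x : M) :
    (η + ζ).inChart x = η.inChart x + ζ.inChart x := rfl

lemma Form.inChart_const_smul (c : ℝ) (η : Form E M k) (x : M) :
    (c • η).inChart x = c • η.inChart x := rfl

lemma Form.SmoothAt.add {η ζ : Form E M k} {x : M} (hη : η.SmoothAt x) (hζ : ζ.SmoothAt x) :
    (η + ζ).SmoothAt x := ContDiffAt.add hη hζ

lemma Form.SmoothAt.const_smul {η : Form E M k} {x : M} (c : ℝ) (hη : η.SmoothAt x) :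
    (c • η).SmoothAt x := ContDiffAt.const_smul c hη

lemma Form.d_add {η ζ : Form E M k} {x : M} (hη : η.SmoothAt x) (hζ : ζ.SmoothAt x) :
    (η + ζ).d x = η.d x + ζ.d x := by
  have h := extDeriv_add (hη.differentiableAt (by simp)) (hζ.differentiableAt (by simp))
  simp only [Form.d, Form.inChart_add, h]
  rfl

lemma Form.d_const_smul (c : ℝ) (η : Form E M k) (x : M) : (c • η).d x = c • η.d x := by
  have h := extDeriv_smul (x := extChartAt 𝓘(ℝ, E) x x) c (η.inChart x)
  simp only [Form.d, Form.inChart_const_smul, h]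
  rfl

lemma contDiffAt_comp_chart_symm {f : M → ℝ} {x : M}
    (hf : ContMDiffAt 𝓘(ℝ, E) 𝓘(ℝ, ℝ) ∞ f x) :
    ContDiffAt ℝ ∞ (fun y => f ((extChartAt 𝓘(ℝ, E) x).symm y)) (extChartAt 𝓘(ℝ, E) x x) := by
  have := contDiffAt_writtenInChart hf
  simpa only [extChartAt_model_space_eq_id, PartialEquiv.refl_coe, id] using this

lemma Form.SmoothAt.fun_smul {η : Form E M k} {f : M → ℝ} {x : M} (hη : η.SmoothAt x)
    (hf : ContMDiffAt 𝓘(ℝ, E) 𝓘(ℝ, ℝ) ∞ f x) : Form.SmoothAt (fun y => f y • η y) x :=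
  (contDiffAt_comp_chart_symm hf).smul hη

/-- The Leibniz rule `d(fβ) = df ∧ β + f dβ`. -/
lemma OneForm.d_fun_smul {β : OneForm E M} {f : M → ℝ} {x : M} (hβ : β.toForm.SmoothAt x)
    (hf : ContMDiffAt 𝓘(ℝ, E) 𝓘(ℝ, ℝ) ∞ f x) (u v : TangentSpace 𝓘(ℝ, E) x) :
    (OneForm.toForm (fun y => f y • β y)).d x ![u, v] =
      dFun f x u * β x v - dFun f x v * β x u + f x * β.toForm.d x ![u, v] := by
  set e := extChartAt 𝓘(ℝ, E) x with he
  let g : E → ℝ := fun y => f (e.symm y)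
  let ζ : E → E [⋀^Fin 1]→L[ℝ] ℝ := β.toForm.inChart x
  have hg : DifferentiableAt ℝ g (e x) :=
    (contDiffAt_comp_chart_symm hf).differentiableAt (by simp)
  have hζ : DifferentiableAt ℝ ζ (e x) := hβ.differentiableAt (by simp)
  have hgx : g (e x) = f x := by simp only [g, e, extChartAt_to_inv]
  have hu : ∀ w : TangentSpace 𝓘(ℝ, E) x,
      ζ (e x) ![(mfderiv 𝓘(ℝ, E) 𝓘(ℝ, E) e x w : E)] = β x w := by
    intro w
    have h1 := mfderiv_extChartAt_symm_comp x (mem_extChartAt_source x) w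
    have h2 := congrArg (β (e.symm (e x)) : E → ℝ) h1
    refine Eq.trans h2 ?_
    exact congrArg (fun z => (β z : E → ℝ) w) (extChartAt_to_inv x)
  have hdf : ∀ w : TangentSpace 𝓘(ℝ, E) x,
      fderiv ℝ g (e x) (mfderiv 𝓘(ℝ, E) 𝓘(ℝ, E) e x w : E) = dFun f x w := by
    intro w
    have h1 := mfderiv_comp x (I'' := 𝓘(ℝ, ℝ)) (g := g) hg.mdifferentiableAt
      (mdifferentiableAt_extChartAt' x (mem_extChartAt_source x))
    have h2 : g ∘ e =ᶠ[𝓝 x] f := by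
      filter_upwards [extChartAt_source_mem_nhds (I := 𝓘(ℝ, E)) x] with z hz
      simp only [g, Function.comp_apply, e.left_inv hz]
    rw [h2.mfderiv_eq, mfderiv_eq_fderiv] at h1
    exact (DFunLike.congr_fun h1 w).symm
  have key : ∀ a b : E, extDeriv (fun y => g y • ζ y) (e x) ![a, b] =
      fderiv ℝ g (e x) a * ζ (e x) ![b] - fderiv ℝ g (e x) b * ζ (e x) ![a] +
        g (e x) * extDeriv ζ (e x) ![a, b] := by
    intro a b
    rw [extDeriv_apply (hg.fun_smul hζ), extDeriv_apply hζ, Fin.sum_univ_two, Fin.sum_univ_two]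
    have e0 : (0 : Fin 2).removeNth ![a, b] = ![b] := by
      ext i; fin_cases i; rfl
    have e1 : (1 : Fin 2).removeNth ![a, b] = ![a] := by
      ext i; fin_cases i; rfl
    have h1 : ∀ (w : Fin 1 → E) (c : E), fderiv ℝ (fun y => (g y • ζ y) w) (e x) c =
        g (e x) * fderiv ℝ (fun y => ζ y w) (e x) c + fderiv ℝ g (e x) c * ζ (e x) w := by
      intro w c
      have := fderiv_fun_mul hg (hζ.continuousAlternatingMap_apply_const w)
      change fderiv ℝ (fun y => g y * ζ y w) (e x) c = _
      rw [this]
      simp [mul_comm]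
    simp only [e0, e1, h1]
    simp
    ring
  have h := key (mfderiv 𝓘(ℝ, E) 𝓘(ℝ, E) e x u) (mfderiv 𝓘(ℝ, E) 𝓘(ℝ, E) e x v)
  rw [hu, hu, hdf, hdf, hgx] at h
  have hvec : ∀ ξ : E [⋀^Fin 2]→L[ℝ] ℝ, ξ.compContinuousLinearMap
      (mfderiv 𝓘(ℝ, E) 𝓘(ℝ, E) e x) ![u, v] =
      ξ ![mfderiv 𝓘(ℝ, E) 𝓘(ℝ, E) e x u, mfderiv 𝓘(ℝ, E) 𝓘(ℝ, E) e x v] := by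
    intro ξ
    refine congrArg ξ (funext fun i => ?_)
    fin_cases i <;> rfl
  refine (hvec _).trans (h.trans ?_)
  congr 2
  exact (hvec _).symm

end FormCalculus

section Metric

variable {E M : Type*}
  [NormedAddCommGroup E] [NormedSpace ℝ E] [FiniteDimensional ℝ E]
  [TopologicalSpace M] [ChartedSpace E M] [IsManifold 𝓘(ℝ, E) ∞ M]

/-- The coefficient on a fixed model vector is `g` applied to `X` and to the image of that vector
under the derivative of the inverse chart; all three are smooth sections along the inverse chart. -/
lemma HyperKahler.alpha0_smooth (S : HyperKahler E M) {X : VField E M} (hX : SmoothVField X) :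
    (OneForm.toForm (S.alpha0 X)).Smooth := by
  refine Form.smooth_of_smoothAt fun x => ?_
  set e := extChartAt 𝓘(ℝ, E) x with he
  rw [Form.SmoothAt, contDiffAt_alternating_iff]
  intro v
  have h1 : ContMDiffAt 𝓘(ℝ, E) 𝓘(ℝ, E) ∞ e.symm (e x) :=
    contMDiffAt_extChartAt_symm x (mem_extChartAt_target x)
  have h2 : ContMDiffAt 𝓘(ℝ, E) 𝓘(ℝ, E).tangent ∞ (fun y : E => Bundle.TotalSpace.mk' E
      (E := (TangentSpace 𝓘(ℝ, E) : M → Type _)) (e.symm y)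
      (mfderiv 𝓘(ℝ, E) 𝓘(ℝ, E) e.symm y (v 0))) (e x) := by
    have hopen : IsOpen e.target := isOpen_extChartAt_target x
    have h3 := (contMDiffOn_extChartAt_symm (I := 𝓘(ℝ, E)) (n := ∞) x).contMDiffOn_tangentMapWithin
      (m := ∞) (by simp) hopen.uniqueMDiffOn
    have h4 : ContMDiff 𝓘(ℝ, E) 𝓘(ℝ, E).tangent ∞
        (fun y : E => (⟨y, v 0⟩ : TangentBundle 𝓘(ℝ, E) E)) :=
      contMDiff_vectorSpace_iff_contDiff.2 contDiff_const
    have h5 := h3.comp h4.contMDiffOn (s := e.target) fun y hy => hy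
    refine (h5.contMDiffAt (hopen.mem_nhds (mem_extChartAt_target x))).congr_of_eventuallyEq ?_
    filter_upwards [hopen.mem_nhds (mem_extChartAt_target x)] with y hy
    simp only [Function.comp_apply, tangentMapWithin]
    rw [mfderivWithin_of_isOpen hopen hy]
  have h3 : ContMDiffAt 𝓘(ℝ, E) (𝓘(ℝ, E).prod 𝓘(ℝ, ℝ)) ∞
      (fun y : E => Bundle.TotalSpace.mk' ℝ (E := Bundle.Trivial M ℝ) (e.symm y)
        (S.g (e.symm y) (X (e.symm y)) (mfderiv 𝓘(ℝ, E) 𝓘(ℝ, E) e.symm y (v 0)))) (e x) := by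
    apply ContMDiffAt.clm_bundle_apply₂ (F₁ := E) (F₂ := E)
    · exact S.g_smooth.contMDiffAt.comp (e x) h1
    · exact hX.contMDiffAt.comp (e x) h1
    · exact h2
  simp only [Bundle.contMDiffAt_totalSpace] at h3
  exact h3.2.contDiffAt

end Metric

section TwoForm

variable {V : Type*} [AddCommGroup V] [Module ℝ V] [TopologicalSpace V]

lemma twoForm_swap (η : V [⋀^Fin 2]→L[ℝ] ℝ) (u v : V) : η ![u, v] = -η ![v, u] := by
  have h := η.toAlternatingMap.map_swap ![v, u] (i := 0) (j := 1) (by simp)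
  have h2 : ![v, u] ∘ Equiv.swap (0 : Fin 2) 1 = ![u, v] := by
    funext i; fin_cases i <;> simp
  rw [h2] at h
  exact h

lemma twoForm_self (η : V [⋀^Fin 2]→L[ℝ] ℝ) (u : V) : η ![u, u] = 0 := by
  have := twoForm_swap η u u
  linarith

lemma twoForm_add_left (η : V [⋀^Fin 2]→L[ℝ] ℝ) (u u' v : V) :
    η ![u + u', v] = η ![u, v] + η ![u', v] :=
  η.toAlternatingMap.map_vecCons_add ![v] u u'

lemma twoForm_smul_left (η : V [⋀^Fin 2]→L[ℝ] ℝ) (c : ℝ) (u v : V) :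
    η ![c • u, v] = c * η ![u, v] :=
  η.toAlternatingMap.map_vecCons_smul ![v] c u

lemma twoForm_add_right (η : V [⋀^Fin 2]→L[ℝ] ℝ) (u v v' : V) :
    η ![u, v + v'] = η ![u, v] + η ![u, v'] := by
  rw [twoForm_swap, twoForm_add_left, twoForm_swap η u v, twoForm_swap η u v']; ring

lemma twoForm_smul_right (η : V [⋀^Fin 2]→L[ℝ] ℝ) (c : ℝ) (u v : V) :
    η ![u, c • v] = c * η ![u, v] := by
  rw [twoForm_swap, twoForm_smul_left, twoForm_swap η u v]; ring

lemma twoForm_ext {η ζ : V [⋀^Fin 2]→L[ℝ] ℝ} (h : ∀ u v, η ![u, v] = ζ ![u, v]) : η = ζ := by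
  ext v
  have : v = ![v 0, v 1] := by funext i; fin_cases i <;> rfl
  rw [this, h]

end TwoForm

/-! ### Descent of maps and forms along a circle bundle. -/

section Descent

variable {W P Q EP EW EQ : Type*}
  [NormedAddCommGroup EP] [NormedSpace ℝ EP] [FiniteDimensional ℝ EP]
  [TopologicalSpace P] [ChartedSpace EP P] [IsManifold 𝓘(ℝ, EP) ∞ P]
  [NormedAddCommGroup EW] [NormedSpace ℝ EW] [FiniteDimensional ℝ EW]
  [TopologicalSpace W] [ChartedSpace EW W] [IsManifold 𝓘(ℝ, EW) ∞ W]
  [NormedAddCommGroup EQ] [NormedSpace ℝ EQ]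
  [TopologicalSpace Q] [ChartedSpace EQ Q]
  {T : ℝ} {pr : P → W} {V : VField EP P}

lemma Form.pullback_apply_two (f : P → W) (η : Form EW W 2) (p : P)
    (u v : TangentSpace 𝓘(ℝ, EP) p) : (η.pullback f : Form EP P 2) p ![u, v] =
      η (f p) ![mfderiv 𝓘(ℝ, EP) 𝓘(ℝ, EW) f p u, mfderiv 𝓘(ℝ, EP) 𝓘(ℝ, EW) f p v] := by
  refine congrArg (η (f p)) (funext fun i => ?_)
  fin_cases i <;> rfl

namespace IsPrincipalCircleBundle

lemma exists_section (hb : IsPrincipalCircleBundle (E := EW) T pr V) (w : W) :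
    ∃ s : W → P, ContMDiffAt 𝓘(ℝ, EW) 𝓘(ℝ, EP) ∞ s w ∧ ∀ᶠ x in 𝓝 w, pr (s x) = x := by
  obtain ⟨p, rfl⟩ := hb.surjective w
  obtain ⟨s, h1, -, h2⟩ := exists_local_section hb.submersion p
  exact ⟨s, h1, h2⟩

/-- Near each point `g` is `g ∘ pr` composed with a local section. -/
lemma contMDiff_of_comp (hb : IsPrincipalCircleBundle (E := EW) T pr V) {g : W → Q}
    (hg : ContMDiff 𝓘(ℝ, EP) 𝓘(ℝ, EQ) ∞ (g ∘ pr)) : ContMDiff 𝓘(ℝ, EW) 𝓘(ℝ, EQ) ∞ g := by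
  intro w
  obtain ⟨s, h1, h2⟩ := hb.exists_section w
  refine ((hg (s w)).comp w h1).congr_of_eventuallyEq ?_
  filter_upwards [h2] with x hx
  simp only [Function.comp_apply, hx]

lemma contMDiff_uncurry_of_comp (hb : IsPrincipalCircleBundle (E := EW) T pr V) {g : ℝ → W → Q}
    (hg : ContMDiff (𝓘(ℝ, ℝ).prod 𝓘(ℝ, EP)) 𝓘(ℝ, EQ) ∞ (fun q : ℝ × P => g q.1 (pr q.2))) :
    ContMDiff (𝓘(ℝ, ℝ).prod 𝓘(ℝ, EW)) 𝓘(ℝ, EQ) ∞ (fun q : ℝ × W => g q.1 q.2) := by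
  rintro ⟨t, w⟩
  obtain ⟨s, h1, h2⟩ := hb.exists_section w
  have h3 : ContMDiffAt (𝓘(ℝ, ℝ).prod 𝓘(ℝ, EW)) (𝓘(ℝ, ℝ).prod 𝓘(ℝ, EP)) ∞
      (fun q : ℝ × W => (q.1, s q.2)) (t, w) :=
    contMDiffAt_fst.prodMk (ContMDiffAt.comp (t, w) (g := s) h1 contMDiffAt_snd)
  refine ((hg (t, s w)).comp (t, w) h3).congr_of_eventuallyEq ?_
  have hsnd : ContinuousAt (Prod.snd : ℝ × W → W) (t, w) := continuousAt_snd
  have h4 : ∀ᶠ q : ℝ × W in 𝓝 (t, w), pr (s q.2) = q.2 := hsnd.eventually h2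
  filter_upwards [h4] with x hx
  simp only [Function.comp_apply, hx]

/-- Maps that are constant on the fibres descend. -/
lemma exists_descent (hb : IsPrincipalCircleBundle (E := EW) T pr V) {g : P → Q}
    (hg : ∀ p q, pr p = pr q → g p = g q) : ∃ g' : W → Q, ∀ p, g' (pr p) = g p :=
  ⟨fun w => g (Function.surjInv hb.surjective w), fun p =>
    hg _ _ (Function.surjInv_eq hb.surjective (pr p))⟩

lemma form_eq_of_pullback_eq (hb : IsPrincipalCircleBundle (E := EW) T pr V) {k : ℕ}
    {η ζ : Form EW W k} {p : P}
    (h : (η.pullback pr : Form EP P k) p = (ζ.pullback pr : Form EP P k) p) :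
    η (pr p) = ζ (pr p) := by
  ext v
  choose u hu using fun i => hb.mfderiv_surjective p (v i)
  have := DFunLike.congr_fun h u
  have h2 : v = fun i => mfderiv 𝓘(ℝ, EP) 𝓘(ℝ, EW) pr p (u i) := funext fun i => (hu i).symm
  rw [h2]
  exact this

/-- Near each point `η` is recovered by pulling its pull-back to P down again along a local section.
-/
lemma smooth_of_pullback (hb : IsPrincipalCircleBundle (E := EW) T pr V) {k : ℕ}
    {η : Form EW W k} (h : (η.pullback pr : Form EP P k).Smooth) : η.Smooth := by
  refine Form.smooth_of_smoothAt fun w => ?_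
  obtain ⟨s, h1, h2⟩ := hb.exists_section w
  refine ((h.smoothAt (s w)).pullback h1).congr ?_
  have h3 : ∀ᶠ x in 𝓝 w, MDifferentiableAt 𝓘(ℝ, EW) 𝓘(ℝ, EP) s x := by
    have := (contMDiffAt_iff_contMDiffAt_nhds (n := 1) (by simp)).1 (h1.of_le (by simp))
    filter_upwards [this] with z hz using hz.mdifferentiableAt (by simp)
  filter_upwards [h2.eventually_nhds, h3] with x hx hx3
  ext v
  have h4 : ∀ u : EW, (mfderiv 𝓘(ℝ, EP) 𝓘(ℝ, EW) pr (s x)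
      (mfderiv 𝓘(ℝ, EW) 𝓘(ℝ, EP) s x u) : EW) = u := by
    intro u
    have h5 := mfderiv_comp x ((hb.smooth (s x)).mdifferentiableAt (by simp)) hx3
    have h6 : pr ∘ s =ᶠ[𝓝 x] id := hx
    rw [h6.mfderiv_eq, mfderiv_id] at h5
    exact (DFunLike.congr_fun h5 u).symm
  refine (congrArg (η (pr (s x))) (funext fun i => h4 (v i))).trans ?_
  exact Form.apply_congr η hx.self_of_nhds v

/-- Invariant two-forms that annihilate the generator descend. -/
lemma exists_twoForm_descent (hb : IsPrincipalCircleBundle (E := EW) T pr V)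
    (hV : ∀ p, V p ≠ 0) {η : Form EP P 2}
    (hη : ∀ φ : ℝ → P → P, IsCircleFlow T V φ → PreservesTwoForm φ η)
    (hηV : ∀ p (u : TangentSpace 𝓘(ℝ, EP) p), η p ![V p, u] = 0) :
    ∃ η' : Form EW W 2, (η'.pullback pr : Form EP P 2) = η := by
  -- The right inverses of the differential are chosen with no regularity in `p`. The descended form
  -- is defined through one chosen point in each fibre and compared with `η` elsewhere afterwards;
  -- its smoothness is a separate matter.
  have hR : ∀ p : P, ∃ R : EW →L[ℝ] EP, ∀ u : EW,
      (mfderiv 𝓘(ℝ, EP) 𝓘(ℝ, EW) pr p (R u) : EW) = u := by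
    intro p
    let D : EP →L[ℝ] EW := mfderiv 𝓘(ℝ, EP) 𝓘(ℝ, EW) pr p
    obtain ⟨R, hR⟩ := LinearMap.exists_rightInverse_of_surjective (D : EP →ₗ[ℝ] EW)
      (LinearMap.range_eq_top.2 fun u => hb.mfderiv_surjective p u)
    exact ⟨R.toContinuousLinearMap, fun u => LinearMap.congr_fun hR u⟩
  choose R hR using hR
  let η₀ : P → EP [⋀^Fin 2]→L[ℝ] ℝ := η
  let V₀ : P → EP := V
  let η' : Form EW W 2 := fun w =>
    ((η₀ (Function.surjInv hb.surjective w)).compContinuousLinearMap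
      (R (Function.surjInv hb.surjective w)) : EW [⋀^Fin 2]→L[ℝ] ℝ)
  refine ⟨η', ?_⟩
  funext p
  refine twoForm_ext fun u v => ?_
  rw [Form.pullback_apply_two]
  obtain ⟨χ, hχ, -, hfib⟩ := hb.action
  set q := Function.surjInv hb.surjective (pr p) with hq
  obtain ⟨t, ht⟩ := (hfib q p).1 (Function.surjInv_eq hb.surjective (pr p))
  have hprχ : pr ∘ χ t = pr := funext fun r => ((hfib r _).2 ⟨t, rfl⟩).symm
  -- Carried from `q` to `p` by the flow, the chosen lift has the same projection as `u`, so it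
  -- differs from `u` by a multiple of the generator, which `η` annihilates.
  have key : ∀ u : EP, ∃ c : ℝ, (mfderiv 𝓘(ℝ, EP) 𝓘(ℝ, EP) (χ t) q
      (R q (mfderiv 𝓘(ℝ, EP) 𝓘(ℝ, EW) pr p u)) : EP) = u + c • V₀ p := by
    intro u
    set u₀ : EP := R q (mfderiv 𝓘(ℝ, EP) 𝓘(ℝ, EW) pr p u)
    have h1 := mfderiv_comp q ((hb.smooth (χ t q)).mdifferentiableAt (by simp))
      ((hχ.contMDiff_right t q).mdifferentiableAt (by simp))
    rw [hprχ] at h1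
    have h2 : (mfderiv 𝓘(ℝ, EP) 𝓘(ℝ, EW) pr q u₀ : EW) =
        mfderiv 𝓘(ℝ, EP) 𝓘(ℝ, EW) pr (χ t q) (mfderiv 𝓘(ℝ, EP) 𝓘(ℝ, EP) (χ t) q u₀) :=
      DFunLike.congr_fun h1 u₀
    rw [ht] at h2
    have h3 : (mfderiv 𝓘(ℝ, EP) 𝓘(ℝ, EW) pr q u₀ : EW) = mfderiv 𝓘(ℝ, EP) 𝓘(ℝ, EW) pr p u :=
      hR q _
    let w : TangentSpace 𝓘(ℝ, EP) p := (mfderiv 𝓘(ℝ, EP) 𝓘(ℝ, EP) (χ t) q u₀ : EP)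
    let u₁ : TangentSpace 𝓘(ℝ, EP) p := u
    have h4 : mfderiv 𝓘(ℝ, EP) 𝓘(ℝ, EW) pr p (w - u₁) = 0 := by
      rw [map_sub]
      exact sub_eq_zero.2 (h2.symm.trans h3)
    obtain ⟨c, hc⟩ := hb.eq_smul_of_mfderiv_eq_zero p (hV p) _ h4
    exact ⟨c, sub_eq_iff_eq_add'.1 hc⟩
  let u₀ : EP := u
  let v₀ : EP := v
  obtain ⟨c, hc⟩ := key u₀
  obtain ⟨d, hd⟩ := key v₀
  have h1 := hη χ hχ t q (R q (mfderiv 𝓘(ℝ, EP) 𝓘(ℝ, EW) pr p u))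
    (R q (mfderiv 𝓘(ℝ, EP) 𝓘(ℝ, EW) pr p v))
  have h2 : η₀ (χ t q) ![u₀ + c • V₀ p, v₀ + d • V₀ p] =
      η₀ q ![R q (mfderiv 𝓘(ℝ, EP) 𝓘(ℝ, EW) pr p u), R q (mfderiv 𝓘(ℝ, EP) 𝓘(ℝ, EW) pr p v)] := by
    refine Eq.trans ?_ h1
    refine congrArg (η₀ (χ t q)) (funext fun i => ?_)
    fin_cases i
    · exact hc.symm
    · exact hd.symm
  rw [ht] at h2
  have h3 : η₀ p ![u₀ + c • V₀ p, v₀ + d • V₀ p] = η₀ p ![u₀, v₀] := by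
    have h4 : ∀ w : EP, η₀ p ![V₀ p, w] = 0 := hηV p
    rw [twoForm_add_left, twoForm_smul_left, h4, twoForm_add_right, twoForm_smul_right,
      twoForm_swap _ u₀ (V₀ p), h4]
    ring
  refine Eq.trans ?_ (h2.symm.trans h3)
  refine congrArg (η₀ q) (funext fun i => ?_)
  fin_cases i <;> rfl

end IsPrincipalCircleBundle

end Descent

/-! ### The rescaled connection θ/a and the two commuting flows. -/

/-- The connection of the inverse twist. -/
def twistedConnection {M EP P : Type*} [NormedAddCommGroup EP] [NormedSpace ℝ EP]
    [TopologicalSpace P] [ChartedSpace EP P] (a : M → ℝ) (pr : P → M) (θ : OneForm EP P) :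
    OneForm EP P :=
  fun p => (a (pr p))⁻¹ • θ p

namespace IsTwist

variable {E M EP P EW W : Type*}
  [NormedAddCommGroup E] [NormedSpace ℝ E] [FiniteDimensional ℝ E]
  [TopologicalSpace M] [T2Space M] [ChartedSpace E M] [IsManifold 𝓘(ℝ, E) ∞ M]
  [NormedAddCommGroup EP] [NormedSpace ℝ EP] [FiniteDimensional ℝ EP]
  [TopologicalSpace P] [T2Space P] [ChartedSpace EP P] [IsManifold 𝓘(ℝ, EP) ∞ P]
  [NormedAddCommGroup EW] [NormedSpace ℝ EW] [FiniteDimensional ℝ EW]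
  [TopologicalSpace W] [T2Space W] [ChartedSpace EW W] [IsManifold 𝓘(ℝ, EW) ∞ W]
  {T TP TW : ℝ} {X : VField E M} {a : M → ℝ} {F : Form E M 2}
  {pr : P → M} {Z : VField EP P} {θ : OneForm EP P} {X' : VField EP P} {prW : P → W}
  (ht : IsTwist (EW := EW) T TP TW X a F pr Z θ X' prW)

include ht

lemma Z_ne_zero (p : P) : Z p ≠ 0 := by
  intro h
  have := ht.connection.generator p
  rw [h, map_zero] at this
  exact zero_ne_one this

lemma mfderiv_Z (p : P) : mfderiv 𝓘(ℝ, EP) 𝓘(ℝ, E) pr p (Z p) = 0 :=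
  ht.bundle.mfderiv_generator p

lemma mfderiv_lift (p : P) : mfderiv 𝓘(ℝ, EP) 𝓘(ℝ, E) pr p (X' p) = X (pr p) := by
  have h := (ht.lift p).2
  rwa [map_sub, map_smul, ht.mfderiv_Z, smul_zero, sub_zero] at h

lemma theta_lift (p : P) : θ p (X' p) = a (pr p) := by
  have h := (ht.lift p).1
  rw [map_sub, map_smul, ht.connection.generator, smul_eq_mul, mul_one] at h
  linarith

lemma X'_ne_zero (p : P) : X' p ≠ 0 := by
  intro h
  have := ht.theta_lift p
  rw [h, map_zero] at this
  exact ht.a_ne_zero _ this.symm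

/-- A tangent vector to `P` is determined by its connection form and its projection. -/
lemma eq_zero_of_horizontal {p : P} {v : TangentSpace 𝓘(ℝ, EP) p} (h1 : θ p v = 0)
    (h2 : mfderiv 𝓘(ℝ, EP) 𝓘(ℝ, E) pr p v = 0) : v = 0 := by
  obtain ⟨c, rfl⟩ := ht.bundle.eq_smul_of_mfderiv_eq_zero p (ht.Z_ne_zero p) v h2
  rw [map_smul, ht.connection.generator, smul_eq_mul, mul_one] at h1
  rw [h1, zero_smul]

lemma eq_of_horizontal {p : P} {v w : TangentSpace 𝓘(ℝ, EP) p} (h1 : θ p v = θ p w)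
    (h2 : mfderiv 𝓘(ℝ, EP) 𝓘(ℝ, E) pr p v = mfderiv 𝓘(ℝ, EP) 𝓘(ℝ, E) pr p w) : v = w :=
  sub_eq_zero.1 (ht.eq_zero_of_horizontal (by rw [map_sub, h1, sub_self])
    (by rw [map_sub, h2, sub_self]))

/-- Horizontal lifts from the twist. -/
lemma exists_horizontal_quotient (p : P) (u : TangentSpace 𝓘(ℝ, EW) (prW p)) :
    ∃ v : TangentSpace 𝓘(ℝ, EP) p, θ p v = 0 ∧ mfderiv 𝓘(ℝ, EP) 𝓘(ℝ, EW) prW p v = u := by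
  obtain ⟨v, hv⟩ := ht.quotient.mfderiv_surjective p u
  refine ⟨v - (θ p v / a (pr p)) • X' p, ?_, ?_⟩
  · rw [map_sub, map_smul, ht.theta_lift, smul_eq_mul, div_mul_cancel₀ _ (ht.a_ne_zero _), sub_self]
  · rw [map_sub, map_smul, ht.quotient.mfderiv_generator, smul_zero, sub_zero, hv]

lemma dFun_generator (x : M) : dFun a x (X x) = 0 := by
  have := ht.da x (X x)
  rw [twoForm_self, neg_zero] at this
  exact this

lemma contMDiff_a_pr : ContMDiff 𝓘(ℝ, EP) 𝓘(ℝ, ℝ) ∞ (fun p => a (pr p)) :=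
  ht.a_smooth.comp ht.bundle.smooth

lemma dFun_comp {f : M → ℝ} (hf : ContMDiff 𝓘(ℝ, E) 𝓘(ℝ, ℝ) ∞ f) (p : P)
    (u : TangentSpace 𝓘(ℝ, EP) p) :
    dFun (fun p => f (pr p)) p u = dFun f (pr p) (mfderiv 𝓘(ℝ, EP) 𝓘(ℝ, E) pr p u) := by
  have h := mfderiv_comp p ((hf (pr p)).mdifferentiableAt (by simp))
    ((ht.bundle.smooth p).mdifferentiableAt (by simp))
  exact DFunLike.congr_fun h u

lemma dFun_a_pr_lift (p : P) : dFun (fun p => a (pr p)) p (X' p) = 0 := by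
  rw [ht.dFun_comp ht.a_smooth, ht.mfderiv_lift, ht.dFun_generator]

lemma dFun_a_pr_Z (p : P) : dFun (fun p => a (pr p)) p (Z p) = 0 := by
  rw [ht.dFun_comp ht.a_smooth, ht.mfderiv_Z, map_zero]

lemma theta_smooth : θ.toForm.Smooth := ht.connection.smooth

/-- `X' ⌟ dθ = -d(a ∘ pr)`. -/
lemma dtheta_lift (p : P) (u : TangentSpace 𝓘(ℝ, EP) p) :
    θ.toForm.d p ![X' p, u] = -dFun (fun p => a (pr p)) p u := by
  rw [ht.curvature, ht.mfderiv_lift, ht.dFun_comp ht.a_smooth]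
  have := ht.da (pr p) (mfderiv 𝓘(ℝ, EP) 𝓘(ℝ, E) pr p u)
  change dFun a (pr p) _ = _ at this
  rw [this, neg_neg]

/-- The connection is preserved by the flow of the lifted vector field. -/
lemma preserves_theta {χ : ℝ → P → P} (hχ : IsCircleFlow TW X' χ) : PreservesOneForm χ θ :=
  hχ.preservesOneForm ht.theta_smooth ht.contMDiff_a_pr ht.theta_lift
    fun p u => by rw [ht.dtheta_lift, neg_add_cancel]

lemma a_comp_lift {χ : ℝ → P → P} (hχ : IsCircleFlow TW X' χ) (t : ℝ) (p : P) :
    a (pr (χ t p)) = a (pr p) :=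
  hχ.comp_eq_of_mfderiv_eq_zero ht.contMDiff_a_pr ht.dFun_a_pr_lift t p

/-- Any flow generated by Z agrees with the one supplied by the bundle, by uniqueness of integral
curves. -/
lemma pr_principal {ψ : ℝ → P → P} (hψ : IsCircleFlow TP Z ψ) (t : ℝ) (p : P) :
    pr (ψ t p) = pr p := by
  obtain ⟨ψ', hψ', -, h⟩ := ht.bundle.action
  have : ψ t p = ψ' t p := by
    have := hψ'.eq_of_isMIntegralCurve (hψ.generator p) t
    simpa [hψ.map_zero] using this
  rw [this]
  exact ((h p _).2 ⟨t, rfl⟩).symm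

lemma prW_lift {χ : ℝ → P → P} (hχ : IsCircleFlow TW X' χ) (t : ℝ) (p : P) :
    prW (χ t p) = prW p := by
  obtain ⟨ψ', hψ', -, h⟩ := ht.quotient.action
  have : χ t p = ψ' t p := by
    have := hψ'.eq_of_isMIntegralCurve (hχ.generator p) t
    simpa [hχ.map_zero] using this
  rw [this]
  exact ((h p _).2 ⟨t, rfl⟩).symm

lemma pr_lift {χ : ℝ → P → P} (hχ : IsCircleFlow TW X' χ) {ξ : ℝ → M → M}
    (hξ : IsCircleFlow T X ξ) (t : ℝ) (p : P) : pr (χ t p) = ξ t (pr p) :=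
  hξ.map_flow hχ ht.bundle.smooth ht.mfderiv_lift t p

/-- The principal flow preserves the lifted vector field. -/
lemma mfderiv_principal_lift {ψ : ℝ → P → P} (hψ : IsCircleFlow TP Z ψ) (t : ℝ) (p : P) :
    mfderiv 𝓘(ℝ, EP) 𝓘(ℝ, EP) (ψ t) p (X' p) = X' (ψ t p) := by
  refine ht.eq_of_horizontal ?_ ?_
  · rw [ht.connection.invariant ψ hψ, ht.theta_lift, ht.theta_lift, ht.pr_principal hψ]
  · have h1 := mfderiv_comp p ((ht.bundle.smooth (ψ t p)).mdifferentiableAt (by simp))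
      ((hψ.contMDiff_right t p).mdifferentiableAt (by simp))
    have h2 : pr ∘ ψ t = pr := funext fun q => ht.pr_principal hψ t q
    rw [h2] at h1
    have h3 := DFunLike.congr_fun h1 (X' p)
    rw [ht.mfderiv_lift]
    have h4 : (mfderiv 𝓘(ℝ, EP) 𝓘(ℝ, E) pr p (X' p) : E) =
      mfderiv 𝓘(ℝ, EP) 𝓘(ℝ, E) pr (ψ t p) (mfderiv 𝓘(ℝ, EP) 𝓘(ℝ, EP) (ψ t) p (X' p)) := h3
    refine h4.symm.trans ((ht.mfderiv_lift p).trans ?_)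
    rw [ht.pr_principal hψ]

/-- `ψ s` maps X' to itself and therefore carries integral curves of X' to integral curves of X'. -/
lemma commute {ψ χ : ℝ → P → P} (hψ : IsCircleFlow TP Z ψ) (hχ : IsCircleFlow TW X' χ)
    (s t : ℝ) (p : P) : ψ s (χ t p) = χ t (ψ s p) :=
  hχ.map_flow hχ (hψ.contMDiff_right s) (ht.mfderiv_principal_lift hψ s) t p

/-! The inverse connection. -/

lemma contMDiff_inv_a_pr : ContMDiff 𝓘(ℝ, EP) 𝓘(ℝ, ℝ) ∞ (fun p => (a (pr p))⁻¹) := fun p =>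
  (contDiffAt_inv ℝ (ht.a_ne_zero (pr p))).contMDiffAt.comp p (ht.contMDiff_a_pr p)

lemma twistedConnection_smooth : (twistedConnection a pr θ).toForm.Smooth :=
  Form.smooth_of_smoothAt fun p =>
    (ht.theta_smooth.smoothAt p).fun_smul (ht.contMDiff_inv_a_pr p)

lemma twistedConnection_lift (p : P) : twistedConnection a pr θ p (X' p) = 1 := by
  change (a (pr p))⁻¹ * θ p (X' p) = 1
  rw [ht.theta_lift, inv_mul_cancel₀ (ht.a_ne_zero _)]

lemma twistedConnection_eq_zero_iff (p : P) (v : TangentSpace 𝓘(ℝ, EP) p) :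
    twistedConnection a pr θ p v = 0 ↔ θ p v = 0 := by
  change (a (pr p))⁻¹ * θ p v = 0 ↔ _
  simp [ht.a_ne_zero]

lemma lift_preserves_twistedConnection {χ : ℝ → P → P} (hχ : IsCircleFlow TW X' χ) :
    PreservesOneForm χ (twistedConnection a pr θ) := by
  intro t p u
  change (a (pr (χ t p)))⁻¹ * θ (χ t p) _ = (a (pr p))⁻¹ * θ p u
  rw [ht.preserves_theta hχ, ht.a_comp_lift hχ]

lemma principal_preserves_twistedConnection {ψ : ℝ → P → P} (hψ : IsCircleFlow TP Z ψ) :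
    PreservesOneForm ψ (twistedConnection a pr θ) := by
  intro t p u
  change (a (pr (ψ t p)))⁻¹ * θ (ψ t p) _ = (a (pr p))⁻¹ * θ p u
  rw [ht.connection.invariant ψ hψ, ht.pr_principal hψ]

lemma twistedConnection_isConnection : IsConnection TW X' (twistedConnection a pr θ) :=
  ⟨ht.twistedConnection_smooth, ht.twistedConnection_lift,
    fun _ hχ => ht.lift_preserves_twistedConnection hχ⟩

lemma dFun_inv (p : P) (u : TangentSpace 𝓘(ℝ, EP) p) :
    dFun (fun p => (a (pr p))⁻¹) p u =
      -dFun (fun p => a (pr p)) p u / a (pr p) ^ 2 := by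
  have h1 : HasMFDerivAt 𝓘(ℝ, ℝ) 𝓘(ℝ, ℝ) (fun r : ℝ => r⁻¹) (a (pr p))
      (ContinuousLinearMap.toSpanSingleton ℝ (-(a (pr p) ^ 2)⁻¹)) :=
    (hasDerivAt_inv (ht.a_ne_zero _)).hasFDerivAt.hasMFDerivAt
  have h2 := h1.comp p ((ht.contMDiff_a_pr p).mdifferentiableAt (by simp)).hasMFDerivAt
  have h3 := DFunLike.congr_fun h2.mfderiv u
  refine Eq.trans h3 ?_
  change dFun (fun p => a (pr p)) p u * (-(a (pr p) ^ 2)⁻¹) = _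
  ring

lemma d_twistedConnection (p : P) (u v : TangentSpace 𝓘(ℝ, EP) p) :
    (twistedConnection a pr θ).toForm.d p ![u, v] =
      (a (pr p))⁻¹ * θ.toForm.d p ![u, v] -
        (dFun (fun p => a (pr p)) p u * θ p v - dFun (fun p => a (pr p)) p v * θ p u)
          / a (pr p) ^ 2 := by
  have h := OneForm.d_fun_smul (ht.theta_smooth.smoothAt p) (ht.contMDiff_inv_a_pr p) u v
  refine Eq.trans h ?_
  rw [ht.dFun_inv, ht.dFun_inv]
  ring

/-- The two contributions -a⁻¹ da and a⁻² · a · da cancel, the remaining term vanishing because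
da(X') = 0. -/
lemma d_twistedConnection_lift (p : P) (u : TangentSpace 𝓘(ℝ, EP) p) :
    (twistedConnection a pr θ).toForm.d p ![X' p, u] = 0 := by
  rw [ht.d_twistedConnection, ht.dtheta_lift, ht.dFun_a_pr_lift, ht.theta_lift]
  have := ht.a_ne_zero (pr p)
  field_simp
  ring

end IsTwist

/-- A flow preserving a smooth one-form preserves its exterior derivative. -/
lemma PreservesOneForm.d {E M : Type*} [NormedAddCommGroup E] [NormedSpace ℝ E]
    [FiniteDimensional ℝ E] [TopologicalSpace M] [ChartedSpace E M] [IsManifold 𝓘(ℝ, E) ∞ M]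
    {T : ℝ} {X : VField E M} {φ : ℝ → M → M} (hφ : IsCircleFlow T X φ) {β : OneForm E M}
    (hβ : β.toForm.Smooth) (h : PreservesOneForm φ β) : PreservesTwoForm φ β.toForm.d := by
  intro t x u v
  have h1 : (β.toForm.pullback (φ t) : Form E M 1) = β.toForm := by
    funext y
    ext w
    exact h t y (w 0)
  have h2 := Form.d_pullback (x := x) (hβ.smoothAt (φ t x)) (hφ.contMDiff_right t x)
  rw [h1] at h2
  rw [h2, Form.pullback_apply_two]

/-! ### The effective period of the induced action. -/

/-- A free continuous action of `ℝ / Tℤ`, written as a `T`-periodic flow. -/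
structure IsFreePeriodicFlow {P : Type*} [TopologicalSpace P] (T : ℝ) (ψ : ℝ → P → P) : Prop where
  pos : 0 < T
  continuous : ∀ t, Continuous (ψ t)
  map_zero : ∀ p, ψ 0 p = p
  map_add : ∀ s t p, ψ (s + t) p = ψ s (ψ t p)
  periodic : ∀ p, ψ T p = p
  free : IsFreeFlow T ψ

namespace IsFreePeriodicFlow

variable {P : Type*} [TopologicalSpace P] {T T' : ℝ} {ψ χ : ℝ → P → P}

lemma map_int_mul (h : IsFreePeriodicFlow T ψ) (n : ℤ) (p : P) : ψ (n * T) p = p := by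
  induction n using Int.induction_on with
  | zero => simpa using h.map_zero p
  | succ n ih =>
    rw [show ((n : ℤ) + 1 : ℤ) * T = (n : ℤ) * T + T by push_cast; ring, h.map_add, h.periodic, ih]
  | pred n ih =>
    have h1 : ψ (((-(n : ℤ) - 1 : ℤ) : ℝ) * T + T) p = p := by
      rw [show ((-(n : ℤ) - 1 : ℤ) : ℝ) * T + T = ((-(n : ℤ) : ℤ) : ℝ) * T by push_cast; ring, ih]
    rwa [h.map_add, h.periodic] at h1

lemma eq_iff (h : IsFreePeriodicFlow T ψ) (s t : ℝ) (p : P) :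
    ψ s p = ψ t p ↔ ∃ n : ℤ, s = t + n * T := by
  constructor
  · intro hst
    have h1 : ψ (-t + s) p = p := by
      rw [h.map_add, hst, ← h.map_add, neg_add_cancel, h.map_zero]
    obtain ⟨n, hn⟩ := h.free _ _ h1
    exact ⟨n, by linarith⟩
  · rintro ⟨n, rfl⟩
    rw [h.map_add, h.map_int_mul]

lemma iterate (h : IsFreePeriodicFlow T ψ) (t : ℝ) (n : ℕ) (p : P) :
    (ψ t)^[n] p = ψ (n * t) p := by
  induction n with
  | zero => simpa using (h.map_zero p).symm
  | succ n ih =>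
    rw [Function.iterate_succ_apply', ih, ← h.map_add]
    congr 1
    push_cast; ring

/-- A map of finite order commuting with a free circle action and preserving its orbits is a
rotation. -/
lemma exists_eq_of_iterate_eq [T2Space P] [ConnectedSpace P] (h : IsFreePeriodicFlow T ψ)
    {g : P → P} (hg : Continuous g) (hcomm : ∀ t p, g (ψ t p) = ψ t (g p))
    (horb : ∀ p, ∃ t, g p = ψ t p) {n : ℕ} (hn : n ≠ 0) (hgn : ∀ p, g^[n] p = p) :
    ∃ t, ∀ p, g p = ψ t p := by
  have hn' : (n : ℝ) ≠ 0 := by exact_mod_cast hn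
  have hnpos : (0 : ℤ) < n := by exact_mod_cast Nat.pos_of_ne_zero hn
  have hT := h.pos.ne'
  -- Freeness and `g^[n] = id` force the rotation angle at each point into (T/n)ℤ modulo T. The sets
  -- `A i` are finitely many, closed, disjoint and cover P, so each is open as well and
  -- connectedness leaves only one.
  let A : Fin n → Set P := fun i => {p | g p = ψ (i * T / n) p}
  have hA : ∀ i, IsClosed (A i) := fun i => isClosed_eq hg (h.continuous _)
  have hcover : ∀ p, ∃ i, p ∈ A i := by
    intro p
    obtain ⟨t, ht⟩ := horb p
    have h1 : ∀ j : ℕ, g^[j] p = ψ (j * t) p := by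
      intro j
      induction j with
      | zero => simpa using (h.map_zero p).symm
      | succ j ih =>
        rw [Function.iterate_succ_apply', ih, hcomm, ht, ← h.map_add]
        congr 1
        push_cast; ring
    obtain ⟨m, hm⟩ := h.free _ _ ((h1 n).symm.trans (hgn p))
    have h2 : (0 : ℤ) ≤ m % n := Int.emod_nonneg _ hnpos.ne'
    have h3 : m % n < n := Int.emod_lt_of_pos _ hnpos
    refine ⟨⟨(m % n).toNat, by omega⟩, ?_⟩
    change g p = ψ (((m % n).toNat : ℕ) * T / n) p
    rw [ht, h.eq_iff]
    refine ⟨m / n, ?_⟩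
    have h4 : (((m % n).toNat : ℕ) : ℝ) = ((m % n : ℤ) : ℝ) := by
      exact_mod_cast Int.toNat_of_nonneg h2
    have h5 : (m : ℝ) = ((m % n : ℤ) : ℝ) + n * ((m / n : ℤ) : ℝ) := by
      exact_mod_cast (Int.emod_add_mul_ediv m n).symm
    rw [h4]
    rw [h5] at hm
    field_simp
    linarith
  have hdisj : ∀ i j p, p ∈ A i → p ∈ A j → i = j := by
    intro i j p hi hj
    obtain ⟨m, hm⟩ := (h.eq_iff _ _ _).1 ((show g p = _ from hi).symm.trans hj)
    have h1 : ((i : ℕ) : ℤ) = (j : ℕ) + m * n := by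
      have : ((i : ℕ) : ℝ) = (j : ℕ) + m * n := by
        field_simp at hm
        linarith
      exact_mod_cast this
    have hi' := i.2
    have hj' := j.2
    have hm0 : m = 0 := by
      by_contra hne
      rcases lt_or_gt_of_ne hne with hneg | hpos
      · nlinarith
      · nlinarith
    rw [hm0] at h1
    exact Fin.ext (by omega)
  obtain ⟨p₀⟩ := (inferInstance : Nonempty P)
  obtain ⟨i, hi⟩ := hcover p₀
  have hopen : IsOpen (A i) := by
    have : (A i)ᶜ = ⋃ j ∈ ({i}ᶜ : Set (Fin n)), A j := by
      ext p
      simp only [Set.mem_compl_iff, Set.mem_iUnion, Set.mem_singleton_iff, exists_prop]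
      constructor
      · intro hp
        obtain ⟨j, hj⟩ := hcover p
        exact ⟨j, fun hji => hp (hji ▸ hj), hj⟩
      · rintro ⟨j, hji, hj⟩ hp
        exact hji (hdisj _ _ _ hj hp)
    rw [← isClosed_compl_iff, this]
    exact Set.Finite.isClosed_biUnion (Set.toFinite _) fun j _ => hA j
  have huniv : A i = Set.univ := IsClopen.eq_univ ⟨hA i, hopen⟩ ⟨p₀, hi⟩
  refine ⟨i * T / n, fun p => ?_⟩
  have : p ∈ A i := huniv ▸ Set.mem_univ p
  exact this

end IsFreePeriodicFlow

section Period

variable {M P W : Type*} [TopologicalSpace P] [T2Space P] [ConnectedSpace P]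
  [TopologicalSpace W] [T2Space W] {T TP TW : ℝ}
  {ψ χ : ℝ → P → P} {ξ : ℝ → M → M} {pr : P → M} {prW : P → W}

/-- In a double fibration by commuting free circle actions `ψ` and `χ`, the effective period of
the action induced by `ψ` on the quotient by `χ` is determined by that of the action induced by
`χ` on the quotient by `ψ`. -/
lemma effective_period (hψ : IsFreePeriodicFlow TP ψ) (hχ : IsFreePeriodicFlow TW χ)
    (hcomm : ∀ s t p, ψ s (χ t p) = χ t (ψ s p))
    (hpr : Function.Surjective pr)
    (hfib : ∀ p q, pr p = pr q ↔ ∃ t, ψ t p = q)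
    (hfibW : ∀ p q, prW p = prW q ↔ ∃ t, χ t p = q)
    (hT : 0 < T) (hξper : ∀ x, ξ T x = x) (hξ : IsEffectiveFlow T ξ)
    (hcov : ∀ t p, pr (χ t p) = ξ t (pr p))
    (hcont : ∀ p, Continuous fun t => prW (ψ t p))
    (hnt : ¬ ∀ s p, prW (ψ s p) = prW p) :
    (∀ p, prW (ψ (T * TP / TW) p) = prW p) ∧
      ∀ s, (∀ p, prW (ψ s p) = prW p) → ∃ n : ℤ, s = n * (T * TP / TW) := by
  obtain ⟨p₀⟩ := (inferInstance : Nonempty P)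
  have hTP := hψ.pos
  have hTW := hχ.pos
  obtain ⟨k, hk⟩ : ∃ k : ℤ, TW = k * T := hξ TW fun x => by
    obtain ⟨p, rfl⟩ := hpr x
    rw [← hcov, hχ.periodic]
  have hkpos : 0 < k := by
    have : (0 : ℝ) < k := by
      by_contra hneg
      nlinarith
    exact_mod_cast this
  lift k to ℕ using hkpos.le
  have hk0 : k ≠ 0 := by rintro rfl; simp at hkpos
  have hkR : (k : ℝ) ≠ 0 := by exact_mod_cast hk0
  push_cast at hk
  -- `χ T` covers the identity of M, so it preserves the orbits of `ψ`, and its k-th iterate is `χ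
  -- TW`, the identity.
  obtain ⟨c, hc⟩ : ∃ c, ∀ p, χ T p = ψ c p := by
    refine hψ.exists_eq_of_iterate_eq (hχ.continuous T) (fun t p => (hcomm t T p).symm) (fun p => ?_)
      hk0 (fun p => ?_)
    · obtain ⟨t, ht⟩ := (hfib p (χ T p)).1 (by rw [hcov, hξper])
      exact ⟨t, ht.symm⟩
    · rw [hχ.iterate, ← hk, hχ.periodic]
  have hcj : ∀ (j : ℕ) p, χ (j * T) p = ψ (j * c) p := fun j p => by
    rw [← hχ.iterate, ← hψ.iterate, show χ T = ψ c from funext hc]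
  have hcz : ∀ (j : ℤ) p, χ (j * T) p = ψ (j * c) p := by
    intro j p
    obtain ⟨n, rfl | rfl⟩ := Int.eq_nat_or_neg j
    · exact_mod_cast hcj n p
    · have h1 := hcj n (ψ (((-(n : ℤ) : ℤ) : ℝ) * c) p)
      rw [← hψ.map_add, show (n : ℝ) * c + ((-(n : ℤ) : ℤ) : ℝ) * c = 0 by push_cast; ring,
        hψ.map_zero] at h1
      have h2 := congrArg (χ (((-(n : ℤ) : ℤ) : ℝ) * T)) h1
      rw [← hχ.map_add, show ((-(n : ℤ) : ℤ) : ℝ) * T + n * T = 0 by push_cast; ring,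
        hχ.map_zero] at h2
      exact h2.symm
  obtain ⟨m, hm⟩ := hψ.free (k * c) p₀ (by rw [← hcj, ← hk, hχ.periodic])
  -- For a common divisor `d` of `m` and `k`, the map `χ (kT/d)` fixes `p₀`. Freeness makes kT/d a
  -- multiple of TW = kT, so `d = 1`.
  have hcop : IsCoprime m (k : ℤ) := by
    rw [Int.isCoprime_iff_gcd_eq_one]
    set d := Int.gcd m k with hd
    obtain ⟨m', hm'⟩ : (d : ℤ) ∣ m := Int.gcd_dvd_left ..
    obtain ⟨k', hk'⟩ : (d : ℤ) ∣ (k : ℤ) := Int.gcd_dvd_right ..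
    have hd0 : (d : ℝ) ≠ 0 := by
      have : d ≠ 0 := by
        intro h0
        rw [h0] at hk'
        simp at hk'
        exact hk0 hk'
      exact_mod_cast this
    have hmR : (m : ℝ) = d * m' := by exact_mod_cast hm'
    have hkR' : (k : ℝ) = d * k' := by exact_mod_cast hk'
    have h1 : (k' : ℝ) * c = m' * TP := by
      rw [hmR, hkR'] at hm
      have : (d : ℝ) * (k' * c) = d * (m' * TP) := by linarith
      exact mul_left_cancel₀ hd0 this
    have h2 : χ (k' * T) p₀ = p₀ := by rw [hcz, h1, hψ.map_int_mul]
    obtain ⟨l, hl⟩ := hχ.free _ _ h2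
    rw [hk] at hl
    have h3 : (k' : ℝ) = l * k := by
      have : (k' : ℝ) * T = (l * k) * T := by linarith
      exact mul_right_cancel₀ hT.ne' this
    have h4 : k' = l * k := by exact_mod_cast h3
    have h5 : (k : ℤ) * (d * l) = k * 1 := by
      rw [mul_one]
      calc (k : ℤ) * (d * l) = d * (l * k) := by ring
        _ = k := by rw [← h4, ← hk']
    have h6 : (d : ℤ) * l = 1 := mul_left_cancel₀ (by exact_mod_cast hk0) h5
    have h7 : IsUnit (d : ℤ) := IsUnit.of_mul_eq_one _ h6
    have := Int.isUnit_iff.1 h7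
    omega
  have hper : T * TP / TW = TP / k := by
    rw [hk]; field_simp
  rw [hper]
  have hcm : c = m * (TP / k) := by field_simp; linarith
  constructor
  · obtain ⟨x, y, hxy⟩ := hcop
    intro p
    have h1 : TP / k = x * c + y * TP := by
      have h2 : (x : ℝ) * m + y * k = 1 := by exact_mod_cast hxy
      rw [hcm]
      field_simp
      linear_combination -h2
    rw [h1, hψ.map_add, hψ.map_int_mul, ← hcz]
    exact ((hfibW p _).2 ⟨_, rfl⟩).symm
  · intro s hs
    -- The times acting trivially on W form a subgroup containing TP. If dense, it would be
    -- everything by continuity, against `hnt`; so it is cyclic, `s` is a rational multiple of TP,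
    -- and `ψ s` has finite order.
    let G : AddSubgroup ℝ :=
      { carrier := {s | ∀ p, prW (ψ s p) = prW p}
        zero_mem' := fun p => by rw [hψ.map_zero]
        add_mem' := fun {s t} hs ht p => by rw [hψ.map_add, hs, ht]
        neg_mem' := fun {s} hs p => by
          rw [← hs, ← hψ.map_add, add_neg_cancel, hψ.map_zero] }
    rcases G.dense_or_cyclic with hG | ⟨g, hg⟩
    · refine absurd (fun s p => ?_) hnt
      have h1 : IsClosed {s | prW (ψ s p) = prW p} := isClosed_eq (hcont p) continuous_const
      have h2 : (G : Set ℝ) ⊆ {s | prW (ψ s p) = prW p} := fun s hs => hs p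
      exact h1.closure_subset_iff.2 h2 (hG s)
    · have hTPG : TP ∈ G := fun p => by rw [hψ.periodic]
      have hsG : s ∈ G := hs
      rw [hg, AddSubgroup.mem_closure_singleton] at hTPG hsG
      obtain ⟨n, hn⟩ := hTPG
      obtain ⟨j, hj⟩ := hsG
      rw [zsmul_eq_mul] at hn hj
      have hn0 : n ≠ 0 := by
        rintro rfl
        simp at hn
        exact hTP.ne hn
      obtain ⟨t, ht⟩ : ∃ t, ∀ p, ψ s p = χ t p := by
        refine hχ.exists_eq_of_iterate_eq (hψ.continuous s) (fun t p => hcomm s t p) (fun p => ?_)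
          (n := n.natAbs) (by simpa using hn0) (fun p => ?_)
        · obtain ⟨t, ht⟩ := (hfibW p (ψ s p)).1 (hs p).symm
          exact ⟨t, ht.symm⟩
        · rw [hψ.iterate]
          have h1 : ∃ l : ℤ, (n.natAbs : ℝ) * s = l * TP := by
            rcases Int.natAbs_eq n with h | h
            · refine ⟨j, ?_⟩
              have : (n : ℝ) = n.natAbs := (congrArg (Int.cast : ℤ → ℝ) h).trans (Int.cast_natCast _)
              rw [← this, ← hj, ← hn]; ring
            · refine ⟨-j, ?_⟩
              have : (n : ℝ) = -n.natAbs :=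
                (congrArg (Int.cast : ℤ → ℝ) h).trans (by rw [Int.cast_neg, Int.cast_natCast])
              have h2 : (n.natAbs : ℝ) = -n := by linarith
              rw [h2, ← hj, ← hn]; push_cast; ring
          obtain ⟨l, hl⟩ := h1
          rw [hl, hψ.map_int_mul]
      -- `χ t = ψ s` covers the identity of M, so effectiveness of `ξ` makes `t` a multiple of T.
      obtain ⟨l, hl⟩ := hξ t fun x => by
        obtain ⟨p, rfl⟩ := hpr x
        rw [← hcov, ← ht]
        exact ((hfib p _).2 ⟨s, rfl⟩).symm
      have h1 : ψ s p₀ = ψ (l * c) p₀ := by rw [ht, hl, hcz]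
      obtain ⟨r, hr⟩ := (hψ.eq_iff _ _ _).1 h1
      refine ⟨l * m + r * k, ?_⟩
      rw [hr, hcm]
      push_cast
      field_simp

end Period

/-! ### The inverse twist. -/

section Maps

variable {W P EP EW : Type*}
  [NormedAddCommGroup EP] [NormedSpace ℝ EP] [FiniteDimensional ℝ EP]
  [TopologicalSpace P] [ChartedSpace EP P] [IsManifold 𝓘(ℝ, EP) ∞ P]
  [NormedAddCommGroup EW] [NormedSpace ℝ EW] [FiniteDimensional ℝ EW]
  [TopologicalSpace W] [ChartedSpace EW W] [IsManifold 𝓘(ℝ, EW) ∞ W]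

lemma dFun_comp_of_contMDiff {f : W → ℝ} (hf : ContMDiff 𝓘(ℝ, EW) 𝓘(ℝ, ℝ) ∞ f) {pr : P → W}
    (hpr : ContMDiff 𝓘(ℝ, EP) 𝓘(ℝ, EW) ∞ pr) (p : P) (u : TangentSpace 𝓘(ℝ, EP) p) :
    dFun (fun p => f (pr p)) p u = dFun f (pr p) (mfderiv 𝓘(ℝ, EP) 𝓘(ℝ, EW) pr p u) := by
  have h := mfderiv_comp p ((hf (pr p)).mdifferentiableAt (by simp))
    ((hpr p).mdifferentiableAt (by simp))
  exact DFunLike.congr_fun h u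

/-- Derivative of a commuting square. -/
lemma mfderiv_square {f : P → W} {ψ : P → P} {φ : W → W} (hf : ContMDiff 𝓘(ℝ, EP) 𝓘(ℝ, EW) ∞ f)
    (hψ : ContMDiff 𝓘(ℝ, EP) 𝓘(ℝ, EP) ∞ ψ) (hφ : ContMDiff 𝓘(ℝ, EW) 𝓘(ℝ, EW) ∞ φ)
    (h : ∀ p, f (ψ p) = φ (f p)) (p : P) (u : TangentSpace 𝓘(ℝ, EP) p) :
    (mfderiv 𝓘(ℝ, EW) 𝓘(ℝ, EW) φ (f p) (mfderiv 𝓘(ℝ, EP) 𝓘(ℝ, EW) f p u) : EW) =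
      mfderiv 𝓘(ℝ, EP) 𝓘(ℝ, EW) f (ψ p) (mfderiv 𝓘(ℝ, EP) 𝓘(ℝ, EP) ψ p u) := by
  have h1 := mfderiv_comp p ((hf (ψ p)).mdifferentiableAt (by simp))
    ((hψ p).mdifferentiableAt (by simp))
  have h2 := mfderiv_comp p ((hφ (f p)).mdifferentiableAt (by simp))
    ((hf p).mdifferentiableAt (by simp))
  have h3 : f ∘ ψ = φ ∘ f := funext h
  rw [h3] at h1
  exact (DFunLike.congr_fun h2 u).symm.trans (DFunLike.congr_fun h1 u)

end Maps

namespace IsTwist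

variable {E M EP P EW W : Type*}
  [NormedAddCommGroup E] [NormedSpace ℝ E] [FiniteDimensional ℝ E]
  [TopologicalSpace M] [T2Space M] [ChartedSpace E M] [IsManifold 𝓘(ℝ, E) ∞ M]
  [NormedAddCommGroup EP] [NormedSpace ℝ EP] [FiniteDimensional ℝ EP]
  [TopologicalSpace P] [T2Space P] [ChartedSpace EP P] [IsManifold 𝓘(ℝ, EP) ∞ P]
  [NormedAddCommGroup EW] [NormedSpace ℝ EW] [FiniteDimensional ℝ EW]
  [TopologicalSpace W] [T2Space W] [ChartedSpace EW W] [IsManifold 𝓘(ℝ, EW) ∞ W]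
  {T TP TW : ℝ} {X : VField E M} {a : M → ℝ} {F : Form E M 2}
  {pr : P → M} {Z : VField EP P} {θ : OneForm EP P} {X' : VField EP P} {prW : P → W}
  {Y : VField EW W}
  (ht : IsTwist (EW := EW) T TP TW X a F pr Z θ X' prW)

include ht

/-- Functions on `M` invariant along `X` descend to the twist. -/
lemma exists_function_descent {f : M → ℝ} (hf : ContMDiff 𝓘(ℝ, E) 𝓘(ℝ, ℝ) ∞ f)
    (hfX : ∀ x, dFun f x (X x) = 0) :
    ∃ f' : W → ℝ, ContMDiff 𝓘(ℝ, EW) 𝓘(ℝ, ℝ) ∞ f' ∧ ∀ p, f' (prW p) = f (pr p) := by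
  obtain ⟨χ, hχ, -, hfib⟩ := ht.quotient.action
  have hsm : ContMDiff 𝓘(ℝ, EP) 𝓘(ℝ, ℝ) ∞ (fun p => f (pr p)) := hf.comp ht.bundle.smooth
  obtain ⟨f', hf'⟩ := ht.quotient.exists_descent (g := fun p => f (pr p)) (by
    intro p q hpq
    obtain ⟨t, rfl⟩ := (hfib p q).1 hpq
    refine (hχ.comp_eq_of_mfderiv_eq_zero hsm (fun p => ?_) t p).symm
    have := ht.dFun_comp hf p (X' p)
    rw [ht.mfderiv_lift, hfX] at this
    exact this)
  refine ⟨f', ht.quotient.contMDiff_of_comp ?_, hf'⟩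
  rwa [show f' ∘ prW = fun p => f (pr p) from funext hf']

lemma exists_curvature_descent : ∃ F' : Form EW W 2,
    (F'.pullback prW : Form EP P 2) = (twistedConnection a pr θ).toForm.d ∧ F'.Smooth := by
  obtain ⟨F', hF'⟩ := ht.quotient.exists_twoForm_descent ht.X'_ne_zero
    (η := (twistedConnection a pr θ).toForm.d)
    (fun φ hφ => PreservesOneForm.d hφ ht.twistedConnection_smooth
      (ht.lift_preserves_twistedConnection hφ))
    ht.d_twistedConnection_lift
  refine ⟨F', hF', ht.quotient.smooth_of_pullback ?_⟩
  rw [hF']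
  exact ht.twistedConnection_smooth.d

/-- On ker θ the term da∧θ of dθ' vanishes and only F/a remains. -/
lemma relTwoForm_of_pullback {F' : Form EW W 2}
    (hF' : (F'.pullback prW : Form EP P 2) = (twistedConnection a pr θ).toForm.d) :
    RelTwoForm θ pr prW (fun x => (1 / a x) • F x) F' := by
  intro p u v hu hv
  rw [← Form.pullback_apply_two, hF', ht.d_twistedConnection, hu, hv, ht.curvature]
  simp

/-- `Z` is the lift to `P` of the vector field on the twist related to `-X / a`. -/
lemma mfderiv_prW_Z (hY : RelVField θ pr prW (fun x => -(1 / a x) • X x) Y) (p : P) :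
    mfderiv 𝓘(ℝ, EP) 𝓘(ℝ, EW) prW p (Z p) = Y (prW p) := by
  obtain ⟨v, h1, h2, h3⟩ := hY p
  -- Since X' = X̃ + aZ, the horizontal lift of -X/a is Z - X'/a, and `prW` annihilates X'.
  have h4 : v = Z p - (a (pr p))⁻¹ • X' p := by
    refine ht.eq_of_horizontal ?_ ?_
    · rw [h1, map_sub, map_smul, ht.connection.generator, ht.theta_lift, smul_eq_mul,
        inv_mul_cancel₀ (ht.a_ne_zero _), sub_self]
    · rw [h2, map_sub, map_smul, ht.mfderiv_Z, ht.mfderiv_lift, zero_sub]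
      change -(1 / a (pr p)) • X (pr p) = _
      rw [one_div, neg_smul]
  rw [h4, map_sub, map_smul, ht.quotient.mfderiv_generator, smul_zero, sub_zero] at h3
  exact h3

/-- Flows of the related vector field on the twist are covered by the principal flow. -/
lemma prW_principal (hY : RelVField θ pr prW (fun x => -(1 / a x) • X x) Y) {T' : ℝ}
    {φ : ℝ → W → W} (hφ : IsCircleFlow T' Y φ) {ψ : ℝ → P → P} (hψ : IsCircleFlow TP Z ψ)
    (t : ℝ) (p : P) : prW (ψ t p) = φ t (prW p) :=
  hφ.map_flow hψ ht.quotient.smooth (ht.mfderiv_prW_Z hY) t p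

/-- The flow of Y is covered by the flow of Z, which preserves θ' and hence dθ', the pull-back of
F'. -/
lemma flow_preserves_twoForm (hY : RelVField θ pr prW (fun x => -(1 / a x) • X x) Y) {T' : ℝ}
    {φ : ℝ → W → W} (hφ : IsCircleFlow T' Y φ) {F' : Form EW W 2}
    (hF' : (F'.pullback prW : Form EP P 2) = (twistedConnection a pr θ).toForm.d) :
    PreservesTwoForm φ F' := by
  obtain ⟨ψ, hψ, -, -⟩ := ht.bundle.action
  intro t w u v
  obtain ⟨p, rfl⟩ := ht.quotient.surjective w
  obtain ⟨u, rfl⟩ := ht.quotient.mfderiv_surjective p u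
  obtain ⟨v, rfl⟩ := ht.quotient.mfderiv_surjective p v
  have hsq := mfderiv_square ht.quotient.smooth (hψ.contMDiff_right t) (hφ.contMDiff_right t)
    (ht.prW_principal hY hφ hψ t) p
  rw [← Form.pullback_apply_two prW F' p u v, hF']
  have h1 := PreservesOneForm.d hψ ht.twistedConnection_smooth
    (ht.principal_preserves_twistedConnection hψ) t p u v
  rw [← h1, ← hF', Form.pullback_apply_two]
  refine (Form.apply_congr F' (ht.prW_principal hY hφ hψ t p).symm _).trans ?_
  refine congrArg (F' (prW (ψ t p))) (funext fun i => ?_)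
  fin_cases i
  · exact hsq u
  · exact hsq v

/-- The double fibration read backwards is a twist of `W`. -/
lemma inverse (hY : RelVField θ pr prW (fun x => -(1 / a x) • X x) Y) {a' : W → ℝ}
    (ha' : ContMDiff 𝓘(ℝ, EW) 𝓘(ℝ, ℝ) ∞ a') (haa' : ∀ p, a' (prW p) = (a (pr p))⁻¹)
    {F' : Form EW W 2} (hFs : F'.Smooth)
    (hF' : (F'.pullback prW : Form EP P 2) = (twistedConnection a pr θ).toForm.d) (T' : ℝ) :
    IsTwist (EW := E) T' TW TP Y a' F' prW X' (twistedConnection a pr θ) Z pr where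
  bundle := ht.quotient
  connection := ht.twistedConnection_isConnection
  F_smooth := hFs
  curvature p u v := by rw [← hF', Form.pullback_apply_two]
  F_invariant φ hφ := ht.flow_preserves_twoForm hY hφ hF'
  a_smooth := ha'
  a_ne_zero w := by
    obtain ⟨p, rfl⟩ := ht.quotient.surjective w
    rw [haa']
    exact inv_ne_zero (ht.a_ne_zero _)
  da w u := by
    obtain ⟨p, rfl⟩ := ht.quotient.surjective w
    obtain ⟨u, rfl⟩ := ht.quotient.mfderiv_surjective p u
    -- On P the claim reads Z⌟dθ' = a⁻² da = -d(1/a), which uses pr_*Z = 0, da(Z) = 0 and θ(Z) = 1.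
    rw [← ht.mfderiv_prW_Z hY p, ← Form.pullback_apply_two prW F' p, hF',
      ht.d_twistedConnection, ht.curvature, ht.mfderiv_Z, ht.dFun_a_pr_Z, ht.connection.generator]
    have h1 := dFun_comp_of_contMDiff ha' ht.quotient.smooth p u
    rw [show (fun p => a' (prW p)) = fun p => (a (pr p))⁻¹ from funext haa', ht.dFun_inv] at h1
    refine h1.symm.trans ?_
    have h2 : F (pr p) ![0, mfderiv 𝓘(ℝ, EP) 𝓘(ℝ, E) pr p u] = 0 := by
      have := twoForm_smul_left (F (pr p)) 0 0 (mfderiv 𝓘(ℝ, EP) 𝓘(ℝ, E) pr p u)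
      rwa [zero_smul, zero_mul] at this
    rw [h2]
    ring
  lift p := by
    constructor
    · rw [map_sub, map_smul, ht.twistedConnection_lift, haa']
      change (a (pr p))⁻¹ * θ p (Z p) - (a (pr p))⁻¹ * 1 = 0
      rw [ht.connection.generator, sub_self]
    · rw [map_sub, map_smul, ht.quotient.mfderiv_generator, smul_zero, sub_zero,
        ht.mfderiv_prW_Z hY]
  quotient := ht.bundle

end IsTwist

/-! ### Fixed points, connectedness and the induced action on the twist. -/

section ZeroSet

variable {E M : Type*} [NormedAddCommGroup E] [NormedSpace ℝ E] [FiniteDimensional ℝ E]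
  [TopologicalSpace M] [T2Space M] [ChartedSpace E M] [IsManifold 𝓘(ℝ, E) ∞ M]
  {T : ℝ} {X : VField E M} {φ : ℝ → M → M}

/-- The zeros of the generator are the fixed points of the flow. -/
lemma IsCircleFlow.generator_eq_zero_iff (h : IsCircleFlow T X φ) (x : M) :
    X x = 0 ↔ ∀ t, φ t x = x := by
  have h0 : (1 : ℝ →L[ℝ] ℝ).smulRight (0 : E) = 0 := by
    ext
    simp
  constructor
  · intro hx t
    refine (h.eq_of_isMIntegralCurve (γ := fun _ => x) (fun t => ?_) t).symm
    rw [hx]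
    exact h0 ▸ hasMFDerivAt_const x t
  · intro hx
    have h1 := h.mfderiv_time 0 x 1
    have hc : (fun t => φ t x) = fun _ => x := funext hx
    have h2 : (mfderiv 𝓘(ℝ, ℝ) 𝓘(ℝ, E) (fun t => φ t x) 0 : ℝ →L[ℝ] E) = 0 := by
      rw [hc]
      exact mfderiv_const
    have h3 : (X (φ 0 x) : E) = 0 :=
      (one_smul ℝ (X (φ 0 x) : E)).symm.trans (h1.symm.trans (DFunLike.congr_fun h2 (1 : ℝ)))
    have key : ∀ y, y = x → X y = 0 → X x = 0 := by
      rintro _ rfl h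
      exact h
    exact key _ (hx 0) h3

/-- The zero set is an intersection of fixed-point sets of maps of a Hausdorff space, hence closed.
-/
lemma IsCircleFlow.isOpen_generator_ne_zero (h : IsCircleFlow T X φ) :
    IsOpen {x | X x ≠ 0} := by
  have h1 : {x | X x ≠ 0} = (⋂ t, {x | φ t x = x})ᶜ := by
    ext x
    simp [h.generator_eq_zero_iff]
  rw [h1]
  exact (isClosed_iInter fun t =>
    isClosed_eq (h.contMDiff_right t).continuous continuous_id).isOpen_compl

end ZeroSet

namespace IsPrincipalCircleBundle

variable {W P EP EW : Type*}
  [NormedAddCommGroup EP] [NormedSpace ℝ EP] [FiniteDimensional ℝ EP]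
  [TopologicalSpace P] [ChartedSpace EP P] [IsManifold 𝓘(ℝ, EP) ∞ P]
  [NormedAddCommGroup EW] [NormedSpace ℝ EW] [FiniteDimensional ℝ EW]
  [TopologicalSpace W] [ChartedSpace EW W] [IsManifold 𝓘(ℝ, EW) ∞ W]
  {T : ℝ} {pr : P → W} {V : VField EP P}

lemma isOpenMap (hb : IsPrincipalCircleBundle (E := EW) T pr V) : IsOpenMap pr := by
  refine isOpenMap_iff_nhds_le.2 fun p U hU => ?_
  obtain ⟨s, h1, h2, h3⟩ := exists_local_section hb.submersion p
  have h4 : s ⁻¹' (pr ⁻¹' U) ∈ 𝓝 (pr p) := h1.continuousAt (by rw [h2]; exact hU)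
  filter_upwards [h3, h4] with x hx hx'
  rw [← hx]
  exact hx'

/-- `pr` is an open quotient map whose fibres are orbits, thus connected, so connectedness lifts
from the base. -/
lemma connectedSpace [ConnectedSpace W] (hb : IsPrincipalCircleBundle (E := EW) T pr V) :
    ConnectedSpace P := by
  obtain ⟨ψ, hψ, -, hfib⟩ := hb.action
  have hq : Topology.IsQuotientMap pr :=
    hb.isOpenMap.isQuotientMap hb.smooth.continuous hb.surjective
  have hconn : ∀ w, IsConnected (pr ⁻¹' {w}) := by
    intro w
    obtain ⟨p, rfl⟩ := hb.surjective w
    have h1 : pr ⁻¹' {pr p} = Set.range fun t => ψ t p := by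
      ext q
      exact eq_comm.trans (hfib p q)
    rw [h1]
    exact isConnected_range (hψ.contMDiff_left p).continuous
  have h2 := hq.isCoinducing.isConnected_preimage_of_isClosed hconn isClosed_univ
    isConnected_univ
  rw [Set.preimage_univ] at h2
  exact connectedSpace_iff_univ.2 h2

end IsPrincipalCircleBundle

lemma IsCircleFlow.isFreePeriodicFlow {E M : Type*} [NormedAddCommGroup E] [NormedSpace ℝ E]
    [FiniteDimensional ℝ E] [TopologicalSpace M] [ChartedSpace E M] [IsManifold 𝓘(ℝ, E) ∞ M]
    {T : ℝ} {X : VField E M} {φ : ℝ → M → M} (h : IsCircleFlow T X φ) (hf : IsFreeFlow T φ) :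
    IsFreePeriodicFlow T φ :=
  ⟨h.period_pos, fun t => (h.contMDiff_right t).continuous, h.map_zero, h.map_add, h.periodic, hf⟩

namespace IsTwist

variable {E M EP P EW W : Type*}
  [NormedAddCommGroup E] [NormedSpace ℝ E] [FiniteDimensional ℝ E]
  [TopologicalSpace M] [T2Space M] [ChartedSpace E M] [IsManifold 𝓘(ℝ, E) ∞ M]
  [NormedAddCommGroup EP] [NormedSpace ℝ EP] [FiniteDimensional ℝ EP]
  [TopologicalSpace P] [T2Space P] [ChartedSpace EP P] [IsManifold 𝓘(ℝ, EP) ∞ P]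
  [NormedAddCommGroup EW] [NormedSpace ℝ EW] [FiniteDimensional ℝ EW]
  [TopologicalSpace W] [T2Space W] [ChartedSpace EW W] [IsManifold 𝓘(ℝ, EW) ∞ W]
  {T TP TW : ℝ} {X : VField E M} {a : M → ℝ} {F : Form E M 2}
  {pr : P → M} {Z : VField EP P} {θ : OneForm EP P} {X' : VField EP P} {prW : P → W}
  {Y : VField EW W}
  (ht : IsTwist (EW := EW) T TP TW X a F pr Z θ X' prW)

include ht

/-- A trivial induced action makes Z vertical for `prW`, that is, a nonzero multiple of X';
projecting to M gives X = 0. This excludes a dense group of trivial times in the period computation.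
-/
lemma vanishes_of_prW_principal {ψ : ℝ → P → P} (hψ : IsCircleFlow TP Z ψ)
    (h : ∀ s p, prW (ψ s p) = prW p) (x : M) : X x = 0 := by
  obtain ⟨p, rfl⟩ := ht.bundle.surjective x
  have h1 := hψ.generator p 0
  have h2 := hasMFDerivAt_comp_integralCurve (f := prW) (γ := fun t => ψ t p) (t := 0)
    ((ht.quotient.smooth _).mdifferentiableAt (by simp)) h1
  have h3 : prW ∘ (fun t => ψ t p) = fun _ => prW p := funext fun t => h t p
  rw [h3] at h2
  have h4 := DFunLike.congr_fun (hasMFDerivAt_unique h2 (hasMFDerivAt_const (prW p) 0)) (1 : ℝ)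
  have h5 : ∀ q, q = p → mfderiv 𝓘(ℝ, EP) 𝓘(ℝ, EW) prW q (Z q) = 0 → X (pr p) = 0 := by
    rintro q rfl hq
    obtain ⟨c, hc⟩ := ht.quotient.eq_smul_of_mfderiv_eq_zero q (ht.X'_ne_zero q) _ hq
    have hc0 : c ≠ 0 := by
      rintro rfl
      exact ht.Z_ne_zero q (hc.trans (zero_smul ℝ _))
    have h6 := ht.mfderiv_Z q
    rw [hc, map_smul, ht.mfderiv_lift] at h6
    exact (smul_eq_zero.1 h6).resolve_left hc0
  exact h5 _ (hψ.map_zero p) ((one_smul ℝ (mfderiv 𝓘(ℝ, EP) 𝓘(ℝ, EW) prW (ψ 0 p) (Z (ψ 0 p)) : EW)).symm.trans h4)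

/-- The principal flow on `P` induces an effective circle action on the twist. -/
lemma exists_induced_flow [ConnectedSpace M]
    (hY : RelVField θ pr prW (fun x => -(1 / a x) • X x) Y)
    {ξ : ℝ → M → M} (hξ : IsCircleFlow T X ξ) (heff : IsEffectiveFlow T ξ) :
    ∃ φ : ℝ → W → W, IsCircleFlow (T * TP / TW) Y φ ∧ IsEffectiveFlow (T * TP / TW) φ := by
  have : ConnectedSpace P := ht.bundle.connectedSpace
  obtain ⟨ψ, hψ, hψfree, hψfib⟩ := ht.bundle.action
  obtain ⟨χ, hχ, hχfree, hχfib⟩ := ht.quotient.action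
  have hnt : ¬ ∀ s p, prW (ψ s p) = prW p := by
    intro h
    have hX := ht.vanishes_of_prW_principal hψ h
    -- If X vanished identically, half the period would act trivially, against effectiveness.
    obtain ⟨n, hn⟩ := heff (T / 2) fun x => (hξ.generator_eq_zero_iff x).1 (hX x) _
    have hT := hξ.period_pos.ne'
    have h2 : (2 * n : ℝ) = 1 := by
      field_simp at hn
      linarith
    have h3 : 2 * n = 1 := by exact_mod_cast h2
    omega
  have hcont : ∀ p, Continuous fun t => prW (ψ t p) := fun p =>
    ht.quotient.smooth.continuous.comp (hψ.contMDiff_left p).continuous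
  obtain ⟨hper, hmin⟩ := effective_period (hψ.isFreePeriodicFlow hψfree)
    (hχ.isFreePeriodicFlow hχfree) (ht.commute hψ hχ) ht.bundle.surjective hψfib hχfib
    hξ.period_pos hξ.periodic heff (ht.pr_lift hχ hξ) hcont hnt
  have hdesc : ∀ t, ∃ g : W → W, ∀ p, g (prW p) = prW (ψ t p) := fun t =>
    ht.quotient.exists_descent (g := fun p => prW (ψ t p)) fun p q hpq => by
      obtain ⟨s, rfl⟩ := (hχfib p q).1 hpq
      rw [ht.commute hψ hχ, ht.prW_lift hχ]
  choose φ hφ using hdesc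
  refine ⟨φ, ⟨?_, ?_, ?_, ?_, ?_, ?_⟩, ?_⟩
  · exact div_pos (mul_pos hξ.period_pos hψ.period_pos) hχ.period_pos
  · refine ht.quotient.contMDiff_uncurry_of_comp ?_
    have h1 : (fun q : ℝ × P => φ q.1 (prW q.2)) = fun q => prW (ψ q.1 q.2) :=
      funext fun q => hφ q.1 q.2
    rw [h1]
    exact ht.quotient.smooth.comp hψ.smooth
  · intro w
    obtain ⟨p, rfl⟩ := ht.quotient.surjective w
    rw [hφ, hψ.map_zero]
  · intro s t w
    obtain ⟨p, rfl⟩ := ht.quotient.surjective w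
    rw [hφ, hφ, hφ, hψ.map_add]
  · intro w
    obtain ⟨p, rfl⟩ := ht.quotient.surjective w
    rw [hφ, hper]
  · intro w
    obtain ⟨p, rfl⟩ := ht.quotient.surjective w
    rw [show (fun t => φ t (prW p)) = fun t => prW (ψ t p) from funext fun t => hφ t p]
    intro t
    have h2 := hasMFDerivAt_comp_integralCurve
      ((ht.quotient.smooth (ψ t p)).mdifferentiableAt (by simp)) (hψ.generator p t)
    rw [ht.mfderiv_prW_Z hY] at h2
    exact h2
  · intro t h
    exact hmin t fun p => by rw [← hφ, h]

/-- Flows of the vector field on the twist preserve bilinear forms related to forms on `M`. -/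
lemma preservesBilin (hY : RelVField θ pr prW (fun x => -(1 / a x) • X x) Y) {T' : ℝ}
    {φ : ℝ → W → W} (hφ : IsCircleFlow T' Y φ) {b : Bilin E M} {b' : Bilin EW W}
    (hb : RelBilin θ pr prW b b') : PreservesBilin φ b' := by
  obtain ⟨ψ, hψ, -, -⟩ := ht.bundle.action
  intro t w u v
  obtain ⟨p, rfl⟩ := ht.quotient.surjective w
  obtain ⟨u, hu, rfl⟩ := ht.exists_horizontal_quotient p u
  obtain ⟨v, hv, rfl⟩ := ht.exists_horizontal_quotient p v
  -- `ψ t` covers `φ t` on W and the identity on M and preserves ker θ, so comparing the relation at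
  -- `p` and at `ψ t p` gives invariance.
  have hsq := mfderiv_square ht.quotient.smooth (hψ.contMDiff_right t) (hφ.contMDiff_right t)
    (ht.prW_principal hY hφ hψ t) p
  have hsq' := mfderiv_square ht.bundle.smooth (hψ.contMDiff_right t) contMDiff_id
    (ht.pr_principal hψ t) p
  have hθ := ht.connection.invariant ψ hψ t p
  have h1 := hb (ψ t p) (mfderiv 𝓘(ℝ, EP) 𝓘(ℝ, EP) (ψ t) p u)
    (mfderiv 𝓘(ℝ, EP) 𝓘(ℝ, EP) (ψ t) p v) (by rw [hθ, hu]) (by rw [hθ, hv])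
  have key : ∀ (w : W) (x : M) (u₁ v₁ u₂ v₂ : EW) (u₃ v₃ u₄ v₄ : E), prW (ψ t p) = w →
      pr (ψ t p) = x → u₁ = u₂ → v₁ = v₂ → u₃ = u₄ → v₃ = v₄ →
      b' (prW (ψ t p)) u₁ v₁ = b (pr (ψ t p)) u₃ v₃ → b' w u₂ v₂ = b x u₄ v₄ := by
    rintro _ _ _ _ _ _ _ _ _ _ rfl rfl rfl rfl rfl rfl h
    exact h
  have hid : ∀ u, (mfderiv 𝓘(ℝ, E) 𝓘(ℝ, E) (id : M → M) (pr p) u : E) = u := fun u => by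
    rw [mfderiv_id]; rfl
  rw [hb p u v hu hv]
  exact key _ _ _ _ _ _ _ _ _ _ (ht.prW_principal hY hφ hψ t p) (ht.pr_principal hψ t p)
    (hsq u).symm (hsq v).symm ((hsq' u).symm.trans (hid _)) ((hsq' v).symm.trans (hid _)) h1

/-- Flows of the vector field on the twist preserve endomorphism fields related to ones on `M`. -/
lemma preservesEndo (hY : RelVField θ pr prW (fun x => -(1 / a x) • X x) Y) {T' : ℝ}
    {φ : ℝ → W → W} (hφ : IsCircleFlow T' Y φ) {A : Endo E M} {A' : Endo EW W}
    (hA : RelEndo θ pr prW A A') : PreservesEndo φ A' := by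
  obtain ⟨ψ, hψ, -, -⟩ := ht.bundle.action
  intro t w u
  obtain ⟨p, rfl⟩ := ht.quotient.surjective w
  obtain ⟨u, hu, rfl⟩ := ht.exists_horizontal_quotient p u
  have hsq := mfderiv_square ht.quotient.smooth (hψ.contMDiff_right t) (hφ.contMDiff_right t)
    (ht.prW_principal hY hφ hψ t) p
  have hsq' : ∀ u : TangentSpace 𝓘(ℝ, EP) p,
      (mfderiv 𝓘(ℝ, EP) 𝓘(ℝ, E) pr (ψ t p) (mfderiv 𝓘(ℝ, EP) 𝓘(ℝ, EP) (ψ t) p u) : E) =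
        mfderiv 𝓘(ℝ, EP) 𝓘(ℝ, E) pr p u := fun u => by
    have h := mfderiv_square ht.bundle.smooth (hψ.contMDiff_right t) contMDiff_id
      (ht.pr_principal hψ t) p u
    rw [mfderiv_id] at h
    exact h.symm
  have hθ := ht.connection.invariant ψ hψ t p
  obtain ⟨v, hv, hv1, hv2⟩ := hA p u hu
  obtain ⟨v', hv', hv1', hv2'⟩ := hA (ψ t p) (mfderiv 𝓘(ℝ, EP) 𝓘(ℝ, EP) (ψ t) p u)
    (by rw [hθ, hu])
  -- Horizontal vectors are determined by their projection to M, so the lift at `ψ t p` is the image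
  -- of the lift at `p`.
  have h1 : v' = mfderiv 𝓘(ℝ, EP) 𝓘(ℝ, EP) (ψ t) p v := by
    refine ht.eq_of_horizontal (by rw [hθ, hv, hv']) (hv1'.trans ?_)
    have key : ∀ (x y : M) (u₁ u₂ : E), x = y → u₁ = u₂ → (A x u₁ : E) = A y u₂ := by
      rintro _ _ _ _ rfl rfl; rfl
    exact (key _ _ _ _ (ht.pr_principal hψ t p) (hsq' u)).trans (hv1.symm.trans (hsq' v).symm)
  have key : ∀ (x y : W) (u₁ u₂ : EW), x = y → u₁ = u₂ → (A' x u₁ : EW) = A' y u₂ := by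
    rintro _ _ _ _ rfl rfl; rfl
  rw [← hv2]
  refine (hsq v).trans ?_
  rw [← h1]
  exact hv2'.trans (key _ _ _ _ (ht.prW_principal hY hφ hψ t p) (hsq u).symm)

lemma isTriholomorphicCircleAction {S : HyperKahler E M} {b : Bilin E M} {S' : HyperKahler EW W}
    (hc : ConnectedSpace M) (hS : IsTriholomorphicCircleAction T S X)
    (hY : RelVField θ pr prW (fun x => -(1 / a x) • X x) Y)
    (hg : RelBilin θ pr prW b S'.g) (hI : RelEndo θ pr prW S.I S'.I)
    (hJ : RelEndo θ pr prW S.J S'.J) (hK : RelEndo θ pr prW S.K S'.K) :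
    IsTriholomorphicCircleAction (T * TP / TW) S' Y := by
  obtain ⟨ξ, hξ, heff, -⟩ := hS
  obtain ⟨φ, hφ, heff'⟩ := ht.exists_induced_flow hY hξ heff
  exact ⟨φ, hφ, heff', ht.preservesBilin hY hφ hg, ht.preservesEndo hY hφ hI,
    ht.preservesEndo hY hφ hJ, ht.preservesEndo hY hφ hK⟩

end IsTwist

/-! ### Quaternionic algebra and the deformed metric. -/

namespace HyperKahler

variable {E M : Type*} [NormedAddCommGroup E] [NormedSpace ℝ E]
  [TopologicalSpace M] [ChartedSpace E M] [IsManifold 𝓘(ℝ, E) ∞ M]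
  (S : HyperKahler E M) (x : M) (u v : TangentSpace 𝓘(ℝ, E) x)

lemma K_eq : S.K x u = S.I x (S.J x u) := (S.I_J x u).symm

lemma I_K : S.I x (S.K x u) = -S.J x u := by rw [K_eq, I_sq]

lemma J_K : S.J x (S.K x u) = S.I x u := by
  rw [K_eq, J_I, K_eq, J_sq, map_neg, neg_neg]

lemma K_sq : S.K x (S.K x u) = -u := by
  rw [S.K_eq x (S.K x u), J_K, I_sq]

lemma g_I_I : S.g x (S.I x u) (S.I x v) = S.g x u v := S.hermitian S.I (Or.inl rfl) x u v

lemma g_J_J : S.g x (S.J x u) (S.J x v) = S.g x u v :=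
  S.hermitian S.J (Or.inr (Or.inl rfl)) x u v

lemma g_K_K : S.g x (S.K x u) (S.K x v) = S.g x u v :=
  S.hermitian S.K (Or.inr (Or.inr rfl)) x u v

lemma g_I_self : S.g x (S.I x u) u = 0 := by
  have h := S.g_I_I x u (S.I x u)
  rw [I_sq, map_neg, S.g_symm x u] at h
  linarith

lemma g_J_self : S.g x (S.J x u) u = 0 := by
  have h := S.g_J_J x u (S.J x u)
  rw [J_sq, map_neg, S.g_symm x u] at h
  linarith

lemma g_K_self : S.g x (S.K x u) u = 0 := by
  have h := S.g_K_K x u (S.K x u)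
  rw [K_sq, map_neg, S.g_symm x u] at h
  linarith

lemma g_I_J : S.g x (S.I x u) (S.J x u) = 0 := by
  rw [← g_I_I, I_sq, I_J, map_neg, neg_apply, g_symm, g_K_self, neg_zero]

lemma g_I_K : S.g x (S.I x u) (S.K x u) = 0 := by
  rw [← g_I_I, I_sq, I_K, map_neg, map_neg, neg_apply, g_symm, g_J_self,
    neg_zero, neg_zero]

lemma g_J_K : S.g x (S.J x u) (S.K x u) = 0 := by
  rw [← g_J_J, J_sq, J_K, map_neg, neg_apply, g_symm, g_I_self, neg_zero]

variable (X : VField E M) (h : M → ℝ)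

lemma elemDeform_apply : S.elemDeform X h x u v = S.g x u v +
    h x * (S.alpha0 X x u * S.alpha0 X x v + S.alphaI X x u * S.alphaI X x v +
      S.alphaJ X x u * S.alphaJ X x v + S.alphaK X x u * S.alphaK X x v) := rfl

/-- X, IX, JX, KX are mutually orthogonal with the same square norm, so on each of them only one of
the four squares contributes, and the factor is the same. -/
lemma elemDeform_X : S.elemDeform X h x (X x) v =
    (1 + h x * S.normSq X x) * S.g x (X x) v := by
  rw [elemDeform_apply]
  simp only [alpha0, alphaI, alphaJ, alphaK, g_I_self, g_J_self, g_K_self, normSq]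
  ring

lemma elemDeform_I : S.elemDeform X h x (S.I x (X x)) v =
    (1 + h x * S.normSq X x) * S.g x (S.I x (X x)) v := by
  rw [elemDeform_apply]
  simp only [alpha0, alphaI, alphaJ, alphaK, normSq, S.g_symm x (X x) (S.I x (X x)), g_I_self,
    g_I_I, S.g_symm x (S.J x (X x)) (S.I x (X x)), g_I_J,
    S.g_symm x (S.K x (X x)) (S.I x (X x)), g_I_K]
  ring

lemma elemDeform_J : S.elemDeform X h x (S.J x (X x)) v =
    (1 + h x * S.normSq X x) * S.g x (S.J x (X x)) v := by
  rw [elemDeform_apply]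
  simp only [alpha0, alphaI, alphaJ, alphaK, normSq, S.g_symm x (X x) (S.J x (X x)), g_J_self,
    g_J_J, g_I_J, S.g_symm x (S.K x (X x)) (S.J x (X x)), g_J_K]
  ring

lemma elemDeform_K : S.elemDeform X h x (S.K x (X x)) v =
    (1 + h x * S.normSq X x) * S.g x (S.K x (X x)) v := by
  rw [elemDeform_apply]
  simp only [alpha0, alphaI, alphaJ, alphaK, normSq, S.g_symm x (X x) (S.K x (X x)), g_K_self,
    g_K_K, g_I_K, g_J_K]
  ring

end HyperKahler

lemma dFun_const_mul {E M : Type*} [NormedAddCommGroup E] [NormedSpace ℝ E]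
    [TopologicalSpace M] [ChartedSpace E M] {f : M → ℝ} {x : M}
    (hf : MDifferentiableAt 𝓘(ℝ, E) 𝓘(ℝ, ℝ) f x) (c : ℝ) (u : TangentSpace 𝓘(ℝ, E) x) :
    dFun (fun y => c * f y) x u = c * dFun f x u :=
  DFunLike.congr_fun (hf.hasMFDerivAt.const_smul c).mfderiv u

/-! ### The hyperkähler conditions for the inverse twist. -/

namespace TwistsVia

variable {E M EP P EW W : Type*}
  [NormedAddCommGroup E] [NormedSpace ℝ E] [FiniteDimensional ℝ E]
  [TopologicalSpace M] [T2Space M] [ChartedSpace E M] [IsManifold 𝓘(ℝ, E) ∞ M]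
  [NormedAddCommGroup EP] [NormedSpace ℝ EP] [FiniteDimensional ℝ EP]
  [TopologicalSpace P] [T2Space P] [ChartedSpace EP P] [IsManifold 𝓘(ℝ, EP) ∞ P]
  [NormedAddCommGroup EW] [NormedSpace ℝ EW] [FiniteDimensional ℝ EW]
  [TopologicalSpace W] [T2Space W] [ChartedSpace EW W] [IsManifold 𝓘(ℝ, EW) ∞ W]
  {T TP TW : ℝ} {S : HyperKahler E M} {X : VField E M} {h : M → ℝ} {lam : ℝ} {a : M → ℝ}
  {F : Form E M 2} {pr : P → M} {Z : VField EP P} {θ : OneForm EP P} {X' : VField EP P}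
  {prW : P → W} {S' : HyperKahler EW W} {Y : VField EW W}
  (hM : TwistsVia T TP TW S X h lam a F pr Z θ X' prW S' Y)

include hM

/-- Each of α_I, α_J, α_K vanishes on X. This is what lets `h` descend to W. -/
lemma dFun_h_generator (x : M) : dFun h x (X x) = 0 := by
  by_cases hX : X x = 0
  · rw [hX, map_zero]
  · obtain ⟨σ, hσ⟩ := hM.F_eq
    obtain ⟨⟨b₁, b₂, b₃, h1, -⟩, -⟩ := hσ x hX
    refine (h1 (X x)).trans (?_ : (_ : ℝ) = (0 : ℝ))
    simp only [HyperKahler.alphaI, HyperKahler.alphaJ, HyperKahler.alphaK, S.g_I_self,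
      S.g_J_self, S.g_K_self]
    ring

/-- The factor 1 + h‖X‖² = a/λ cancels the 1/a in the lift and leaves the constant -1/λ. `hζ0`
covers the zeros of X, where no formula for `a` is assumed. It is applied with ζ equal to X, IX, JX
and KX. -/
lemma pairing_related {p : P} {v : TangentSpace 𝓘(ℝ, EP) p} (hv : θ p v = 0)
    {ζ : TangentSpace 𝓘(ℝ, E) (pr p)} (hζ0 : X (pr p) = 0 → ζ = 0)
    (hζ : ∀ w, S.elemDeform X h (pr p) ζ w = (1 + h (pr p) * S.normSq X (pr p)) * S.g (pr p) ζ w)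
    (hvζ : mfderiv 𝓘(ℝ, EP) 𝓘(ℝ, E) pr p v = -(1 / a (pr p)) • ζ)
    (u : TangentSpace 𝓘(ℝ, EP) p) (hu : θ p u = 0) :
    S'.g (prW p) (mfderiv 𝓘(ℝ, EP) 𝓘(ℝ, EW) prW p v) (mfderiv 𝓘(ℝ, EP) 𝓘(ℝ, EW) prW p u) =
      -(1 / lam) * S.g (pr p) ζ (mfderiv 𝓘(ℝ, EP) 𝓘(ℝ, E) pr p u) := by
  rw [hM.rel_g p v u hv hu, hvζ, map_smul]
  change -(1 / a (pr p)) * S.elemDeform X h (pr p) ζ _ = _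
  rw [hζ]
  by_cases hX : X (pr p) = 0
  · rw [hζ0 hX, map_zero]
    simp
  · have h1 := hM.a_eq _ hX
    have h2 := hM.twist.a_ne_zero (pr p)
    have h3 := hM.lam_ne_zero
    have h4 : 1 + h (pr p) * S.normSq X (pr p) = a (pr p) / lam := by
      rw [h1]; field_simp
    rw [h4]
    field_simp

lemma alpha0_related {p : P} (u : TangentSpace 𝓘(ℝ, EP) p) (hu : θ p u = 0) :
    S'.alpha0 Y (prW p) (mfderiv 𝓘(ℝ, EP) 𝓘(ℝ, EW) prW p u) =
      -(1 / lam) * S.alpha0 X (pr p) (mfderiv 𝓘(ℝ, EP) 𝓘(ℝ, E) pr p u) := by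
  obtain ⟨v, hv, hv1, hv2⟩ := hM.rel_X p
  rw [HyperKahler.alpha0, ← hv2]
  exact hM.pairing_related hv id (fun w => S.elemDeform_X _ _ _ _) hv1 u hu

lemma alpha_related {A : Endo E M} {A' : Endo EW W} (hA : RelEndo θ pr prW A A')
    (hd : ∀ x v, S.elemDeform X h x (A x (X x)) v =
      (1 + h x * S.normSq X x) * S.g x (A x (X x)) v)
    {p : P} (u : TangentSpace 𝓘(ℝ, EP) p) (hu : θ p u = 0) :
    S'.g (prW p) (A' (prW p) (Y (prW p))) (mfderiv 𝓘(ℝ, EP) 𝓘(ℝ, EW) prW p u) =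
      -(1 / lam) * S.g (pr p) (A (pr p) (X (pr p))) (mfderiv 𝓘(ℝ, EP) 𝓘(ℝ, E) pr p u) := by
  obtain ⟨v, hv, hv1, hv2⟩ := hM.rel_X p
  obtain ⟨w, hw, hw1, hw2⟩ := hA p v hv
  rw [hv1, map_smul] at hw1
  rw [← hv2, ← hw2]
  exact hM.pairing_related hw (fun h0 => by rw [h0, map_zero]) (hd _) hw1 u hu

lemma alphaI_related {p : P} (u : TangentSpace 𝓘(ℝ, EP) p) (hu : θ p u = 0) :
    S'.alphaI Y (prW p) (mfderiv 𝓘(ℝ, EP) 𝓘(ℝ, EW) prW p u) =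
      -(1 / lam) * S.alphaI X (pr p) (mfderiv 𝓘(ℝ, EP) 𝓘(ℝ, E) pr p u) :=
  hM.alpha_related hM.rel_I (fun x v => S.elemDeform_I x v X h) u hu

lemma alphaJ_related {p : P} (u : TangentSpace 𝓘(ℝ, EP) p) (hu : θ p u = 0) :
    S'.alphaJ Y (prW p) (mfderiv 𝓘(ℝ, EP) 𝓘(ℝ, EW) prW p u) =
      -(1 / lam) * S.alphaJ X (pr p) (mfderiv 𝓘(ℝ, EP) 𝓘(ℝ, E) pr p u) :=
  hM.alpha_related hM.rel_J (fun x v => S.elemDeform_J x v X h) u hu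

lemma alphaK_related {p : P} (u : TangentSpace 𝓘(ℝ, EP) p) (hu : θ p u = 0) :
    S'.alphaK Y (prW p) (mfderiv 𝓘(ℝ, EP) 𝓘(ℝ, EW) prW p u) =
      -(1 / lam) * S.alphaK X (pr p) (mfderiv 𝓘(ℝ, EP) 𝓘(ℝ, E) pr p u) :=
  hM.alpha_related hM.rel_K (fun x v => S.elemDeform_K x v X h) u hu

/-- Used contrapositively: conditions to be checked where Y ≠ 0 lie over points where X ≠ 0. -/
lemma generator_eq_zero {p : P} (h0 : X (pr p) = 0) : Y (prW p) = 0 := by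
  obtain ⟨v, hv, hv1, hv2⟩ := hM.rel_X p
  have hv1 : mfderiv 𝓘(ℝ, EP) 𝓘(ℝ, E) pr p v = -(1 / a (pr p)) • X (pr p) := hv1
  rw [h0, smul_zero] at hv1
  rw [← hv2, hM.twist.eq_zero_of_horizontal hv hv1, map_zero]

/-- The relation between the forms α₀ is evaluated on the lift of -X/a itself. -/
lemma normSq_related (p : P) :
    S'.normSq Y (prW p) = S.normSq X (pr p) / (lam * a (pr p)) := by
  obtain ⟨v, hv, hv1, hv2⟩ := hM.rel_X p
  have h1 := hM.alpha0_related v hv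
  rw [hv1, hv2, map_smul] at h1
  refine h1.trans ?_
  change -(1 / lam) * (-(1 / a (pr p)) * S.normSq X (pr p)) = _
  have h2 := hM.twist.a_ne_zero (pr p)
  have h3 := hM.lam_ne_zero
  field_simp

/-- Each square of a form of Y carries λ⁻², which the factor -λ² of h' turns into exactly the
negative of the original deformation. -/
lemma elemDeform_inverse {h' : W → ℝ} (hh' : ∀ p, h' (prW p) = -lam ^ 2 * h (pr p)) :
    RelBilin θ prW pr (S'.elemDeform Y h') S.g := by
  intro p u v hu hv
  have h1 := hM.rel_g p u v hu hv
  rw [S.elemDeform_apply] at h1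
  rw [S'.elemDeform_apply, h1, hh', hM.alpha0_related u hu, hM.alpha0_related v hv,
    hM.alphaI_related u hu, hM.alphaI_related v hv, hM.alphaJ_related u hu,
    hM.alphaJ_related v hv, hM.alphaK_related u hu, hM.alphaK_related v hv]
  have h3 := hM.lam_ne_zero
  field_simp
  ring

/-- Here 1 + h'‖Y‖² = 1 - λh‖X‖²/a = λ/a. -/
lemma a_inverse {h' a' : W → ℝ} (hh' : ∀ p, h' (prW p) = -lam ^ 2 * h (pr p))
    (ha' : ∀ p, a' (prW p) = (a (pr p))⁻¹) (w : W) (hw : Y w ≠ 0) :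
    a' w = 1 / lam * (1 + h' w * S'.normSq Y w) := by
  obtain ⟨p, rfl⟩ := hM.twist.quotient.surjective w
  have h1 := hM.a_eq (pr p) fun h0 => hw (hM.generator_eq_zero h0)
  have h2 := hM.twist.a_ne_zero (pr p)
  have h3 := hM.lam_ne_zero
  rw [ha', hh', hM.normSq_related]
  field_simp
  rw [h1]
  ring

/-- Where `X ≠ 0`, the pull-back of `h' α₀'` is `λ h α₀ - θ + λ θ'`. -/
lemma pullback_alpha0 {h' : W → ℝ} (hh' : ∀ p, h' (prW p) = -lam ^ 2 * h (pr p)) {p : P}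
    (hX : X (pr p) ≠ 0) (u : TangentSpace 𝓘(ℝ, EP) p) :
    h' (prW p) * S'.alpha0 Y (prW p) (mfderiv 𝓘(ℝ, EP) 𝓘(ℝ, EW) prW p u) =
      lam * (h (pr p) * S.alpha0 X (pr p) (mfderiv 𝓘(ℝ, EP) 𝓘(ℝ, E) pr p u)) - θ p u +
        lam * twistedConnection a pr θ p u := by
  have h1 := hM.a_eq (pr p) hX
  have h2 := hM.twist.a_ne_zero (pr p)
  have h3 := hM.lam_ne_zero
  -- Subtracting this multiple of X' makes `u` horizontal without changing its projection to W.
  have h4 := hM.alpha0_related (u - (θ p u / a (pr p)) • X' p) (by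
    rw [map_sub, map_smul, hM.twist.theta_lift, smul_eq_mul, div_mul_cancel₀ _ h2, sub_self])
  rw [map_sub, map_smul, hM.twist.quotient.mfderiv_generator, smul_zero, sub_zero,
    map_sub, map_smul, hM.twist.mfderiv_lift, map_sub, map_smul] at h4
  rw [h4, hh']
  change _ = lam * (h (pr p) * S.alpha0 X (pr p) (mfderiv 𝓘(ℝ, EP) 𝓘(ℝ, E) pr p u)) - θ p u +
        lam * ((a (pr p))⁻¹ * θ p u)
  change -lam ^ 2 * h (pr p) * (-(1 / lam) * (_ - (θ p u / a (pr p)) * S.normSq X (pr p))) = _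
  generalize S.alpha0 X (pr p) (mfderiv 𝓘(ℝ, EP) 𝓘(ℝ, E) pr p u) = α
  have h5 : lam * h (pr p) * S.normSq X (pr p) = a (pr p) - lam := by rw [h1]; ring
  field_simp
  linear_combination (-θ p u) * h5

lemma smoothVField : SmoothVField X := by
  obtain ⟨ξ, hξ, -⟩ := hM.action
  exact hξ.smoothVField

lemma smooth_smul_alpha0 : (OneForm.toForm fun x => h x • S.alpha0 X x).Smooth :=
  Form.smooth_of_smoothAt fun x =>
    ((S.alpha0_smooth hM.smoothVField).smoothAt x).fun_smul (hM.h_smooth x)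

/-- The differential of `pullback_alpha0`. -/
lemma pullback_d_alpha0 {h' : W → ℝ} (hh' : ∀ p, h' (prW p) = -lam ^ 2 * h (pr p))
    (hs : (OneForm.toForm fun w => h' w • S'.alpha0 Y w).Smooth) {p : P} (hX : X (pr p) ≠ 0) :
    ((OneForm.toForm fun w => h' w • S'.alpha0 Y w).d.pullback prW : Form EP P 2) p =
      lam • ((OneForm.toForm fun x => h x • S.alpha0 X x).d.pullback pr : Form EP P 2) p +
        ((-1 : ℝ) • θ.toForm.d p + lam • (twistedConnection a pr θ).toForm.d p) := by
  have hs' := hM.smooth_smul_alpha0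
  -- To be differentiated, the identity of one-forms is needed on a neighbourhood, which exists
  -- because X ≠ 0 is an open condition.
  have h1 : ∀ᶠ q in 𝓝 p, X (pr q) ≠ 0 := by
    obtain ⟨ξ, hξ, -⟩ := hM.action
    exact hM.twist.bundle.smooth.continuous.continuousAt
      (hξ.isOpen_generator_ne_zero.mem_nhds hX)
  have h2 : ∀ᶠ q in 𝓝 p,
      ((OneForm.toForm fun w => h' w • S'.alpha0 Y w).pullback prW : Form EP P 1) q =
        (lam • ((OneForm.toForm fun x => h x • S.alpha0 X x).pullback pr : Form EP P 1) +
          ((-1 : ℝ) • θ.toForm + lam • (twistedConnection a pr θ).toForm)) q := by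
    filter_upwards [h1] with q hq
    ext v
    refine (hM.pullback_alpha0 hh' hq (v 0)).trans ?_
    change _ = lam * (h (pr q) * S.alpha0 X (pr q) (mfderiv 𝓘(ℝ, EP) 𝓘(ℝ, E) pr q (v 0))) +
      ((-1) * θ q (v 0) + lam * twistedConnection a pr θ q (v 0))
    ring
  have h3 := (hs'.smoothAt (pr p)).pullback (hM.twist.bundle.smooth p)
  have h4 := hM.twist.theta_smooth.smoothAt p
  have h5 := hM.twist.twistedConnection_smooth.smoothAt p
  rw [← Form.d_pullback (hs.smoothAt (prW p)) (hM.twist.quotient.smooth p), Form.d_congr h2,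
    Form.d_add (h3.const_smul lam) ((h4.const_smul (-1)).add (h5.const_smul lam)),
    Form.d_add (h4.const_smul (-1)) (h5.const_smul lam), Form.d_const_smul, Form.d_const_smul,
    Form.d_const_smul, Form.d_pullback (hs'.smoothAt (pr p)) (hM.twist.bundle.smooth p)]

/-- The curvature condition for the inverse twist. -/
lemma curvature_inverse {h' : W → ℝ} (hhs : ContMDiff 𝓘(ℝ, EW) 𝓘(ℝ, ℝ) ∞ h')
    (hh' : ∀ p, h' (prW p) = -lam ^ 2 * h (pr p)) (hY : SmoothVField Y)
    {F' : Form EW W 2} (hFs : F'.Smooth)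
    (hF' : (F'.pullback prW : Form EP P 2) = (twistedConnection a pr θ).toForm.d) :
    ∃ σ' : Form EW W 2, ∀ w, Y w ≠ 0 → S'.IsStarThree Y h' σ' w ∧ σ'.d w = 0 ∧
      F' w = (1 / lam) • ((OneForm.toForm fun w => h' w • S'.alpha0 Y w).d w + σ' w) := by
  have ht := hM.twist
  have hl := hM.lam_ne_zero
  set ζ : Form EW W 1 := OneForm.toForm fun w => h' w • S'.alpha0 Y w with hζ
  have hs : ζ.Smooth := Form.smooth_of_smoothAt fun w =>
    ((S'.alpha0_smooth hY).smoothAt w).fun_smul (hhs w)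
  obtain ⟨σ, hσ⟩ := hM.F_eq
  -- σ' is solved from the required formula for F'; it is closed because F' pulls back to the exact
  -- form dθ'. The substance is that it equals *₃dh'.
  refine ⟨lam • F' + (-1 : ℝ) • ζ.d, fun w hw => ?_⟩
  obtain ⟨p, rfl⟩ := ht.quotient.surjective w
  have hX : X (pr p) ≠ 0 := fun h0 => hw (hM.generator_eq_zero h0)
  obtain ⟨⟨b₁, b₂, b₃, hb, hbσ⟩, -, hF⟩ := hσ (pr p) hX
  -- The power λ³ arises twice: from dh' ∼ -λ²dh with α ∼ -λα', and from σ' ∼ λσ with α∧β ∼ λ²α'∧β'.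
  refine ⟨⟨lam ^ 3 * b₁, lam ^ 3 * b₂, lam ^ 3 * b₃, fun u => ?_, fun u v => ?_⟩, ?_, ?_⟩
  · obtain ⟨u, hu, rfl⟩ := ht.exists_horizontal_quotient p u
    have h1 := dFun_comp_of_contMDiff hhs ht.quotient.smooth p u
    rw [show (fun p => h' (prW p)) = fun p => -lam ^ 2 * h (pr p) from funext hh',
      dFun_const_mul (f := fun p => h (pr p))
        ((hM.h_smooth.comp ht.bundle.smooth p).mdifferentiableAt (by simp)),
      ht.dFun_comp hM.h_smooth] at h1
    refine h1.symm.trans ?_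
    rw [hM.alphaI_related u hu, hM.alphaJ_related u hu, hM.alphaK_related u hu]
    refine (congrArg (-lam ^ 2 * ·) (hb _)).trans ?_
    field_simp
    ring
  · obtain ⟨u, hu, rfl⟩ := ht.exists_horizontal_quotient p u
    obtain ⟨v, hv, rfl⟩ := ht.exists_horizontal_quotient p v
    have h1 := DFunLike.congr_fun (hM.pullback_d_alpha0 hh' hs hX) ![u, v]
    rw [← Form.pullback_apply_two]
    have h2 : ((lam • F' + (-1 : ℝ) • ζ.d).pullback prW : Form EP P 2) p ![u, v] =
        lam * (F'.pullback prW : Form EP P 2) p ![u, v] +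
          (-1) * (ζ.d.pullback prW : Form EP P 2) p ![u, v] := rfl
    have h3 : (lam • ((OneForm.toForm fun x => h x • S.alpha0 X x).d.pullback pr : Form EP P 2) p +
        ((-1 : ℝ) • θ.toForm.d p + lam • (twistedConnection a pr θ).toForm.d p)) ![u, v] =
        lam * ((OneForm.toForm fun x => h x • S.alpha0 X x).d.pullback pr : Form EP P 2) p ![u, v] +
        ((-1) * θ.toForm.d p ![u, v] + lam * (twistedConnection a pr θ).toForm.d p ![u, v]) := rfl
    have h4 : ∀ z, F (pr p) z =
        lam * ((OneForm.toForm fun x => h x • S.alpha0 X x).d (pr p) z + σ (pr p) z) := fun z =>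
      DFunLike.congr_fun hF z
    rw [h2, h1, h3, hF', ht.curvature, h4, Form.pullback_apply_two, hbσ]
    simp only [wedge, hM.alphaI_related u hu, hM.alphaJ_related u hu, hM.alphaK_related u hu,
      hM.alphaI_related v hv, hM.alphaJ_related v hv, hM.alphaK_related v hv]
    field_simp
    ring
  · have h1 : F'.d (prW p) = 0 := by
      refine ht.quotient.form_eq_of_pullback_eq (η := F'.d) (ζ := 0) (p := p) ?_
      rw [← Form.d_pullback (hFs.smoothAt _) (ht.quotient.smooth p), hF',
        Form.d_d ht.twistedConnection_smooth]
      rfl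
    rw [Form.d_add ((hFs.smoothAt _).const_smul lam) ((hs.d.smoothAt _).const_smul (-1)),
      Form.d_const_smul, Form.d_const_smul, Form.d_d hs, h1, smul_zero, smul_zero, add_zero]
  · have key : ∀ f z : EW [⋀^Fin 2]→L[ℝ] ℝ,
        f = (1 / lam) • (z + (lam • f + (-1 : ℝ) • z)) := fun f z => by
      ext w
      change f w = 1 / lam * (z w + (lam * f w + -1 * z w))
      field_simp
      ring
    exact key _ _

lemma relEndo_inverse {A : Endo E M} {A' : Endo EW W} (hA : RelEndo θ pr prW A A') :
    RelEndo (twistedConnection a pr θ) prW pr A' A := by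
  intro p u hu
  obtain ⟨v, hv, hv1, hv2⟩ := hA p u ((hM.twist.twistedConnection_eq_zero_iff p u).1 hu)
  exact ⟨v, (hM.twist.twistedConnection_eq_zero_iff p v).2 hv, hv2, hv1⟩

lemma relVField_inverse {a' : W → ℝ} (ha' : ∀ p, a' (prW p) = (a (pr p))⁻¹) :
    RelVField (twistedConnection a pr θ) prW pr (fun w => -(1 / a' w) • Y w) X := by
  intro p
  obtain ⟨v, hv, hv1, hv2⟩ := hM.rel_X p
  have h2 := hM.twist.a_ne_zero (pr p)
  -- Since 1/a' is related to a, the field -Y/a' lifts to -a times the lift of -X/a, which is the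
  -- lift of X.
  refine ⟨-a (pr p) • v, ?_, ?_, ?_⟩
  · rw [hM.twist.twistedConnection_eq_zero_iff, map_smul, hv, smul_zero]
  · rw [map_smul, hv2]
    change _ = -(1 / a' (prW p)) • Y (prW p)
    rw [ha', one_div, inv_inv]
  · rw [map_smul, hv1]
    change -a (pr p) • -(1 / a (pr p)) • X (pr p) = _
    rw [smul_smul, show -a (pr p) * -(1 / a (pr p)) = 1 by field_simp, one_smul]

end TwistsVia

end HKTwist

end

/-! ### Assembly of the inverse twist. -/

theorem proposition5p2
    {E M EP P EW W : Type*}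
    [NormedAddCommGroup E] [NormedSpace ℝ E] [FiniteDimensional ℝ E]
    [TopologicalSpace M] [T2Space M] [SecondCountableTopology M]
    [ChartedSpace E M] [IsManifold 𝓘(ℝ, E) ∞ M]
    [NormedAddCommGroup EP] [NormedSpace ℝ EP] [FiniteDimensional ℝ EP]
    [TopologicalSpace P] [T2Space P] [SecondCountableTopology P]
    [ChartedSpace EP P] [IsManifold 𝓘(ℝ, EP) ∞ P]
    [NormedAddCommGroup EW] [NormedSpace ℝ EW] [FiniteDimensional ℝ EW]
    [TopologicalSpace W] [T2Space W] [SecondCountableTopology W]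
    [ChartedSpace EW W] [IsManifold 𝓘(ℝ, EW) ∞ W]
    (T TP TW : ℝ)
    (S : HKTwist.HyperKahler E M) (X : HKTwist.VField E M)
    (h : M → ℝ) (lam : ℝ) (a : M → ℝ) (F : HKTwist.Form E M 2)
    (pr : P → M) (Z : HKTwist.VField EP P) (θ : HKTwist.OneForm EP P)
    (X' : HKTwist.VField EP P) (prW : P → W)
    (S' : HKTwist.HyperKahler EW W) (Y : HKTwist.VField EW W)
    (hM : HKTwist.TwistsVia T TP TW S X h lam a F pr Z θ X' prW S' Y) :
    ∃ (h' : W → ℝ) (a' : W → ℝ) (F' : HKTwist.Form EW W 2) (θ' : HKTwist.OneForm EP P),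
      HKTwist.RelFun pr prW (fun x => -lam ^ 2 * h x) h' ∧
      HKTwist.RelFun pr prW (fun x => 1 / a x) a' ∧
      HKTwist.RelTwoForm θ pr prW (fun x => (1 / a x) • F x) F' ∧
      (∀ p v, θ' p v = 0 ↔ θ p v = 0) ∧
      HKTwist.TwistsVia (T * TP / TW) TW TP S' Y h' (1 / lam) a' F' prW X' θ' Z pr S X := by
  have ht := hM.twist
  have hconn := hM.connected
  have hP : ConnectedSpace P := ht.bundle.connectedSpace
  obtain ⟨h₀, hh₀, hh₀'⟩ := ht.exists_function_descent hM.h_smooth hM.dFun_h_generator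
  obtain ⟨a₀, ha₀, ha₀'⟩ := ht.exists_function_descent ht.a_smooth ht.dFun_generator
  obtain ⟨F', hF', hFs⟩ := ht.exists_curvature_descent
  have ha0 : ∀ w, a₀ w ≠ 0 := by
    intro w
    obtain ⟨p, rfl⟩ := ht.quotient.surjective w
    rw [ha₀']
    exact ht.a_ne_zero _
  have hhs : ContMDiff 𝓘(ℝ, EW) 𝓘(ℝ, ℝ) ∞ (fun w => -lam ^ 2 * h₀ w) :=
    (contDiff_const_smul (-lam ^ 2)).contMDiff.comp hh₀
  have hh' : ∀ p, -lam ^ 2 * h₀ (prW p) = -lam ^ 2 * h (pr p) := fun p => by rw [hh₀']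
  have has : ContMDiff 𝓘(ℝ, EW) 𝓘(ℝ, ℝ) ∞ (fun w => (a₀ w)⁻¹) := fun w =>
    (contDiffAt_inv ℝ (ha0 w)).contMDiffAt.comp w (ha₀ w)
  have haa' : ∀ p, (a₀ (prW p))⁻¹ = (a (pr p))⁻¹ := fun p => by rw [ha₀']
  have hact := ht.isTriholomorphicCircleAction hM.connected hM.action hM.rel_X hM.rel_g
    hM.rel_I hM.rel_J hM.rel_K
  -- The smoothness of Y is obtained from the induced circle action.
  have hY : HKTwist.SmoothVField Y := by
    obtain ⟨φ, hφ, -⟩ := hact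
    exact hφ.smoothVField
  refine ⟨fun w => -lam ^ 2 * h₀ w, fun w => (a₀ w)⁻¹, F', HKTwist.twistedConnection a pr θ,
    hh', fun p => (haa' p).trans (one_div _).symm, ht.relTwoForm_of_pullback hF',
    ht.twistedConnection_eq_zero_iff,
    ht.quotient.surjective.connectedSpace ht.quotient.smooth.continuous, hact, hhs,
    one_div_ne_zero hM.lam_ne_zero, hM.a_inverse hh' haa', hM.curvature_inverse hhs hh' hY hFs hF',
    ht.inverse hM.rel_X has haa' hFs hF' _, ?_, hM.relEndo_inverse hM.rel_I,
    hM.relEndo_inverse hM.rel_J, hM.relEndo_inverse hM.rel_K, hM.relVField_inverse haa'⟩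
  intro p u v hu hv
  exact hM.elemDeform_inverse hh' p u v ((ht.twistedConnection_eq_zero_iff p u).1 hu)
    ((ht.twistedConnection_eq_zero_iff p v).1 hv)
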